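/- Let $g$ be an element of order $r \ge 2$ in a finite group (for instance a generator of a cyclic group of order $r$), let $m,\ell$ be positive integers with $2^m > r$ and $2^{m+\ell} > r^2$ (for instance $\ell = m$), and put $n = m+\ell$. A single run of the quantum order-finding algorithm prepares the state $$\frac{1}{2^{n}} \sum_{a,\,j=0}^{2^{n}-1} e^{2\pi i a j/2^{n}}\, |j, g^a\rangle$$ and measures the first register, which yields a frequency $j \in \{0,\dots,2^n-1\}$. The classical post-processing, with parameters $B, c \ge 1$ and input $g, m, \ell, j$ (but not $r$), does the following. 1. For each of the frequencies $j' \in \{j, j\pm1,\dots,j\pm B\}$ (modulo $2^n$) it computes a candidate $\tilde r$, either as the denominator $q$ of the last convergent $p/q$ with $q < 2^{n/2}$ in the continued fraction expansion of $j'/2^n$, or as twice the absolute value of the second component of the shortest non-zero vector, found by Lagrange's algorithm, of the lattice spanned by $(j',\tfrac12)$ and $(2^n,0)$. 2. Optionally, it keeps only the candidates $\tilde r\in[1,2^m)$ with $g^{e\tilde r}=1$, where $e=\prod_{q} q^{\lfloor \log_q cm\rfloor}$ over the primes $q\le cm$. 3. From each candidate $\tilde r\in[1,2^m)$ it tries to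 find a multiple $d\tilde r$ with $g^{d\tilde r}=1$. To this end it raises $g^{\tilde r}$ to the powers $q^{\lfloor\log_q cm\rfloor}$ for primes $q\le cm$ and determines the exponents of the $q$ in $d$, either sequentially with a stack or by a binary tree search over the primes; it may signal failure. 4. It returns the least of the values $d\tilde r$ found. The following holds for each of these variants of the post-processing. (i) With $c=1$ and $B=m$, the probability that a single run returns $r$ tends to one as $r\to\infty$, uniformly in the group, in $g$, and in the admissible $m,\ell$: for every $\varepsilon>0$ there is an $R$ such that the probability is at least $1-\varepsilon$ whenever $r\ge R$. (ii) All algorithms involved execute in polynomial time with the same parameters, assuming that $m$ and $\ell$ are polynomially bounded in $\log r$ and that the group arithmetic is efficient. The state above is prepared, up to the order of the qubits of the first register, by an explicit circuit of Hadamard gates, controlled multiplications by $g^{2^i}$ and controlled phase rotations. If $m+\ell$ and the time of one group operation are bounded by $K(\log_2 r)^k$, then the total time of a run (construction and execution of the circuit, measurement, and post-processing of any observed $j$) is at most $K'(\log_2 r)^{k'}$, where $K'$ and $k'$ depend only on $K$ and $k$. Here one elementary gate takes unit time, and classical integer operations are charged by schoolbook bit costs. -/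

import Mathlib

universe u v

namespace OrderFinding

/-! ## Step counting

A `Timed α` is a result together with the number of bit operations and of group operations
(multiplications, and comparisons with the identity) spent on computing it. -/

structure Timed (α : Type u) where
  val : α
  bitOps : ℕ
  groupOps : ℕ

namespace Timed

def ret {α : Type u} (a : α) : Timed α := ⟨a, 1, 0⟩

def bind {α : Type u} {β : Type v} (x : Timed α) (f : α → Timed β) : Timed β :=
  ⟨(f x.val).val, x.bitOps + (f x.val).bitOps, x.groupOps + (f x.val).groupOps⟩

/-- Total time, if one group operation takes time `τ`. -/
def time {α : Type u} (τ : ℕ) (x : Timed α) : ℕ := x.bitOps + τ * x.groupOps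

@[simp] theorem val_ret {α : Type u} (a : α) : (ret a).val = a := rfl
@[simp] theorem bitOps_ret {α : Type u} (a : α) : (ret a).bitOps = 1 := rfl
@[simp] theorem groupOps_ret {α : Type u} (a : α) : (ret a).groupOps = 0 := rfl
@[simp] theorem val_bind {α : Type u} {β : Type v} (x : Timed α) (f : α → Timed β) :
    (x.bind f).val = (f x.val).val := rfl
@[simp] theorem bitOps_bind {α : Type u} {β : Type v} (x : Timed α) (f : α → Timed β) :
    (x.bind f).bitOps = x.bitOps + (f x.val).bitOps := rfl
@[simp] theorem groupOps_bind {α : Type u} {β : Type v} (x : Timed α) (f : α → Timed β) :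
    (x.bind f).groupOps = x.groupOps + (f x.val).groupOps := rfl

end Timed

open Timed

/-- Bit cost of one integer operation (addition, subtraction, comparison, multiplication,
division with remainder) on operands of the sizes of `a` and `b`, by the schoolbook methods. -/
def opCost (a b : ℕ) : ℕ := (a.size + 1) * (b.size + 1)

/-- The value `x` of an integer operation on the operands `a` and `b`. -/
def op {α : Type u} (a b : ℕ) (x : α) : Timed α := ⟨x, opCost a b, 0⟩

/-- The value `x` of an operation on the signed operands `a` and `b`. -/
def iop {α : Type u} (a b : ℤ) (x : α) : Timed α := op a.natAbs b.natAbs x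

/-- The list `[s, s + 1, …, s + k - 1]`. -/
def rangeT (s k : ℕ) : Timed (List ℕ) := ⟨List.range' s k, k * ((s + k).size + 1) + 1, 0⟩

def mapT {α : Type u} {β : Type v} (f : α → Timed β) : List α → Timed (List β)
  | [] => ret []
  | a :: l => (f a).bind fun b => (mapT f l).bind fun t => ret (b :: t)

def filterT {α : Type u} (p : α → Timed Bool) : List α → Timed (List α)
  | [] => ret []
  | a :: l => (p a).bind fun b => (filterT p l).bind fun t => ret (if b then a :: t else t)

/-! ## Arithmetic in the group -/

section GroupOps

variable {G : Type u} [Group G]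

def gmul (x y : G) : Timed G := ⟨x * y, 0, 1⟩

def isOne [DecidableEq G] (x : G) : Timed Bool := ⟨decide (x = 1), 0, 1⟩

/-- Square-and-multiply; the exponent is given by its bits, least significant bit first. -/
def powBits (x : G) : List Bool → Timed G
  | [] => ret 1
  | b :: bs => (powBits x bs).bind fun y => (gmul y y).bind fun z =>
      if b then gmul z x else ret z

def gpow (x : G) (k : ℕ) : Timed G := powBits x k.bits

end GroupOps

/-! ## The primes up to `N` and their largest powers up to `N` -/

def noDivisor (q : ℕ) : List ℕ → Timed Bool
  | [] => ret true
  | d :: ds => (op q d (decide (d ∣ q))).bind fun b => if b then ret false else noDivisor q ds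

/-- The primes `q ≤ N` in increasing order, by trial division. -/
def primesUpTo (N : ℕ) : Timed (List ℕ) :=
  (rangeT 2 (N - 1)).bind fun l =>
    filterT (fun q => (rangeT 2 (q - 2)).bind fun ds => noDivisor q ds) l

def maxPowLoop (N q : ℕ) : ℕ → ℕ → ℕ → Timed (ℕ × ℕ)
  | 0, e, p => ret (e, p)
  | i + 1, e, p => (op p q (p * q)).bind fun p' => (op p' N (decide (p' ≤ N))).bind fun b =>
      if b then maxPowLoop N q i (e + 1) p' else ret (e, p)

/-- The pair `(e, q ^ e)` for `e = ⌊log_q N⌋`. -/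
def maxPow (N q : ℕ) : Timed (ℕ × ℕ) := maxPowLoop N q N.size 0 1

/-- `∏ q ^ ⌊log_q N⌋` over the primes `q` in the list. -/
def prodMaxPow (N : ℕ) : List ℕ → Timed ℕ
  | [] => ret 1
  | q :: qs => (maxPow N q).bind fun ep => (prodMaxPow N qs).bind fun k => op ep.2 k (ep.2 * k)

/-! ## From a frequency `j` to a candidate for `r / gcd (r, z)` -/

/-- Euclid's algorithm on `(a, b)`, together with the denominators `q₂, q₁` of the two latest
convergents; stops at the last convergent whose denominator `q` satisfies `q ^ 2 < M`. -/
def cfLoop (M a b q₂ q₁ : ℕ) : Timed ℕ :=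
  if _h : b = 0 then ret q₁
  else
    (op a b (a / b)).bind fun t => (op t q₁ (t * q₁)).bind fun s => (op s q₂ (s + q₂)).bind fun q =>
      (op q q (q * q)).bind fun qq => (op qq M (decide (qq < M))).bind fun c =>
        if c then cfLoop M b (a % b) q₁ q else ret q₁
termination_by b
decreasing_by exact Nat.mod_lt _ (Nat.pos_of_ne_zero _h)

/-- The denominator of the last convergent `p / q` with `q < 2 ^ (n / 2)` in the continued fraction
expansion of `j / 2 ^ n`. -/
def cfSolve (n j : ℕ) : Timed ℕ := cfLoop (2 ^ n) j (2 ^ n) 1 0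

/-- The pair `(a, k)` of integers stands for the vector `(a, k / 2)`; this is four times the square
of its Euclidean norm. -/
def sqNorm (x : ℤ × ℤ) : ℕ := 4 * x.1.natAbs ^ 2 + x.2.natAbs ^ 2

def sqNormT (x : ℤ × ℤ) : Timed ℕ :=
  (iop x.1 x.1 (x.1.natAbs ^ 2)).bind fun s => (iop x.2 x.2 (x.2.natAbs ^ 2)).bind fun t =>
    (op 4 s (4 * s)).bind fun s' => op s' t (s' + t)

/-- Four times the inner product of two vectors. -/
def innerT (x y : ℤ × ℤ) : Timed ℤ :=
  (iop x.1 y.1 (x.1 * y.1)).bind fun s => (iop x.2 y.2 (x.2 * y.2)).bind fun t =>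
    (iop 4 s (4 * s)).bind fun s' => iop s' t (s' + t)

/-- `y - t • x`, for `t` the integer closest to `⟨x, y⟩ / ⟨x, x⟩`. -/
def reduceT (x y : ℤ × ℤ) : Timed (ℤ × ℤ) :=
  (innerT x y).bind fun p => (sqNormT x).bind fun s =>
    (iop 2 p (2 * p)).bind fun p' => (iop p' s (p' + (s : ℤ))).bind fun a =>
      (iop 2 s (2 * (s : ℤ))).bind fun b => (iop a b (a / b)).bind fun t =>
        (iop t x.1 (t * x.1)).bind fun c₁ => (iop t x.2 (t * x.2)).bind fun c₂ =>
          (iop y.1 c₁ (y.1 - c₁)).bind fun d₁ => (iop y.2 c₂ (y.2 - c₂)).bind fun d₂ =>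
            ret (d₁, d₂)

/-- Lagrange's reduction of the basis `(x, y)`; returns the first vector of the reduced basis. -/
def lagrange (x y : ℤ × ℤ) : Timed (ℤ × ℤ) :=
  (reduceT x y).bind fun z => (sqNormT z).bind fun s => (sqNormT x).bind fun s' =>
    (op s s' ()).bind fun _ =>
      if _h : sqNorm z < sqNorm x then lagrange z x else ret x
termination_by sqNorm x

/-- Twice the second component, up to sign, of the shortest non-zero vector of the lattice
spanned by `(j, 1 / 2)` and `(2 ^ n, 0)`. -/
def latticeSolve (n j : ℕ) : Timed ℕ :=
  (lagrange ((j : ℤ), 1) ((2 : ℤ) ^ n, 0)).bind fun x => ret x.2.natAbs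

/-! ## From a candidate `t` for `r / d` to `r`, where `d` is `N`-smooth -/

section Recover

variable {G : Type u} [Group G] [DecidableEq G]

def inRange (m t : ℕ) : Timed Bool := op t (2 ^ m) (decide (1 ≤ t ∧ t < 2 ^ m))

/-- Raises `x` to the powers `q ^ ⌊log_q N⌋` one after the other until the identity is reached,
pushing the triples `(x, q, ⌊log_q N⌋)` onto the stack. -/
def climb (N : ℕ) : List ℕ → G → List (G × ℕ × ℕ) → Timed (G × List (G × ℕ × ℕ))
  | [], x, S => ret (x, S)
  | q :: qs, x, S => (maxPow N q).bind fun ep => (gpow x ep.2).bind fun y => (isOne y).bind fun b =>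
      if b then ret (y, (x, q, ep.1) :: S) else climb N qs y ((x, q, ep.1) :: S)

def peel (q : ℕ) : ℕ → G → ℕ → Timed ℕ
  | 0, _, d => ret d
  | i + 1, x, d => (isOne x).bind fun b =>
      if b then ret d
      else (gpow x q).bind fun y => (op d q (d * q)).bind fun d' => peel q i y d'

def backtrack : List (G × ℕ × ℕ) → ℕ → Timed ℕ
  | [], d => ret d
  | (x, q, e) :: S, d => (gpow x d).bind fun y => (peel q e y d).bind fun d' => backtrack S d'

/-- Recovery of `r` from `t` with a stack; `none` signals failure. -/
def recoverStack (N m : ℕ) (primes : List ℕ) (g : G) (t : ℕ) : Timed (Option ℕ) :=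
  (inRange m t).bind fun b =>
    if b then
      (gpow g t).bind fun x => (isOne x).bind fun b₁ =>
        if b₁ then ret (some t)
        else (climb N primes x []).bind fun yS => (isOne yS.1).bind fun b₂ =>
          if b₂ then (backtrack yS.2 1).bind fun d => op d t (some (d * t))
          else ret none
    else ret none

/-- The recursion of the binary tree search. -/
def tree (N : ℕ) (F : List ℕ) (x : G) : Timed (List (ℕ × G)) :=
  match F with
  | [] => ret []
  | [q] => ret [(q, x)]
  | q₁ :: q₂ :: qs =>
      let F' := q₁ :: q₂ :: qs
      (prodMaxPow N (F'.drop (F'.length / 2))).bind fun dL =>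
        (prodMaxPow N (F'.take (F'.length / 2))).bind fun dR =>
          (gpow x dL).bind fun xL => (gpow x dR).bind fun xR =>
            (tree N (F'.take (F'.length / 2)) xL).bind fun TL =>
              (tree N (F'.drop (F'.length / 2)) xR).bind fun TR =>
                ⟨TL ++ TR, F'.length, 0⟩
termination_by F.length
decreasing_by all_goals (simp; omega)

/-- Multiplies `d` by `q` and raises `x` to the power `q` until `x = 1`, at most `i` times; `none`
if `x = 1` is not reached. -/
def treePeel (q : ℕ) : ℕ → G → ℕ → Timed (Option ℕ)
  | 0, x, d => (isOne x).bind fun b => ret (if b then some d else none)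
  | i + 1, x, d => (isOne x).bind fun b =>
      if b then ret (some d)
      else (gpow x q).bind fun y => (op d q (d * q)).bind fun d' => treePeel q i y d'

def treeCollect (N : ℕ) : List (ℕ × G) → ℕ → Timed (Option ℕ)
  | [], d => ret (some d)
  | (q, x) :: T, d => (maxPow N q).bind fun ep => (treePeel q ep.1 x d).bind fun o =>
      match o with
      | none => ret none
      | some d' => treeCollect N T d'

/-- Recovery of `r` from `t` with a binary tree search; `none` signals failure. -/
def recoverTree (N m : ℕ) (primes : List ℕ) (g : G) (t : ℕ) : Timed (Option ℕ) :=
  (inRange m t).bind fun b =>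
    if b then
      (gpow g t).bind fun x => (tree N primes x).bind fun T => (treeCollect N T 1).bind fun o =>
        match o with
        | none => ret none
        | some d => op d t (some (d * t))
    else ret none

/-- Keeps the candidates `t` in `[1, 2 ^ m)` with `(g ^ e) ^ t = 1` for `e = ∏ q ^ ⌊log_q N⌋`. -/
def filterCandidates (N m : ℕ) (primes : List ℕ) (g : G) (S : List ℕ) : Timed (List ℕ) :=
  (prodMaxPow N primes).bind fun e => (gpow g e).bind fun x =>
    filterT (fun t => (inRange m t).bind fun b =>
      if b then (gpow x t).bind fun y => isOne y else ret false) S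

/-- The least of the candidates that are not `none`. -/
def minimumT : List (Option ℕ) → Timed (Option ℕ)
  | [] => ret none
  | none :: l => (minimumT l).bind fun o => ret o
  | some a :: l => (minimumT l).bind fun o =>
      match o with
      | none => ret (some a)
      | some b => op a b (some (min a b))

end Recover

/-! ## The classical post-processing -/

/-- Continued fractions-based or lattice-based post-processing. -/
inductive Solver
  | continuedFractions
  | lattice

/-- Recovery of `r` from the candidates with a stack or with a binary tree search. -/
inductive Recovery
  | stack
  | tree

/-- A variant of the post-processing; `filter` tells whether the candidates are first filtered. -/
structure Variant where
  solver : Solver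
  recovery : Recovery
  filter : Bool

def solve : Solver → ℕ → ℕ → Timed ℕ
  | .continuedFractions => cfSolve
  | .lattice => latticeSolve

/-- The frequencies `j, j ± 1, …, j ± B`, reduced modulo `2 ^ n`. -/
def neighbours (n B j : ℕ) : Timed (List ℕ) :=
  (rangeT 0 (2 * B + 1)).bind fun l =>
    mapT (fun s => (iop j B ((j : ℤ) - B)).bind fun a => (iop a s (a + (s : ℤ))).bind fun b =>
      iop b (2 ^ n) (b % (2 : ℤ) ^ n).toNat) l

section PostProcess

variable {G : Type u} [Group G] [DecidableEq G]

def recover : Recovery → ℕ → ℕ → List ℕ → G → ℕ → Timed (Option ℕ)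
  | .stack => recoverStack
  | .tree => recoverTree

/-- The post-processing of an observed frequency `j`, given `g`, `c`, `B`, `m` and `ℓ`: solve all
frequencies at distance at most `B` from `j`, recover candidates for the order by removing `c * m`-smooth cofactors, and return the least. -/
def postProcess (V : Variant) (g : G) (c B m ℓ j : ℕ) : Timed (Option ℕ) :=
  (op c m (c * m)).bind fun N => (primesUpTo N).bind fun primes =>
    (neighbours (m + ℓ) B j).bind fun js => (mapT (solve V.solver (m + ℓ)) js).bind fun S =>
      (if V.filter then filterCandidates N m primes g S else ret S).bind fun S' =>
        (mapT (recover V.recovery N m primes g) S').bind fun rs => minimumT rs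

end PostProcess

/-! ## The quantum part -/

section Quantum

variable {G : Type u} [Group G]

/-- The amplitude of `|j, x⟩` in the state
`2 ^ (-n) * ∑_{a, j = 0}^{2 ^ n - 1} exp (2 π i a j / 2 ^ n) |j, g ^ a⟩`. -/
noncomputable def amplitude [DecidableEq G] (n : ℕ) (g : G) (j : ℕ) (x : G) : ℂ :=
  (1 / 2 ^ n) * ∑ a ∈ Finset.range (2 ^ n),
    if g ^ a = x then Complex.exp (2 * Real.pi * Complex.I / 2 ^ n * (a * j)) else 0

/-- The probability of observing the frequency `j` when the first register is measured. -/
noncomputable def freqProb [DecidableEq G] [Fintype G] (n : ℕ) (g : G) (j : ℕ) : ℝ :=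
  ∑ x : G, ‖amplitude n g j x‖ ^ 2

/-- The probability that a single run (one measurement, followed by the post-processing) returns
the order of `g`. -/
noncomputable def successProb [DecidableEq G] [Fintype G] (V : Variant) (g : G) (c B m ℓ : ℕ) : ℝ :=
  ∑ j ∈ Finset.range (2 ^ (m + ℓ)) with (postProcess V g c B m ℓ j).val = some (orderOf g),
    freqProb (m + ℓ) g j

/-- Elementary gates on `n` qubits and one register that holds a group element: a Hadamard gate; a
rotation by `2 π / 2 ^ d` controlled by two qubits; a multiplication by the known group element
`h`, controlled by one qubit. -/
inductive Gate (n : ℕ) (G : Type u)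
  | hadamard (i : Fin n)
  | cphase (i k : Fin n) (d : ℕ)
  | cmul (i : Fin n) (h : G)

/-- Amplitudes in the computational basis `|b, x⟩`. -/
abbrev QState (n : ℕ) (G : Type u) := (Fin n → Fin 2) → G → ℂ

noncomputable def Gate.apply {n : ℕ} : Gate n G → QState n G → QState n G
  | .hadamard i, ψ => fun b x =>
      (1 / (Real.sqrt 2 : ℂ)) *
        ∑ s : Fin 2, (-1) ^ ((b i).val * s.val) * ψ (Function.update b i s) x
  | .cphase i k d, ψ => fun b x =>
      Complex.exp (2 * Real.pi * Complex.I * ((b i).val * (b k).val) / 2 ^ d) * ψ b x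
  | .cmul i h, ψ => fun b x => ψ b (x * (h ^ (b i).val)⁻¹)

/-- Time of one gate, if one group operation takes time `τ`. -/
def Gate.time {n : ℕ} (τ : ℕ) : Gate n G → ℕ
  | .hadamard _ => 1
  | .cphase _ _ _ => 1
  | .cmul _ _ => 1 + τ

/-- The state `|0, 1⟩`. -/
def initial [DecidableEq G] (n : ℕ) : QState n G := fun b x => if b = 0 ∧ x = 1 then 1 else 0

noncomputable def runGates {n : ℕ} (C : List (Gate n G)) (ψ : QState n G) : QState n G :=
  C.foldl (fun φ γ => γ.apply φ) ψ

/-- The quantum Fourier transform, up to the order of the qubits. -/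
def qft (n : ℕ) (G : Type u) : List (Gate n G) :=
  (List.finRange n).reverse.flatMap fun i =>
    Gate.hadamard i :: ((List.finRange n).filter fun k => k < i).map fun k =>
      Gate.cphase k i (i.val - k.val + 1)

/-- Controlled multiplications by `h, h ^ 2, h ^ 4, …`, precomputed by squaring. -/
def cmulGates {n : ℕ} : List (Fin n) → G → Timed (List (Gate n G))
  | [], _ => ret []
  | i :: is, h => (gmul h h).bind fun h' => (cmulGates is h').bind fun C => ret (Gate.cmul i h :: C)

/-- The circuit of the order-finding algorithm: a uniform superposition of exponents `a`, the
exponentiation `|a, 1⟩ ↦ |a, g ^ a⟩` with bit `i` of `a` in qubit `i`, and the Fourier transform. -/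
def circuit (n : ℕ) (g : G) : Timed (List (Gate n G)) :=
  (cmulGates (List.finRange n) g).bind fun C =>
    ⟨(List.finRange n).map Gate.hadamard ++ C ++ qft n G, n + C.length + (qft n G).length, 0⟩

/-- The frequency read off the qubits after the Fourier transform (most significant bit in
qubit `0`). -/
def readout {n : ℕ} (b : Fin n → Fin 2) : ℕ := ∑ i, (b i).val * 2 ^ (n - 1 - i.val)

/-- The time of a single run in which the frequency `j` is observed, if one group operation takes
time `τ`: the construction of the circuit, its execution, the measurement of `m + ℓ` qubits, and
the post-processing. -/
def runTime [DecidableEq G] (V : Variant) (τ : ℕ) (g : G) (c B m ℓ j : ℕ) : ℕ :=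
  (circuit (m + ℓ) g).time τ + ((circuit (m + ℓ) g).val.map (Gate.time τ)).sum + (m + ℓ)
    + (postProcess V g c B m ℓ j).time τ

end Quantum

end OrderFinding

/-!
The three claims are independent of each other.

*The circuit.* The Hadamard gates and the controlled multiplications turn `|0, 1⟩` into the uniform
superposition of the states `|a, g ^ a⟩` (`runGates_hadamard`, `runGates_cmulGates`). The gates of
the Fourier transform are processed target by target. After the targets in a set `S`, the amplitude
at `b` is a sum over the bit strings `a` that agree with `b` outside `S`, weighted by one phase for
each target in `S` (`partialFourier`, `runGates_qft_step`). When all targets are done, the phases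
multiply to `exp (2 π i a j / 2 ^ n)`: of the products of bit `k` of `a` with the bit of `j` in
qubit `i`, those with `k = i` are supplied by the Hadamard gates, those with `k < i` by the
rotations, and those with `k > i` amount to whole turns (`prod_qftPhase`).

*The success probability.* Let `r` be the order of `g`, let `M = 2 ^ n`, and call the frequency
closest to `z * M / r` the peak of index `z`. The amplitudes are geometric sums, so a frequency at
distance `t` from the closest peak is observed with probability at most `4 / r`, and at most
`1 / (r * t ^ 2)` if `t ≠ 0` (`freqProb_le_peakWeight`). By Parseval's identity the probabilities
add up to one (`sum_freqProb`), so it suffices to bound the probability of failure from above.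

If the observed frequency is within distance `m` of the peak of index `z`, that peak is one of the
frequencies solved. It is so close to `z * M / r`, and `r ^ 2 < M`, that either solver returns
`r / gcd (r, z)` from it (`val_cfSolve`, `val_latticeSolve`). The stack and the tree search both
compute the order of `g ^ t` for every candidate `t` for which `g ^ t` has smooth order, and drop
the others (`val_recover`). Hence all values returned are multiples of `r`, and the least one is `r`
as soon as `gcd (r, z)` divides the smooth bound `∏ q ^ ⌊log_q m⌋` (`postProcess_eq_orderOf`). There
are few indices for which it does not: then a prime power greater than `m` divides both `r` and `z`.
As `r < 2 ^ m`, fewer than `m / log₂ m` primes `q` have such a power dividing `r`, and each of these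
powers divides at most `r / m` indices, so that at most `r / log₂ m` indices are bad
(`card_unsmooth_mul_log_le`). The frequencies that belong to the bad indices, to the indices `0` and
`r`, or that are at distance more than `m` from the closest peak have total probability
`O (1 / log m + 1 / r + 1 / m)` (`one_sub_le_successProb`), which tends to zero because
`m > log₂ r`.

*The running time.* All numbers that occur have fewer than `U = (n + 10) ^ 2` bits, so each integer
operation costs at most `U ^ 2`. Every loop is bounded by the length of a list or by the size of an
exponent, except those of the two solvers. In Euclid's algorithm each division halves the product of
the two remainders (`cfLoop_spec`); in Lagrange's algorithm a reduction that does not shrink the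
squared norm by a factor of three is followed by the end of the algorithm
(`sqNorm_le_sqNorm_reduceT`). Altogether the post-processing costs at most `U ^ 11` bit and group
operations (`costLe_postProcess`).
-/

namespace OrderFinding
open Timed

/-! ### Integer and group arithmetic -/

section Group
variable {G : Type u} [Group G]

theorem val_powBits (x : G) (l : List Bool) :
    (powBits x l).val = x ^ l.foldr Nat.bit 0 := by
  induction l with
  | nil => simp [powBits]
  | cons b l ih =>
    cases b <;> simp [powBits, gmul, ih, Nat.bit, pow_add, two_mul]

theorem foldr_bit_bits (k : ℕ) : k.bits.foldr Nat.bit 0 = k := by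
  induction k using Nat.binaryRec' with
  | zero => simp
  | bit b n h ih => rw [Nat.bits_append_bit _ _ h]; simp [ih]

@[simp] theorem val_gpow (x : G) (k : ℕ) : (gpow x k).val = x ^ k := by
  rw [gpow, val_powBits, foldr_bit_bits]

@[simp] theorem val_gmul (x y : G) : (gmul x y).val = x * y := rfl

@[simp] theorem val_isOne [DecidableEq G] (x : G) : (isOne x).val = decide (x = 1) := rfl

end Group

@[simp] theorem val_op {α : Type u} (a b : ℕ) (x : α) : (op a b x).val = x := rfl
@[simp] theorem val_iop {α : Type u} (a b : ℤ) (x : α) : (iop a b x).val = x := rfl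
@[simp] theorem val_rangeT (s k : ℕ) : (rangeT s k).val = List.range' s k := rfl

@[simp] theorem val_mapT {α : Type u} {β : Type v} (f : α → Timed β) (l : List α) :
    (mapT f l).val = l.map fun a => (f a).val := by
  induction l <;> simp [mapT, *]

@[simp] theorem val_filterT {α : Type u} (p : α → Timed Bool) (l : List α) :
    (filterT p l).val = l.filter fun a => (p a).val := by
  induction l with
  | nil => rfl
  | cons a l ih => simp [filterT, ih, List.filter_cons]

/-! ### Primes and their powers -/

theorem val_noDivisor (q : ℕ) (l : List ℕ) :
    (noDivisor q l).val = true ↔ ∀ d ∈ l, ¬ d ∣ q := by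
  induction l with
  | nil => simp [noDivisor]
  | cons d l ih => by_cases h : d ∣ q <;> simp [noDivisor, h, ih]

theorem mem_primesUpTo {N q : ℕ} : q ∈ (primesUpTo N).val ↔ q.Prime ∧ q ≤ N := by
  simp only [primesUpTo, val_bind, val_rangeT, val_filterT, List.mem_filter, List.mem_range'_1,
    val_noDivisor]
  constructor
  · rintro ⟨⟨h₁, h₂⟩, h₃⟩
    refine ⟨Nat.prime_def.2 ⟨h₁, fun d hd => ?_⟩, by omega⟩
    have h₀ := Nat.le_of_dvd (by omega) hd
    have h₄ := h₃ d
    have : 0 < d := Nat.pos_of_dvd_of_pos hd (by omega)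
    by_contra! h
    exact h₄ ⟨by omega, by omega⟩ hd
  · rintro ⟨hq, hN⟩
    have := hq.two_le
    refine ⟨⟨this, by omega⟩, fun d hd hdq => ?_⟩
    rcases (Nat.dvd_prime hq).1 hdq with h | h <;> omega

theorem nodup_primesUpTo (N : ℕ) : (primesUpTo N).val.Nodup := by
  simp only [primesUpTo, val_bind, val_rangeT, val_filterT]
  exact List.Nodup.filter _ (List.nodup_range' (step := 1))

theorem length_primesUpTo_le (N : ℕ) : (primesUpTo N).val.length ≤ N := by
  simp only [primesUpTo, val_bind, val_rangeT, val_filterT]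
  refine (List.length_filter_le _ _).trans ?_
  simp

theorem val_maxPowLoop {N q : ℕ} (hq : 2 ≤ q) (i e : ℕ) (h : q ^ e ≤ N) (h' : N < q ^ (e + i)) :
    (maxPowLoop N q i e (q ^ e)).val = (Nat.log q N, q ^ Nat.log q N) := by
  induction i generalizing e with
  | zero => simp at h'; omega
  | succ i ih =>
    by_cases hb : q ^ e * q ≤ N
    · have := ih (e + 1) (by rwa [pow_succ]) (by rwa [add_assoc, add_comm 1 i])
      rw [pow_succ] at this
      simpa [maxPowLoop, hb] using this
    · have : Nat.log q N = e := by
        have h0 : N ≠ 0 := by have := Nat.pow_pos (n := e) (show 0 < q by omega); omega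
        rw [Nat.log_eq_iff (Or.inr ⟨by omega, h0⟩)]
        exact ⟨h, by rw [pow_succ]; omega⟩
      simp [maxPowLoop, hb, this]

theorem val_maxPow {N q : ℕ} (hN : 1 ≤ N) (hq : 2 ≤ q) :
    (maxPow N q).val = (Nat.log q N, q ^ Nat.log q N) := by
  have := val_maxPowLoop (N := N) hq N.size 0 (by simpa) (by
    rw [zero_add]; exact (Nat.lt_size_self N).trans_le (Nat.pow_le_pow_left hq _))
  simpa [maxPow] using this

/-- The product of the largest powers `q ^ ⌊log_q N⌋` of the elements `q` of a list. -/
def smoothBound (N : ℕ) (F : List ℕ) : ℕ := (F.map fun q => q ^ Nat.log q N).prod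

@[simp] theorem smoothBound_nil (N : ℕ) : smoothBound N [] = 1 := rfl
@[simp] theorem smoothBound_cons (N q : ℕ) (F : List ℕ) :
    smoothBound N (q :: F) = q ^ Nat.log q N * smoothBound N F := by simp [smoothBound]
theorem smoothBound_append (N : ℕ) (F F' : List ℕ) :
    smoothBound N (F ++ F') = smoothBound N F * smoothBound N F' := by simp [smoothBound]

theorem dvd_smoothBound {N q : ℕ} {F : List ℕ} (h : q ∈ F) :
    q ^ Nat.log q N ∣ smoothBound N F :=
  List.dvd_prod (List.mem_map_of_mem (f := fun q => q ^ Nat.log q N) h)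

theorem val_prodMaxPow {N : ℕ} (hN : 1 ≤ N) {F : List ℕ} (hF : ∀ q ∈ F, 2 ≤ q) :
    (prodMaxPow N F).val = smoothBound N F := by
  induction F with
  | nil => simp [prodMaxPow]
  | cons q F ih =>
    simp only [List.mem_cons, forall_eq_or_imp] at hF
    simp [prodMaxPow, ih hF.2, val_maxPow hN hF.1]

/-! ### Recovery of the order from a candidate -/

section Tree

variable {G : Type u} [Group G]

/-- The tree search raises `x` to the cofactor of each prime power in the smooth bound. -/
theorem val_tree {N : ℕ} (hN : 1 ≤ N) {F : List ℕ} (hF : ∀ q ∈ F, q.Prime) (x : G) :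
    (tree N F x).val = F.map fun q => (q, x ^ (smoothBound N F / q ^ Nat.log q N)) := by
  induction F, x using tree.induct with
  | case1 => simp [tree]
  | case2 x q =>
    have := Nat.pow_pos (n := Nat.log q N) (hF q (by simp)).pos
    simp [tree, Nat.div_self this]
  | case3 x q₁ q₂ qs F' ih₁ ih₂ =>
    have hF' : ∀ q ∈ F', q.Prime := hF
    have ht : ∀ q ∈ F'.take (F'.length / 2), q.Prime := fun q h => hF' q (List.mem_of_mem_take h)
    have hd : ∀ q ∈ F'.drop (F'.length / 2), q.Prime := fun q h => hF' q (List.mem_of_mem_drop h)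
    have hE : smoothBound N F' = smoothBound N (F'.take (F'.length / 2)) *
        smoothBound N (F'.drop (F'.length / 2)) := by
      rw [← smoothBound_append, List.take_append_drop]
    have e : F'.map (fun q => (q, x ^ (smoothBound N F' / q ^ Nat.log q N))) =
        (F'.take (F'.length / 2)).map (fun q => (q, x ^ (smoothBound N F' / q ^ Nat.log q N))) ++
        (F'.drop (F'.length / 2)).map (fun q => (q, x ^ (smoothBound N F' / q ^ Nat.log q N))) := by
      rw [← List.map_append, List.take_append_drop]
    change (tree N F' x).val = _
    rw [show tree N F' x = _ from tree.eq_3 N x q₁ q₂ qs]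
    refine Eq.trans ?_ e.symm
    simp only [val_bind, val_gpow] at ih₁ ih₂ ⊢
    change (tree N (F'.take (F'.length / 2)) (x ^ (prodMaxPow N (F'.drop (F'.length / 2))).val)).val
      ++ (tree N (F'.drop (F'.length / 2)) (x ^ (prodMaxPow N (F'.take (F'.length / 2))).val)).val
      = _
    rw [val_prodMaxPow hN fun q h => (ht q h).two_le, val_prodMaxPow hN fun q h => (hd q h).two_le,
      ih₁ _ ht, ih₂ _ hd]
    congr 1
    · refine List.map_congr_left fun q hq => ?_
      rw [← pow_mul, hE, mul_comm (smoothBound N (List.take _ _)),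
        Nat.mul_div_assoc _ (dvd_smoothBound hq)]
    · refine List.map_congr_left fun q hq => ?_
      rw [← pow_mul, hE, Nat.mul_div_assoc _ (dvd_smoothBound hq)]

/-- If `x ^ E = 1`, for `E` a product of powers of distinct primes, then the order of `x` is the
product of its prime-power parts, each of which is the order of a power of `x`. -/
theorem prod_orderOf_pow {N : ℕ} {F : List ℕ} (hF : ∀ q ∈ F, q.Prime) (hF' : F.Nodup) {x : G}
    (hx : x ^ smoothBound N F = 1) :
    (F.map fun q => orderOf (x ^ (smoothBound N F / q ^ Nat.log q N))).prod = orderOf x := by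
  have hdvd := orderOf_dvd_of_pow_eq_one hx
  have hE0 : smoothBound N F ≠ 0 := by
    refine List.prod_ne_zero fun h => ?_
    obtain ⟨q, hq, h⟩ := List.mem_map.1 h
    exact (Nat.pow_pos (n := Nat.log q N) (hF q hq).pos).ne' h
  have ho : orderOf x ≠ 0 := fun h => hE0 (by simpa [h] using hdvd)
  have key : ∀ q ∈ F, orderOf (x ^ (smoothBound N F / q ^ Nat.log q N)) =
      q ^ (orderOf x).factorization q := by
    intro q hq
    have hq' := hF q hq
    have hdiv : smoothBound N F / q ^ Nat.log q N = smoothBound N (F.erase q) := by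
      have : smoothBound N F = q ^ Nat.log q N * smoothBound N (F.erase q) := by
        rw [← smoothBound_cons]
        exact ((List.perm_cons_erase hq).map _).prod_eq
      rw [this, Nat.mul_div_cancel_left _ (Nat.pow_pos hq'.pos)]
    have hcop : ∀ k, Nat.Coprime (q ^ k) (smoothBound N (F.erase q)) := by
      intro k
      refine Nat.Coprime.pow_left k ?_
      rw [smoothBound, Nat.coprime_list_prod_right_iff]
      intro n hn
      obtain ⟨p, hp, rfl⟩ := List.mem_map.1 hn
      rw [hF'.mem_erase_iff] at hp
      exact ((Nat.coprime_primes hq' (hF p hp.2)).2 hp.1.symm).pow_right _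
    -- `w` is the part of the order that is prime to `q`; it is the gcd with the cofactor of `q`
    have hw : orderOf x = q ^ (orderOf x).factorization q *
        (orderOf x / q ^ (orderOf x).factorization q) := (Nat.ordProj_mul_ordCompl_eq_self _ _).symm
    set w := orderOf x / q ^ (orderOf x).factorization q
    have hwc : Nat.Coprime (q ^ Nat.log q N) w :=
      Nat.Coprime.pow_left _ ((Nat.Prime.coprime_iff_not_dvd hq').2 (Nat.not_dvd_ordCompl hq' ho))
    have hwd : w ∣ smoothBound N (F.erase q) := by
      refine hwc.symm.dvd_of_dvd_mul_left ?_
      rw [← hdiv, Nat.mul_div_cancel' (dvd_smoothBound hq)]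
      exact (Dvd.intro_left _ hw.symm).trans hdvd
    have hw0 : 0 < w := Nat.pos_of_ne_zero fun h => ho (by rw [hw, h, mul_zero])
    have hE0' : smoothBound N (F.erase q) ≠ 0 := by
      intro h
      apply hE0
      rw [← Nat.mul_div_cancel' (dvd_smoothBound (N := N) hq), hdiv, h, mul_zero]
    rw [hdiv, orderOf_pow' x hE0']
    have hg : (orderOf x).gcd (smoothBound N (F.erase q)) = w := by
      rw [hw, Nat.Coprime.gcd_mul_left_cancel _ (hcop _)]
      exact Nat.gcd_eq_left hwd
    rw [hg]
    conv_lhs => rw [hw]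
    exact Nat.mul_div_cancel _ hw0
  rw [List.map_congr_left key, ← List.prod_toFinset _ hF']
  conv_rhs => rw [← Nat.prod_factorization_pow_eq_self ho]
  rw [Finsupp.prod]
  symm
  refine Finset.prod_subset (fun q hq => ?_) fun q _ hq => ?_
  · have hq' := Nat.mem_primeFactors.1 (Nat.support_factorization _ ▸ hq)
    obtain ⟨n, hn, hqn⟩ := (hq'.1.prime.dvd_prod_iff).1 (hq'.2.1.trans hdvd)
    obtain ⟨p, hp, rfl⟩ := List.mem_map.1 hn
    have := (Nat.prime_dvd_prime_iff_eq hq'.1 (hF p hp)).1 (hq'.1.dvd_of_dvd_pow hqn)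
    subst this; simpa using hp
  · rw [Finsupp.notMem_support_iff] at hq; simp [hq]

end Tree

section Recover

variable {G : Type u} [Group G] [DecidableEq G]

theorem val_inRange (m t : ℕ) : (inRange m t).val = decide (1 ≤ t ∧ t < 2 ^ m) := rfl

/-- The stack `S` records a chain of powers that leads from `x₀` to `y`: each entry `(x, q, e)`
stands for one step from `x` to `x ^ q ^ e`. -/
def PowerChain (x₀ : G) : List (G × ℕ × ℕ) → G → Prop
  | [], y => y = x₀
  | (x, q, e) :: S, y => y = x ^ q ^ e ∧ q.Prime ∧ PowerChain x₀ S x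

theorem powerChain_climb {N : ℕ} (hN : 1 ≤ N) {F : List ℕ} (hF : ∀ q ∈ F, q.Prime) {x₀ x : G}
    {S : List (G × ℕ × ℕ)} (hS : PowerChain x₀ S x) :
    PowerChain x₀ (climb N F x S).val.2 (climb N F x S).val.1 := by
  induction F generalizing x S with
  | nil => simpa [climb] using hS
  | cons q F ih =>
    simp only [List.mem_cons, forall_eq_or_imp] at hF
    by_cases h : x ^ q ^ Nat.log q N = 1
    · simp [climb, val_maxPow hN hF.1.two_le, h, PowerChain, hF.1, hS]
    · simp only [climb, val_bind, val_maxPow hN hF.1.two_le, val_gpow, val_isOne, h, decide_false]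
      exact ih hF.2 ⟨rfl, hF.1, hS⟩

theorem climb_eq_one_iff {N : ℕ} (hN : 1 ≤ N) {F : List ℕ} (hF : ∀ q ∈ F, q.Prime) (x : G)
    (S : List (G × ℕ × ℕ)) :
    (climb N F x S).val.1 = 1 ↔ x ^ smoothBound N F = 1 := by
  induction F generalizing x S with
  | nil => simp [climb]
  | cons q F ih =>
    simp only [List.mem_cons, forall_eq_or_imp] at hF
    by_cases h : x ^ q ^ Nat.log q N = 1
    · simp [climb, val_maxPow hN hF.1.two_le, h, pow_mul]
    · simp only [climb, val_bind, val_maxPow hN hF.1.two_le, val_gpow, val_isOne, h, decide_false]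
      simpa [pow_mul] using ih hF.2 _ _

/-- If `orderOf x = d * q ^ j`, then multiplying `d` by `q` until `x ^ d = 1` yields the order of
`x`. -/
theorem val_peel {q : ℕ} (hq : q.Prime) {i j d : ℕ} {x : G} (hd : 0 < d) (hj : j ≤ i)
    (hx : orderOf x = d * q ^ j) : (peel q i (x ^ d) d).val = orderOf x := by
  induction i generalizing j d with
  | zero => obtain rfl : j = 0 := by omega
            simp [peel, hx]
  | succ i ih =>
    by_cases h : x ^ d = 1
    · have h₁ := Nat.le_of_dvd hd (orderOf_dvd_of_pow_eq_one h)
      have h₂ : d ≤ orderOf x := hx ▸ Nat.le_mul_of_pos_right _ (Nat.pow_pos hq.pos)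
      simp [peel, h]; omega
    · cases j with
      | zero => exact absurd (by rw [← pow_orderOf_eq_one x, hx]; simp) h
      | succ j =>
        have := ih (j := j) (d := d * q) (Nat.mul_pos hd hq.pos) (by omega)
          (by rw [hx, pow_succ]; ring)
        simpa [peel, h, ← pow_mul] using this

/-- Going back along the chain, the order of each element is obtained from the order of the next,
to which it is a power of a single prime. -/
theorem val_backtrack [Finite G] {x₀ : G} {S : List (G × ℕ × ℕ)} {y : G}
    (hS : PowerChain x₀ S y) : (backtrack S (orderOf y)).val = orderOf x₀ := by
  induction S generalizing y with
  | nil => simp_all [backtrack, PowerChain]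
  | cons s S ih =>
    obtain ⟨x, q, e⟩ := s
    obtain ⟨rfl, hq, hS⟩ := hS
    obtain ⟨j, hj, hj'⟩ := (Nat.dvd_prime_pow hq).1 (Nat.gcd_dvd_right (orderOf x) (q ^ e))
    have h : orderOf x = orderOf (x ^ q ^ e) * q ^ j := by
      rw [orderOf_pow, ← hj', Nat.div_mul_cancel (Nat.gcd_dvd_left _ _)]
    simp [backtrack, val_peel hq (orderOf_pos _) hj h, ih hS]

theorem val_recoverStack [Finite G] {N m : ℕ} (hN : 1 ≤ N) {F : List ℕ} (hF : ∀ q ∈ F, q.Prime)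
    (g : G) (t : ℕ) :
    (recoverStack N m F g t).val =
      if (1 ≤ t ∧ t < 2 ^ m) ∧ (g ^ t) ^ smoothBound N F = 1 then some (orderOf (g ^ t) * t)
      else none := by
  by_cases h : 1 ≤ t ∧ t < 2 ^ m
  · by_cases h₁ : g ^ t = 1
    · simp [recoverStack, val_inRange, h, h₁]
    · have h₂ := climb_eq_one_iff hN hF (g ^ t) []
      by_cases h₃ : (g ^ t) ^ smoothBound N F = 1
      · have h₄ := powerChain_climb hN hF (x₀ := g ^ t) (x := g ^ t) (S := []) rfl
        have h₅ := val_backtrack h₄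
        rw [h₂.2 h₃, orderOf_one] at h₅
        simp [recoverStack, val_inRange, h, h₁, h₃, h₂, h₅]
      · simp [recoverStack, val_inRange, h, h₁, h₃, h₂]
  · simp only [recoverStack, val_inRange, val_bind, h, decide_false]; simp

theorem val_treePeel {q : ℕ} (hq : q.Prime) (i d : ℕ) (x : G) :
    (treePeel q i x d).val = if x ^ q ^ i = 1 then some (d * orderOf x) else none := by
  induction i generalizing x d with
  | zero => by_cases h : x = 1 <;> simp [treePeel, h]
  | succ i ih =>
    by_cases h : x = 1
    · simp [treePeel, h]
    · simp only [treePeel, val_bind, val_isOne, h, decide_false]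
      simp only [Bool.false_eq_true, if_false, val_bind, val_gpow, val_op, ih]
      rw [← pow_mul, ← pow_succ']
      by_cases h' : x ^ q ^ (i + 1) = 1
      · obtain ⟨j, -, hj⟩ := (Nat.dvd_prime_pow hq).1 (orderOf_dvd_of_pow_eq_one h')
        have hj0 : j ≠ 0 := by rintro rfl; simp at hj; exact h hj
        obtain ⟨k, rfl⟩ := Nat.exists_eq_succ_of_ne_zero hj0
        have : orderOf (x ^ q) = q ^ k := by
          rw [orderOf_pow_of_dvd hq.ne_zero (by rw [hj]; exact dvd_pow_self _ (by simp)), hj,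
            Nat.succ_eq_add_one, pow_succ, Nat.mul_div_cancel _ hq.pos]
        simp [this, hj, pow_succ]; ring_nf
      · simp [h']

theorem val_treeCollect {N : ℕ} (hN : 1 ≤ N) {F : List ℕ} (hF : ∀ q ∈ F, q.Prime) (y : ℕ → G)
    (d : ℕ) :
    (treeCollect N (F.map fun q => (q, y q)) d).val =
      if ∀ q ∈ F, y q ^ q ^ Nat.log q N = 1 then
        some (d * (F.map fun q => orderOf (y q)).prod) else none := by
  induction F generalizing d with
  | nil => simp [treeCollect]
  | cons q F ih =>
    simp only [List.mem_cons, forall_eq_or_imp] at hF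
    by_cases h : y q ^ q ^ Nat.log q N = 1
    · simp [treeCollect, val_maxPow hN hF.1.two_le, val_treePeel hF.1, h, ih hF.2, mul_assoc]
    · simp [treeCollect, val_maxPow hN hF.1.two_le, val_treePeel hF.1, h]

theorem val_recoverTree {N m : ℕ} (hN : 1 ≤ N) {F : List ℕ} (hF : ∀ q ∈ F, q.Prime)
    (hF' : F.Nodup) (hF₀ : F ≠ []) (g : G) (t : ℕ) :
    (recoverTree N m F g t).val =
      if (1 ≤ t ∧ t < 2 ^ m) ∧ (g ^ t) ^ smoothBound N F = 1 then some (orderOf (g ^ t) * t)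
      else none := by
  by_cases h : 1 ≤ t ∧ t < 2 ^ m
  · have hiff : (∀ q ∈ F, ((g ^ t) ^ (smoothBound N F / q ^ Nat.log q N)) ^ q ^ Nat.log q N = 1) ↔
        (g ^ t) ^ smoothBound N F = 1 := by
      have : ∀ q ∈ F, ((g ^ t) ^ (smoothBound N F / q ^ Nat.log q N)) ^ q ^ Nat.log q N =
          (g ^ t) ^ smoothBound N F := fun q hq => by
        rw [← pow_mul _ _ (q ^ _), Nat.div_mul_cancel (dvd_smoothBound hq)]
      obtain ⟨q, hq⟩ := List.exists_mem_of_ne_nil F hF₀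
      exact ⟨fun h => this q hq ▸ h q hq, fun h q hq => (this q hq).trans h⟩
    have hc := val_treeCollect hN hF
      (fun q => (g ^ t) ^ (smoothBound N F / q ^ Nat.log q N)) 1
    rw [← val_tree hN hF] at hc
    by_cases h₁ : (g ^ t) ^ smoothBound N F = 1
    · rw [if_pos (hiff.2 h₁), prod_orderOf_pow hF hF' h₁, one_mul] at hc
      simp [recoverTree, val_inRange, h, h₁, hc]
    · rw [if_neg (fun h => h₁ (hiff.1 h))] at hc
      simp [recoverTree, val_inRange, h, h₁, hc]
  · simp only [recoverTree, val_inRange, val_bind, h, decide_false]; simp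

/-- For a candidate `t` in the admissible range, both methods of recovery compute the order of
`g ^ t` if it divides the smooth bound, and fail otherwise. -/
theorem val_recover [Finite G] (R : Recovery) {N : ℕ} (m : ℕ) (hN : 2 ≤ N) (g : G) (t : ℕ) :
    (recover R N m (primesUpTo N).val g t).val =
      if (1 ≤ t ∧ t < 2 ^ m) ∧ (g ^ t) ^ smoothBound N (primesUpTo N).val = 1 then
        some (orderOf (g ^ t) * t)
      else none := by
  have hF : ∀ q ∈ (primesUpTo N).val, q.Prime := fun q hq => (mem_primesUpTo.1 hq).1
  have hF₀ : (primesUpTo N).val ≠ [] :=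
    List.ne_nil_of_mem (mem_primesUpTo.2 ⟨Nat.prime_two, hN⟩)
  have hN' : 1 ≤ N := by omega
  cases R with
  | stack => exact val_recoverStack hN' hF g t
  | tree => exact val_recoverTree hN' hF (nodup_primesUpTo N) hF₀ g t

theorem val_filterCandidates {N : ℕ} (m : ℕ) (hN : 1 ≤ N) (g : G) (S : List ℕ) :
    (filterCandidates N m (primesUpTo N).val g S).val =
      S.filter fun t => decide ((1 ≤ t ∧ t < 2 ^ m) ∧
        (g ^ t) ^ smoothBound N (primesUpTo N).val = 1) := by
  have hF : ∀ q ∈ (primesUpTo N).val, 2 ≤ q := fun q hq => (mem_primesUpTo.1 hq).1.two_le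
  simp only [filterCandidates, val_bind, val_prodMaxPow hN hF, val_gpow, val_filterT]
  congr 1
  funext t
  simp only [val_inRange]
  by_cases h : 1 ≤ t ∧ t < 2 ^ m
  · simp [h, ← pow_mul, mul_comm]
  · simp only [h, decide_false, Bool.false_eq_true, if_false, val_ret, false_and]

/-- A lower bound of all candidates that is itself a candidate is the minimum. The second claim
carries the induction. -/
theorem val_minimumT_eq {r : ℕ} {l : List (Option ℕ)} (hl : ∀ a, some a ∈ l → r ≤ a) :
    (some r ∈ l → (minimumT l).val = some r) ∧ ∀ a, (minimumT l).val = some a → r ≤ a := by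
  induction l with
  | nil => simp [minimumT]
  | cons o l ih =>
    obtain ⟨ih₁, ih₂⟩ := ih fun a h => hl a (List.mem_cons_of_mem _ h)
    cases o with
    | none => simpa [minimumT] using ⟨ih₁, ih₂⟩
    | some b =>
      have hb := hl b (by simp)
      rcases ho : (minimumT l).val with - | c
      · simp_all [minimumT]
      · have hc := ih₂ c ho
        simp only [minimumT, val_bind, ho, val_op, List.mem_cons, Option.some.injEq]
        refine ⟨?_, fun a ha => ?_⟩
        · rintro (rfl | h)
          · exact min_eq_left hc
          · rw [ih₁ h, Option.some.injEq] at ho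
            omega
        · omega

/-- In `neighbours` the list of shifts is coerced element by element to a list of integers; here the
coercion is written as `List.map`. -/
theorem neighbours_eq (n B j : ℕ) : neighbours n B j =
    (rangeT 0 (2 * B + 1)).bind fun l => mapT (fun s : ℤ => (iop j B ((j : ℤ) - B)).bind fun a =>
      (iop a s (a + s)).bind fun b => iop b (2 ^ n) (b % (2 : ℤ) ^ n).toNat)
      (l.map fun s : ℕ => (s : ℤ)) := by
  rw [neighbours]
  congr 1
  funext l
  congr 1
  exact List.flatMap_pure_eq_map _ l

/-- All frequencies at distance at most `B` from `j` are among its neighbours. -/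
theorem mem_neighbours {n B j j' : ℕ} (hj' : j' < 2 ^ n) (h₁ : j ≤ j' + B) (h₂ : j' ≤ j + B) :
    j' ∈ (neighbours n B j).val := by
  simp only [neighbours_eq, val_bind, val_rangeT, val_mapT, val_iop, List.mem_map]
  refine ⟨((j' + B - j : ℕ) : ℤ), ⟨_, List.mem_range'_1.2 (by omega), rfl⟩, ?_⟩
  have : ((j : ℤ) - B + ((j' + B - j : ℕ) : ℤ)) = j' := by omega
  rw [this, Int.emod_eq_of_lt (by positivity) (by exact_mod_cast hj')]
  simp

/-- The post-processing returns the order of `g` as soon as one neighbour of the observed frequency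
yields a divisor `t` of the order such that `g ^ t` has smooth order: every other candidate is
recovered to some multiple of the order, or dropped. -/
theorem postProcess_eq_orderOf [Finite G] (V : Variant) (g : G) {B m ℓ j j' : ℕ} (hm : 2 ≤ m)
    (hj' : j' ∈ (neighbours (m + ℓ) B j).val) {t : ℕ} (ht : (solve V.solver (m + ℓ) j').val = t)
    (ht₂ : t < 2 ^ m) (htr : t ∣ orderOf g)
    (hsm : orderOf g / t ∣ smoothBound m (primesUpTo m).val) :
    (postProcess V g 1 B m ℓ j).val = some (orderOf g) := by
  have ht₁ : 1 ≤ t := Nat.pos_of_dvd_of_pos htr (orderOf_pos g)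
  have ho : orderOf (g ^ t) = orderOf g / t := orderOf_pow_of_dvd (by omega) htr
  have hgood : (1 ≤ t ∧ t < 2 ^ m) ∧ (g ^ t) ^ smoothBound m (primesUpTo m).val = 1 :=
    ⟨⟨ht₁, ht₂⟩, orderOf_dvd_iff_pow_eq_one.1 (ho ▸ hsm)⟩
  simp only [postProcess, val_bind, val_op, one_mul, val_mapT]
  set S := (neighbours (m + ℓ) B j).val.map fun a => (solve V.solver (m + ℓ) a).val with hS
  have htS : t ∈ S := List.mem_map.2 ⟨j', hj', ht⟩
  have htS' : t ∈ (if V.filter = true then filterCandidates m m (primesUpTo m).val g S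
      else ret S).val := by
    split_ifs
    · rw [val_filterCandidates m (by omega)]
      exact List.mem_filter.2 ⟨htS, decide_eq_true hgood⟩
    · exact htS
  refine (val_minimumT_eq fun a ha => ?_).1 ?_
  · obtain ⟨s, -, hs⟩ := List.mem_map.1 ha
    rw [val_recover _ _ hm] at hs
    split_ifs at hs with h
    rw [Option.some.injEq] at hs
    subst hs
    refine Nat.le_of_dvd (Nat.mul_pos (orderOf_pos _) h.1.1) (orderOf_dvd_of_pow_eq_one ?_)
    rw [mul_comm, pow_mul, pow_orderOf_eq_one]
  · refine List.mem_map.2 ⟨t, htS', ?_⟩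
    rw [val_recover _ _ hm, if_pos hgood, ho, Nat.div_mul_cancel htr]

end Recover

/-! ### Continued fractions -/

/-- Let `q₁` be a denominator whose square is less than `M`, and `q` the next one, whose square is
not. The numbers `b` and `b'` are the (non-negative) remainders of Euclid's algorithm that belong to
`q₁` and `q`, and `(α, β)` are the coordinates of a good approximation with denominator `r` with
respect to the two convergents. Then the approximation is a multiple of the convergent with
denominator `q₁`. -/
theorem coord_eq_zero_of_large_denominator {M r q q₁ b b' α β : ℤ} (hr : 0 < r) (hrM : r ^ 2 < M)
    (hq₁ : 0 < q₁) (hq₁M : q₁ ^ 2 < M) (hq : 0 ≤ q) (hqM : M ≤ q ^ 2) (hb : 0 ≤ b) (hb' : 0 ≤ b')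
    (hM : b * q + b' * q₁ = M) (hrq : r = α * q + β * q₁) (hD : 2 * |α * b' - β * b| ≤ r) :
    α = 0 := by
  have hrq' : r < q := by nlinarith
  have hrq₁ : q₁ * r < M := by nlinarith
  by_contra hα
  rcases lt_or_gt_of_ne hα with h | h
  -- for negative `α` both terms of the error have the same sign, so the error is too large
  · have h₁ := neg_abs_le (α * b' - β * b)
    have : q₁ * (β * b - α * b') ≥ M := by
      have : q₁ * (β * b - α * b') = r * b + (-α) * M := by rw [← hM, hrq]; ring
      nlinarith [mul_nonneg hr.le hb]
    nlinarith
  -- for positive `α` the coordinate `β` is negative because `r < q`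
  · have h₁ := le_abs_self (α * b' - β * b)
    have hβ : β ≤ -1 := by
      by_contra! hβ
      nlinarith
    have h₂ : q₁ * (α * b' - β * b) = α * M - r * b := by rw [← hM, hrq]; ring
    have h₃ : b ≤ α * b' - β * b := by nlinarith
    nlinarith

/-- If the convergent `p / q` that follows `p₁ / q₁` has a denominator with `M ≤ q ^ 2`, then `q₁`
is the denominator of the good approximation `z / r`. The sign `s` alternates from one convergent to
the next. -/
theorem eq_of_large_denominator {M j z r p p₁ q q₁ b b' s : ℤ} (hr : 0 < r) (hrM : r ^ 2 < M)
    (hq₁ : 0 < q₁) (hq₁M : q₁ ^ 2 < M) (hq : 0 ≤ q) (hqM : M ≤ q ^ 2) (hb₀ : 0 ≤ b)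
    (hb₀' : 0 ≤ b') (hs : s * s = 1) (hb : b = -s * (j * q₁ - p₁ * M))
    (hb' : b' = s * (j * q - p * M)) (hdet : p * q₁ - p₁ * q = -s) (hcop : IsCoprime z r)
    (hz : 2 * |j * r - z * M| ≤ r) : q₁ = r := by
  obtain ⟨α, hα⟩ : ∃ α, α = s * (r * p₁ - z * q₁) := ⟨_, rfl⟩
  obtain ⟨β, hβ⟩ : ∃ β, β = -s * (r * p - z * q) := ⟨_, rfl⟩
  have hrq : r = α * q + β * q₁ := by
    rw [hα, hβ]
    linear_combination -r * hs + r * s * hdet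
  have hzq : z = α * p + β * p₁ := by
    rw [hα, hβ]
    linear_combination -z * hs + z * s * hdet
  have hα0 : α = 0 := by
    refine coord_eq_zero_of_large_denominator hr hrM hq₁ hq₁M hq hqM hb₀ hb₀' ?_ hrq ?_
    · rw [hb, hb']
      linear_combination -M * s * hdet + M * hs
    · have h₁ : α * b' - β * b = s * (j * r - z * M) := by
        have : α * b' - β * b = s * (j * (α * q + β * q₁) - (α * p + β * p₁) * M) := by
          rw [hb, hb']; ring
        rw [this, ← hrq, ← hzq]
      have hs' : |s| = 1 := by
        have : |s| * |s| = 1 := by rw [← abs_mul, hs, abs_one]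
        nlinarith [abs_nonneg s]
      rw [h₁, abs_mul, hs', one_mul]
      exact hz
  rw [hα0, zero_mul, zero_add] at hrq hzq
  have : IsUnit β := hcop.isUnit_of_dvd' ⟨_, hzq⟩ ⟨_, hrq⟩
  rcases Int.isUnit_iff.1 this with h | h
  · rw [h, one_mul] at hrq; exact hrq.symm
  · rw [h] at hrq
    linarith

/-- The invariant of Euclid's algorithm on `j` and `M`: the remainders `a`, `b` are, up to sign, the
errors `j * q - p * M` of the two latest convergents `p₂ / q₂`, `p₁ / q₁`, which have determinant
`s = ± 1`. Neither `z / r` nor the numerators are known to the algorithm. -/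
theorem val_cfLoop {M j z r : ℕ} (hr : 0 < r) (hrM : r ^ 2 < M) (hzr : Nat.Coprime z r)
    (hz : 2 * |(j : ℤ) * r - z * M| ≤ r) (a b q₂ q₁ : ℕ) (p₂ p₁ s : ℤ) (hs : s * s = 1)
    (ha : (a : ℤ) = s * (j * q₂ - p₂ * M)) (hb : (b : ℤ) = -s * (j * q₁ - p₁ * M))
    (hdet : p₁ * q₂ - p₂ * q₁ = s) (hq₂ : q₂ ^ 2 < M) (hq₁ : q₁ ^ 2 < M) :
    (cfLoop M a b q₂ q₁).val = r := by
  induction b using Nat.strong_induction_on generalizing a q₂ q₁ p₂ p₁ s with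
  | _ b ih =>
  have hM : (0 : ℤ) < M := by exact_mod_cast (Nat.zero_le _).trans_lt hrM
  have hrM' : (r : ℤ) ^ 2 < M := by exact_mod_cast hrM
  have hq₁' : (q₁ : ℤ) ^ 2 < M := by exact_mod_cast hq₁
  have hr' : (0 : ℤ) < r := by exact_mod_cast hr
  have hcop : IsCoprime (z : ℤ) r := Nat.isCoprime_iff_coprime.2 hzr
  have hcop₁ : IsCoprime p₁ (q₁ : ℤ) :=
    ⟨s * q₂, -s * p₂, by linear_combination s * hdet + hs⟩
  rw [cfLoop]
  split_ifs with h0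
  · -- the expansion has ended: `j / M = p₁ / q₁`
    subst h0
    have h₁ : (j : ℤ) * q₁ = p₁ * M := by
      have : s * (j * q₁ - p₁ * M) = 0 := by push_cast at hb; linarith
      rcases mul_eq_zero.1 this with h | h
      · simp [h] at hs
      · linarith
    have h₂ : (M : ℤ) * (r * p₁ - z * q₁) = q₁ * (j * r - z * M) := by
      linear_combination -(r : ℤ) * h₁
    have h₃ : (r : ℤ) * p₁ - z * q₁ = 0 := by
      rw [← Int.abs_lt_one_iff]
      have : (M : ℤ) * |(r : ℤ) * p₁ - z * q₁| = q₁ * |(j : ℤ) * r - z * M| := by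
        rw [← abs_of_pos hM, ← abs_mul, abs_of_pos hM, h₂, abs_mul, Nat.abs_cast]
      have h₄ : (q₁ : ℤ) * r < M := by nlinarith
      have h₅ : (q₁ : ℤ) * (2 * |(j : ℤ) * r - z * M|) ≤ q₁ * r := by gcongr
      nlinarith
    change q₁ = r
    refine Nat.dvd_antisymm (Int.natCast_dvd_natCast.1 ?_) (Int.natCast_dvd_natCast.1 ?_)
    · exact hcop₁.symm.dvd_of_dvd_mul_right ⟨z, by linarith⟩
    · exact hcop.symm.dvd_of_dvd_mul_left ⟨p₁, by linarith⟩
  · have hb0 : 0 < b := Nat.pos_of_ne_zero h0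
    have hab : ((a % b : ℕ) : ℤ) = a - (a / b : ℕ) * b := by
      have := Nat.div_add_mod a b
      zify at this ⊢
      linarith
    set t := a / b
    simp only [val_bind, val_op]
    set q := t * q₁ + q₂ with hq
    have hb'e : ((a % b : ℕ) : ℤ) = s * (j * q - (t * p₁ + p₂) * M) := by
      rw [hab, ha, hb, hq]; push_cast; ring
    by_cases hc : q * q < M
    · simp only [hc, decide_true, if_true]
      exact ih _ (Nat.mod_lt _ hb0) b q₁ q p₁ (t * p₁ + p₂) (-s) (by linarith)
        (by rw [hb]) (by rw [hb'e]; ring) (by rw [hq]; push_cast; linear_combination -hdet) hq₁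
        (by rwa [sq])
    · simp only [hc, decide_false]
      change q₁ = r
      have hq₁0 : 0 < q₁ := by
        rcases Nat.eq_zero_or_pos q₁ with h | h
        · rw [hq, h, mul_zero, zero_add, ← sq] at hc; omega
        · exact h
      have hqq : (q : ℤ) = t * q₁ + q₂ := by rw [hq]; push_cast; ring
      have := eq_of_large_denominator hr' hrM' (by exact_mod_cast hq₁0) hq₁'
        (q := q) (by positivity)
        (by rw [sq]; exact_mod_cast not_lt.1 hc) (Nat.cast_nonneg b) (Nat.cast_nonneg (a % b)) hs
        hb hb'e (by rw [hqq]; linear_combination -hdet) hcop hz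
      exact_mod_cast this

/-- The continued fraction expansion recovers the denominator of a fraction `z / r` at distance at
most `2 ^ (-n - 1)` from `j / 2 ^ n`. -/
theorem val_cfSolve {n j z r : ℕ} (hr : 0 < r) (hrM : r ^ 2 < 2 ^ n) (hzr : Nat.Coprime z r)
    (hz : 2 * |(j : ℤ) * r - z * 2 ^ n| ≤ r) : (cfSolve n j).val = r := by
  have : 1 ≤ r ^ 2 := Nat.one_le_pow _ _ hr
  exact val_cfLoop hr hrM hzr (by exact_mod_cast hz) _ _ _ _ 0 1 1 (by norm_num) (by simp)
    (by simp) (by simp) (by omega) (by omega)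

/-! ### Lagrange's algorithm -/

/-- Four times the inner product, as computed by `innerT`. -/
def inner4 (x y : ℤ × ℤ) : ℤ := 4 * (x.1 * y.1) + x.2 * y.2

@[simp] theorem val_innerT (x y : ℤ × ℤ) : (innerT x y).val = inner4 x y := rfl

@[simp] theorem val_sqNormT (x : ℤ × ℤ) : (sqNormT x).val = sqNorm x := rfl

theorem cast_sqNorm (x : ℤ × ℤ) : (sqNorm x : ℤ) = 4 * x.1 ^ 2 + x.2 ^ 2 := by
  simp [sqNorm]

/-- The coefficient of the reduction step: the integer closest to the quotient of the inner products
of `y` and of `x` with `x`. -/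
def roundCoeff (x y : ℤ × ℤ) : ℤ := (2 * inner4 x y + sqNorm x) / (2 * sqNorm x)

theorem val_reduceT (x y : ℤ × ℤ) : (reduceT x y).val = y - roundCoeff x y • x := by
  simp [reduceT, roundCoeff, Prod.ext_iff]

theorem two_mul_abs_inner4_reduceT_le {x : ℤ × ℤ} (hx : 0 < sqNorm x) (y : ℤ × ℤ) :
    2 * |inner4 x (reduceT x y).val| ≤ sqNorm x := by
  have hx' : (0 : ℤ) < sqNorm x := by exact_mod_cast hx
  have h₁ : inner4 x (reduceT x y).val = inner4 x y - roundCoeff x y * sqNorm x := by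
    rw [val_reduceT, cast_sqNorm]; simp [inner4]; ring
  have h₂ := Int.emod_add_mul_ediv (2 * inner4 x y + sqNorm x) (2 * sqNorm x)
  have h₃ := Int.emod_nonneg (2 * inner4 x y + sqNorm x) (by omega : 2 * (sqNorm x : ℤ) ≠ 0)
  have h₄ := Int.emod_lt_of_pos (2 * inner4 x y + sqNorm x) (by omega : 0 < 2 * (sqNorm x : ℤ))
  rw [← roundCoeff] at h₂
  rw [h₁]
  suffices |inner4 x y - roundCoeff x y * sqNorm x| * 2 ≤ sqNorm x by linarith
  rw [← abs_two, ← abs_mul, abs_le]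
  constructor <;> linarith

/-- The determinant of two vectors, with the second components as stored. -/
def det2 (x y : ℤ × ℤ) : ℤ := x.1 * y.2 - x.2 * y.1

theorem det2_reduceT (x y : ℤ × ℤ) : det2 (reduceT x y).val x = - det2 x y := by
  rw [val_reduceT]; simp [det2]; ring

theorem sqNorm_pos_of_det2 {x y : ℤ × ℤ} (h : det2 x y ≠ 0) : 0 < sqNorm x := by
  by_contra! h0
  have h1 : (sqNorm x : ℤ) ≤ 0 := by exact_mod_cast h0
  rw [cast_sqNorm] at h1
  have h2 : x.1 = 0 := by nlinarith [sq_nonneg x.1, sq_nonneg x.2]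
  have h3 : x.2 = 0 := by nlinarith [sq_nonneg x.1, sq_nonneg x.2]
  simp [det2, h2, h3] at h

theorem val_lagrange_eq (x y : ℤ × ℤ) : (lagrange x y).val =
    if sqNorm (reduceT x y).val < sqNorm x then (lagrange (reduceT x y).val x).val else x := by
  rw [lagrange]
  simp only [val_bind]
  split_ifs <;> rfl

/-- Lagrange's algorithm returns a shortest non-zero vector of the lattice. -/
theorem lagrange_shortest (x y : ℤ × ℤ) (hxy : det2 x y ≠ 0) :
    (∃ α β : ℤ, (lagrange x y).val = α • x + β • y) ∧ 0 < sqNorm (lagrange x y).val ∧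
    ∀ α β : ℤ, α • x + β • y ≠ 0 → sqNorm (lagrange x y).val ≤ sqNorm (α • x + β • y) := by
  induction hN : sqNorm x using Nat.strong_induction_on generalizing x y with
  | _ N ih =>
  subst hN
  rw [val_lagrange_eq]
  have hx := sqNorm_pos_of_det2 hxy
  have hz := two_mul_abs_inner4_reduceT_le hx y
  have hd := det2_reduceT x y
  have hzy := val_reduceT x y
  set z := (reduceT x y).val
  set t := roundCoeff x y
  split_ifs with h
  · obtain ⟨⟨α, β, h₁⟩, h₂, h₃⟩ := ih _ h z x (by rw [hd]; simpa using hxy) rfl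
    refine ⟨⟨β - α * t, α, ?_⟩, h₂, fun α' β' h₄ => ?_⟩
    · rw [h₁, hzy]; simp only [smul_sub, sub_smul, mul_smul]; abel
    · have : β' • z + (α' + β' * t) • x = α' • x + β' • y := by
        rw [hzy]; simp only [smul_sub, add_smul, mul_smul]; abel
      rw [← this] at h₄ ⊢
      exact h₃ _ _ h₄
  · refine ⟨⟨1, 0, by simp⟩, hx, fun α β h₄ => ?_⟩
    have h₅ : α • x + β • y = (α + β * t) • x + β • z := by
      rw [hzy]; simp only [smul_sub, add_smul, mul_smul]; abel
    rw [h₅] at h₄ ⊢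
    set γ := α + β * t
    have h₆ : (sqNorm (γ • x + β • z) : ℤ) =
        γ ^ 2 * sqNorm x + 2 * (γ * β) * inner4 x z + β ^ 2 * sqNorm z := by
      simp only [cast_sqNorm, inner4, Prod.fst_add, Prod.snd_add, Prod.smul_fst, Prod.smul_snd,
        smul_eq_mul]
      ring
    have hne : γ ≠ 0 ∨ β ≠ 0 := by
      by_contra! hne; simp [hne.1, hne.2] at h₄
    zify
    rw [h₆]
    have h₇ : (sqNorm x : ℤ) ≤ sqNorm z := by exact_mod_cast not_lt.1 h
    have h₈ : 0 < (sqNorm x : ℤ) := by exact_mod_cast hx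
    have h₉ : -(|γ| * |β| * sqNorm x) ≤ 2 * (γ * β) * inner4 x z := by
      have := neg_abs_le (2 * (γ * β) * inner4 x z)
      rw [abs_mul, abs_mul, abs_two, abs_mul] at this
      have : |γ| * |β| * (2 * |inner4 x z|) ≤ |γ| * |β| * sqNorm x := by gcongr
      linarith
    -- the form `γ² - |γβ| + β²` is positive definite, hence at least one on non-zero integers
    have h₁₀ : 1 ≤ |γ| ^ 2 - |γ| * |β| + |β| ^ 2 := by
      rcases hne with h | h
      · have := Int.one_le_abs h
        rcases eq_or_ne β 0 with h' | h'
        · simp [h']; nlinarith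
        · have := Int.one_le_abs h'
          nlinarith [sq_nonneg (|γ| - |β|)]
      · have := Int.one_le_abs h
        rcases eq_or_ne γ 0 with h' | h'
        · simp [h']; nlinarith
        · have := Int.one_le_abs h'
          nlinarith [sq_nonneg (|γ| - |β|)]
    rw [← sq_abs γ, ← sq_abs β]
    have : |β| ^ 2 * (sqNorm x : ℤ) ≤ |β| ^ 2 * sqNorm z := by gcongr
    nlinarith

/-- The shortest vector recovers the denominator of a fraction `z / r` at distance at
most `2 ^ (-n - 1)` from `j / 2 ^ n`. -/
theorem val_latticeSolve {n j z r : ℕ} (hr : 0 < r) (hrM : r ^ 2 < 2 ^ n) (hzr : Nat.Coprime z r)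
    (hz : 2 * |(j : ℤ) * r - z * 2 ^ n| ≤ r) : (latticeSolve n j).val = r := by
  have hM : (0 : ℤ) < 2 ^ n := by positivity
  have hrM' : (r : ℤ) ^ 2 < 2 ^ n := by exact_mod_cast hrM
  have hr' : (0 : ℤ) < r := by exact_mod_cast hr
  have hcop : IsCoprime (z : ℤ) r := Nat.isCoprime_iff_coprime.2 hzr
  obtain ⟨⟨α, β, h₁⟩, h₂, h₃⟩ :=
    lagrange_shortest ((j : ℤ), 1) ((2 : ℤ) ^ n, 0) (by simp [det2])
  set v := (lagrange ((j : ℤ), 1) ((2 : ℤ) ^ n, 0)).val with hv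
  change v.2.natAbs = r
  -- the lattice vector that belongs to `z / r`
  obtain ⟨D, hD⟩ : ∃ D, D = (j : ℤ) * r - z * 2 ^ n := ⟨_, rfl⟩
  rw [← hD] at hz
  have hw : (r : ℤ) • ((j : ℤ), (1 : ℤ)) + (-z : ℤ) • ((2 : ℤ) ^ n, (0 : ℤ)) = (D, (r : ℤ)) := by
    ext <;> simp [hD]; ring
  have h₄ := h₃ r (-z) (by rw [hw]; simp [Prod.ext_iff]; omega)
  rw [hw] at h₄
  zify at h₄ h₂
  rw [cast_sqNorm] at h₂
  rw [cast_sqNorm, cast_sqNorm] at h₄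
  dsimp only at h₄
  have hv₁ : v.1 = α * j + β * 2 ^ n := by rw [h₁]; simp
  have hv₂ : v.2 = α := by rw [h₁]; simp
  have hDsq : 4 * D ^ 2 ≤ r ^ 2 := by
    rw [← sq_abs D]; nlinarith [abs_nonneg D]
  -- both vectors are so short that their determinant, a multiple of `2 ^ n`, vanishes
  have hdet : v.1 * r - v.2 * D = 0 := by
    have e : v.1 * r - v.2 * D = 2 ^ n * (β * r + α * z) := by rw [hv₁, hv₂, hD]; ring
    have h₅ : (2 * (v.1 * r - v.2 * D)) ^ 2 ≤ (2 * r ^ 2) ^ 2 := by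
      have : (2 * (v.1 * r - v.2 * D)) ^ 2 ≤ (4 * v.1 ^ 2 + v.2 ^ 2) * (4 * D ^ 2 + r ^ 2) := by
        nlinarith [sq_nonneg (4 * v.1 * D + v.2 * r)]
      nlinarith
    have h₆ : |2 * (v.1 * r - v.2 * D)| ≤ 2 * r ^ 2 := abs_le_of_sq_le_sq h₅ (by positivity)
    rw [e] at h₆ ⊢
    rw [abs_mul, abs_mul, abs_two, abs_of_pos hM] at h₆
    have : |β * r + α * z| < 1 := by nlinarith
    rw [Int.abs_lt_one_iff.1 this, mul_zero]
  have hβ : β * r + α * z = 0 := by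
    have : 2 ^ n * (β * r + α * z) = 0 := by rw [← hdet, hv₁, hv₂, hD]; ring
    exact (mul_eq_zero.1 this).resolve_left hM.ne'
  obtain ⟨c, hc⟩ : (r : ℤ) ∣ α := hcop.symm.dvd_of_dvd_mul_right ⟨-β, by linarith⟩
  have hβc : β = -c * z := by
    have : (r : ℤ) * (β + c * z) = 0 := by rw [hc] at hβ; linarith
    have := (mul_eq_zero.1 this).resolve_left hr'.ne'
    linarith
  have hv₁' : v.1 = c * D := by rw [hv₁, hc, hβc, hD]; ring
  have hv₂' : v.2 = c * r := by rw [hv₂, hc]; ring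
  rw [hv₁', hv₂'] at h₄ h₂
  have hc0 : c ≠ 0 := by rintro rfl; simp at h₂
  have hc1 : |c| = 1 := by
    have h₇ := Int.one_le_abs hc0
    have h₈ : |c| ^ 2 * (4 * D ^ 2 + r ^ 2) ≤ 4 * D ^ 2 + r ^ 2 := by rw [sq_abs]; linarith
    have : 0 < 4 * D ^ 2 + (r : ℤ) ^ 2 := by positivity
    have h₉ : |c| ^ 2 ≤ 1 := le_of_mul_le_mul_right (by linarith) this
    nlinarith
  zify
  rw [hv₂', abs_mul, hc1, one_mul, Nat.abs_cast]

/-- Either solver recovers the denominator of a fraction `z / r` at distance at most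
`2 ^ (-n - 1)` from `j / 2 ^ n`, if `r ^ 2 < 2 ^ n`. -/
theorem val_solve (A : Solver) {n j z r : ℕ} (hr : 0 < r) (hrM : r ^ 2 < 2 ^ n)
    (hzr : Nat.Coprime z r) (hz : 2 * |(j : ℤ) * r - z * 2 ^ n| ≤ r) :
    (solve A n j).val = r := by
  cases A with
  | continuedFractions => exact val_cfSolve hr hrM hzr hz
  | lattice => exact val_latticeSolve hr hrM hzr hz

/-! ### The distribution of the frequencies -/

section Distribution

/-- The primitive root of unity of order `2 ^ n` used by the Fourier transform. -/
noncomputable def rootOfUnity (n : ℕ) : ℂ := Complex.exp (2 * Real.pi * Complex.I / 2 ^ n)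

theorem isPrimitiveRoot_rootOfUnity (n : ℕ) : IsPrimitiveRoot (rootOfUnity n) (2 ^ n) := by
  have := Complex.isPrimitiveRoot_exp (2 ^ n) (by positivity)
  simpa [rootOfUnity] using this

theorem norm_rootOfUnity (n : ℕ) : ‖rootOfUnity n‖ = 1 :=
  (isPrimitiveRoot_rootOfUnity n).norm'_eq_one (by positivity)

theorem exp_eq_rootOfUnity_pow (n a j : ℕ) :
    Complex.exp (2 * Real.pi * Complex.I / 2 ^ n * (a * j)) = rootOfUnity n ^ (a * j) := by
  rw [rootOfUnity, ← Complex.exp_nat_mul]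
  push_cast
  congr 1
  ring

open scoped ComplexConjugate in
/-- Parseval's identity for the discrete Fourier transform of length `2 ^ n`. -/
theorem sum_norm_sq_fourier (n : ℕ) (c : ℕ → ℂ) :
    ∑ j ∈ Finset.range (2 ^ n),
      ‖∑ a ∈ Finset.range (2 ^ n), c a * rootOfUnity n ^ (a * j)‖ ^ 2 =
      2 ^ n * ∑ a ∈ Finset.range (2 ^ n), ‖c a‖ ^ 2 := by
  set ζ := rootOfUnity n with hζdef
  have hζ := isPrimitiveRoot_rootOfUnity n
  rw [← hζdef] at hζ
  have hζ0 : ζ ≠ 0 := hζ.ne_zero (by positivity)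
  have hconj : conj ζ = ζ⁻¹ := (Complex.inv_eq_conj (norm_rootOfUnity n)).symm
  have orth : ∀ a ∈ Finset.range (2 ^ n), ∀ b ∈ Finset.range (2 ^ n),
      ∑ j ∈ Finset.range (2 ^ n), ζ ^ (a * j) * (ζ⁻¹) ^ (b * j) = if a = b then 2 ^ n else 0 := by
    intro a ha b hb
    rw [Finset.mem_range] at ha hb
    have e : ∀ j ∈ Finset.range (2 ^ n), ζ ^ (a * j) * (ζ⁻¹) ^ (b * j) =
        (ζ ^ a * (ζ⁻¹) ^ b) ^ j := fun j _ => by rw [mul_pow, ← pow_mul, ← pow_mul]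
    rw [Finset.sum_congr rfl e]
    split_ifs with h
    · subst h
      have : ζ ^ a * ζ⁻¹ ^ a = 1 := by rw [← mul_pow, mul_inv_cancel₀ hζ0, one_pow]
      simp only [this, one_pow]; simp
    · set μ := ζ ^ a * ζ⁻¹ ^ b with hμ
      have h1 : μ ^ 2 ^ n = 1 := by
        rw [hμ, mul_pow, ← pow_mul, ← pow_mul, mul_comm a, mul_comm b, pow_mul, pow_mul, inv_pow,
          hζ.pow_eq_one]; simp
      have h2 : μ ≠ 1 := by
        intro h2
        apply h
        apply hζ.pow_inj ha hb
        rw [hμ, inv_pow, mul_inv_eq_one₀ (pow_ne_zero _ hζ0)] at h2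
        exact h2
      have := mul_geom_sum μ (2 ^ n)
      rw [h1, sub_self] at this
      exact (mul_eq_zero.1 this).resolve_left (sub_ne_zero.2 h2)
  apply Complex.ofReal_injective
  push_cast
  simp_rw [← Complex.mul_conj', map_sum, map_mul, map_pow, hconj, Finset.sum_mul_sum]
  rw [Finset.sum_comm, Finset.mul_sum]
  refine Finset.sum_congr rfl fun a ha => ?_
  rw [Finset.sum_comm]
  have : ∀ b ∈ Finset.range (2 ^ n), ∑ j ∈ Finset.range (2 ^ n),
      c a * ζ ^ (a * j) * (conj (c b) * ζ⁻¹ ^ (b * j)) =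
      if a = b then c a * conj (c b) * 2 ^ n else 0 := by
    intro b hb
    have h := orth a ha b hb
    calc _ = c a * conj (c b) * ∑ j ∈ Finset.range (2 ^ n), ζ ^ (a * j) * (ζ⁻¹) ^ (b * j) := by
          rw [Finset.mul_sum]; exact Finset.sum_congr rfl fun j _ => by ring
      _ = _ := by rw [h]; split_ifs <;> simp
  rw [Finset.sum_congr rfl this, Finset.sum_ite_eq, if_pos ha]
  ring

variable {G : Type u} [Group G] [DecidableEq G]

theorem norm_amplitude_sq (n : ℕ) (g : G) (j : ℕ) (x : G) :
    ‖amplitude n g j x‖ ^ 2 = (1 / 2 ^ n) ^ 2 *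
      ‖∑ a ∈ Finset.range (2 ^ n), (if g ^ a = x then 1 else 0) * rootOfUnity n ^ (a * j)‖ ^ 2 := by
  rw [amplitude, norm_mul, mul_pow]
  congr 1
  · simp
  · simp only [exp_eq_rootOfUnity_pow, ite_mul, one_mul, zero_mul]

/-- The frequencies are observed with total probability one. -/
theorem sum_freqProb [Fintype G] (n : ℕ) (g : G) :
    ∑ j ∈ Finset.range (2 ^ n), freqProb n g j = 1 := by
  simp only [freqProb, norm_amplitude_sq]
  rw [Finset.sum_comm]
  simp_rw [← Finset.mul_sum, sum_norm_sq_fourier]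
  rw [← Finset.mul_sum, Finset.sum_comm]
  have : ∀ a ∈ Finset.range (2 ^ n), ∑ x : G, ‖(if g ^ a = x then 1 else 0 : ℂ)‖ ^ 2 = (1 : ℝ) := by
    intro a _
    rw [Finset.sum_eq_single (g ^ a)] <;> simp
    intro b hb
    exact Ne.symm hb
  rw [Finset.sum_congr rfl this]
  simp
  field_simp

theorem freqProb_nonneg [Fintype G] (n : ℕ) (g : G) (j : ℕ) : 0 ≤ freqProb n g j :=
  Finset.sum_nonneg fun _ _ => by positivity

/-- Summation over the exponents `a` with `g ^ a = g ^ b` is summation over an arithmetic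
progression. -/
theorem sum_filter_pow_eq [Finite G] (g : G) {b M : ℕ} (hb : b < orderOf g) (hM : orderOf g ≤ M) :
    ∃ L : ℕ, L ≤ M / orderOf g + 1 ∧ ∀ f : ℕ → ℂ,
      ∑ a ∈ Finset.range M, (if g ^ a = g ^ b then 1 else 0) * f a =
      ∑ k ∈ Finset.range L, f (b + k * orderOf g) := by
  have hr := orderOf_pos g
  refine ⟨(M - b + orderOf g - 1) / orderOf g, ?_, fun f => ?_⟩
  · rw [← Nat.add_div_right _ hr]
    exact Nat.div_le_div_right (by omega)
  · have hk : ∀ k, k < (M - b + orderOf g - 1) / orderOf g ↔ b + k * orderOf g < M := by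
      intro k
      rw [← Nat.succ_le_iff, Nat.le_div_iff_mul_le hr, Nat.succ_mul]
      omega
    simp only [ite_mul, one_mul, zero_mul]
    rw [← Finset.sum_filter]
    symm
    refine Finset.sum_nbij (fun k => b + k * orderOf g) ?_ ?_ ?_ fun _ _ => rfl
    · intro k h
      rw [Finset.mem_range, hk] at h
      refine Finset.mem_filter.2 ⟨Finset.mem_range.2 h, ?_⟩
      rw [pow_add, mul_comm k, pow_mul, pow_orderOf_eq_one, one_pow, mul_one]
    · intro k _ k' _ h
      simpa [hr.ne'] using h
    · intro a ha
      obtain ⟨h₁, h₂⟩ := Finset.mem_filter.1 ha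
      rw [Finset.mem_range] at h₁
      have h₃ : a % orderOf g = b := by
        rw [pow_inj_mod, Nat.mod_eq_of_lt hb] at h₂; exact h₂
      have h₄ : b + a / orderOf g * orderOf g = a := by
        rw [← h₃, mul_comm]; exact Nat.mod_add_div _ _
      refine ⟨a / orderOf g, ?_, h₄⟩
      rw [Finset.mem_coe, Finset.mem_range, hk, h₄]
      exact h₁

/-- A frequency is observed with probability at most `r * (C / 2 ^ n) ^ 2`, if `C` bounds the
geometric sums that arise, up to a phase, from the `r` values of `g ^ a`. -/
theorem freqProb_le [Fintype G] {n : ℕ} {g : G} (hM : orderOf g ≤ 2 ^ n) (j : ℕ) {C : ℝ}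
    (hC : ∀ L ≤ 2 ^ n / orderOf g + 1,
      ‖∑ k ∈ Finset.range L, (rootOfUnity n ^ (orderOf g * j)) ^ k‖ ≤ C) :
    freqProb n g j ≤ orderOf g * (C / 2 ^ n) ^ 2 := by
  have hle : ∀ b < orderOf g, ‖amplitude n g j (g ^ b)‖ ^ 2 ≤ (C / 2 ^ n) ^ 2 := by
    intro b hb
    obtain ⟨L, hL, hf⟩ := sum_filter_pow_eq g hb hM
    rw [norm_amplitude_sq, hf]
    have e : ∀ k ∈ Finset.range L, rootOfUnity n ^ ((b + k * orderOf g) * j) =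
        rootOfUnity n ^ (b * j) * (rootOfUnity n ^ (orderOf g * j)) ^ k := by
      intro k _; rw [← pow_mul, ← pow_add]; congr 1; ring
    rw [Finset.sum_congr rfl e, ← Finset.mul_sum, norm_mul, norm_pow, norm_rootOfUnity, one_pow,
      one_mul, ← mul_pow, one_div_mul_eq_div]
    gcongr
    exact hC L hL
  rw [freqProb]
  have hsub : ∑ x : G, ‖amplitude n g j x‖ ^ 2 =
      ∑ x ∈ (Finset.range (orderOf g)).image fun b => g ^ b, ‖amplitude n g j x‖ ^ 2 := by
    symm
    refine Finset.sum_subset (Finset.subset_univ _) fun x _ hx => ?_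
    rw [amplitude, Finset.sum_eq_zero]
    · simp
    · intro a _
      rw [if_neg]
      rintro rfl
      exact hx (Finset.mem_image.2 ⟨a % orderOf g,
        Finset.mem_range.2 (Nat.mod_lt _ (orderOf_pos g)), pow_mod_orderOf g a⟩)
  rw [hsub]
  calc _ ≤ ((Finset.range (orderOf g)).image fun b => g ^ b).card • (C / 2 ^ n) ^ 2 := by
        refine Finset.sum_le_card_nsmul _ _ _ fun x hx => ?_
        obtain ⟨b, hb, rfl⟩ := Finset.mem_image.1 hx
        exact hle b (Finset.mem_range.1 hb)
    _ ≤ (orderOf g) • (C / 2 ^ n) ^ 2 := by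
        refine nsmul_le_nsmul_left (by positivity) ?_
        exact Finset.card_image_le.trans (by simp)
    _ = _ := by rw [nsmul_eq_mul]

/-- The trivial bound for the geometric sums, by the number of their terms. -/
theorem freqProb_le_four_div [Fintype G] {n : ℕ} {g : G} (hM : orderOf g ≤ 2 ^ n) (j : ℕ) :
    freqProb n g j ≤ 4 / orderOf g := by
  have hr : (0 : ℝ) < orderOf g := by exact_mod_cast orderOf_pos g
  have hM' : (orderOf g : ℝ) ≤ 2 ^ n := by exact_mod_cast hM
  refine (freqProb_le hM j (C := 2 * 2 ^ n / orderOf g) fun L hL => ?_).trans ?_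
  · calc _ ≤ ∑ k ∈ Finset.range L, ‖(rootOfUnity n ^ (orderOf g * j)) ^ k‖ := norm_sum_le _ _
      _ = L := by simp [norm_rootOfUnity]
      _ ≤ ((2 ^ n / orderOf g + 1 : ℕ) : ℝ) := by exact_mod_cast hL
      _ ≤ 2 ^ n / orderOf g + 1 := by
        push_cast
        gcongr
        simpa using Nat.cast_div_le (α := ℝ) (m := 2 ^ n) (n := orderOf g)
      _ ≤ _ := by
        have : 1 ≤ (2 : ℝ) ^ n / orderOf g := (one_le_div hr).2 hM'
        rw [mul_div_assoc]; linarith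
  · apply le_of_eq
    field_simp
    norm_num

theorem two_mul_abs_le_norm_exp_sub_one {φ : ℝ} (h : |φ| ≤ 1 / 2) :
    4 * |φ| ≤ ‖Complex.exp (Complex.I * ((2 * Real.pi * φ : ℝ) : ℂ)) - 1‖ := by
  rw [Complex.norm_exp_I_mul_ofReal_sub_one]
  have hπ := Real.pi_pos
  have h₁ : 2 * Real.pi * φ / 2 = Real.pi * φ := by ring
  have h₂ : |Real.pi * φ| ≤ Real.pi / 2 := by
    rw [abs_mul, abs_of_pos hπ]; nlinarith
  have h₃ := Real.mul_abs_le_abs_sin h₂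
  rw [abs_mul, abs_of_pos hπ, ← mul_assoc, div_mul_cancel₀ _ hπ.ne'] at h₃
  rw [h₁, Real.norm_eq_abs, abs_mul, abs_two]
  linarith

/-- Frequencies at some distance from the multiples of `2 ^ n / r` are unlikely. -/
theorem freqProb_le_of_dist [Fintype G] {n : ℕ} {g : G} (hM : orderOf g ≤ 2 ^ n) (j z : ℕ)
    (h₀ : (orderOf g : ℝ) * j - z * 2 ^ n ≠ 0)
    (h : 2 * |(orderOf g : ℝ) * j - z * 2 ^ n| ≤ 2 ^ n) :
    freqProb n g j ≤ orderOf g / (4 * ((orderOf g : ℝ) * j - z * 2 ^ n) ^ 2) := by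
  set D : ℝ := (orderOf g : ℝ) * j - z * 2 ^ n with hD
  have hM0 : (0 : ℝ) < 2 ^ n := by positivity
  have hDp : 0 < |D| := abs_pos.2 h₀
  set μ := rootOfUnity n ^ (orderOf g * j)
  have hμ : μ = Complex.exp (Complex.I * ((2 * Real.pi * (D / 2 ^ n) : ℝ) : ℂ)) := by
    have hz : rootOfUnity n ^ (z * 2 ^ n) = 1 := by
      rw [mul_comm, pow_mul, (isPrimitiveRoot_rootOfUnity n).pow_eq_one, one_pow]
    have : μ = Complex.exp (Complex.I * ((2 * Real.pi * (D / 2 ^ n) : ℝ) : ℂ)) *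
        rootOfUnity n ^ (z * 2 ^ n) := by
      rw [← exp_eq_rootOfUnity_pow, ← Complex.exp_add]
      simp only [μ, rootOfUnity]
      rw [← Complex.exp_nat_mul]
      congr 1
      rw [hD]
      push_cast
      field_simp
      ring
    rw [this, hz, mul_one]
  have hlow : 4 * (|D| / 2 ^ n) ≤ ‖μ - 1‖ := by
    rw [hμ, ← abs_of_pos hM0, ← abs_div]
    rw [abs_of_pos hM0]
    refine two_mul_abs_le_norm_exp_sub_one ?_
    rw [abs_div, abs_of_pos hM0, div_le_iff₀ hM0]
    linarith
  have hμ1 : ‖μ‖ = 1 := by simp [μ, norm_rootOfUnity]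
  refine (freqProb_le hM j (C := 2 ^ n / (2 * |D|)) fun L _ => ?_).trans ?_
  · have h₁ : ‖μ - 1‖ * ‖∑ k ∈ Finset.range L, μ ^ k‖ ≤ 2 := by
      rw [← norm_mul, mul_geom_sum]
      refine (norm_sub_le _ _).trans ?_
      rw [norm_pow, hμ1]; norm_num
    have h₂ : 4 * (|D| / 2 ^ n) * ‖∑ k ∈ Finset.range L, μ ^ k‖ ≤ 2 :=
      (mul_le_mul_of_nonneg_right hlow (norm_nonneg _)).trans h₁
    rw [le_div_iff₀ (by positivity)]
    have h₃ : 4 * (|D| / 2 ^ n) * ‖∑ k ∈ Finset.range L, μ ^ k‖ =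
      2 * (‖∑ k ∈ Finset.range L, μ ^ k‖ * (2 * |D|)) / 2 ^ n := by ring
    rw [h₃, div_le_iff₀ hM0] at h₂
    linarith
  · apply le_of_eq
    rw [← sq_abs D]
    field_simp
    norm_num

end Distribution

/-! ### Indices with a large common prime power -/

/-- The indices `z` such that frequencies close to `z * 2 ^ n / r` do not reveal `r`, because
`gcd (r, z)` does not divide the smooth bound. -/
def unsmooth (r m : ℕ) : Finset ℕ :=
  (Finset.Ioc 0 r).filter fun z => ¬ r.gcd z ∣ smoothBound m (primesUpTo m).val

/-- A number that does not divide the smooth bound has a prime-power divisor greater than `m`. -/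
theorem exists_prime_pow_dvd_of_not_dvd {m d : ℕ}
    (h : ¬ d ∣ smoothBound m (primesUpTo m).val) :
    ∃ q : ℕ, q.Prime ∧ q ^ (Nat.log q m + 1) ∣ d := by
  rw [Nat.dvd_iff_prime_pow_dvd_dvd] at h
  push Not at h
  obtain ⟨q, k, hq, hk, hk'⟩ := h
  refine ⟨q, hq, (pow_dvd_pow q ?_).trans hk⟩
  by_contra! hlt
  apply hk'
  rcases le_or_gt q m with h | h
  · exact (pow_dvd_pow q (by omega)).trans (dvd_smoothBound (mem_primesUpTo.2 ⟨hq, h⟩))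
  · rw [Nat.log_of_lt h] at hlt
    obtain rfl : k = 0 := by omega
    simp

/-- A union bound over the prime powers beyond `m` that divide `r`: there are fewer than
`m / log₂ m` of them, and each divides at most `r / m` of the numbers up to `r`. -/
theorem card_unsmooth_mul_log_le {r m : ℕ} (hr : 0 < r) (hm : 1 ≤ m) (hrm : r < 2 ^ m) :
    (unsmooth r m).card * Nat.log 2 m ≤ r := by
  set Q := r.primeFactors.filter fun q => q ^ (Nat.log q m + 1) ∣ r with hQ
  have hQp : ∀ q ∈ Q, q.Prime := fun q hq =>
    (Nat.mem_primeFactors.1 (Finset.mem_filter.1 hq).1).1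
  have hlt : ∀ q ∈ Q, m < q ^ (Nat.log q m + 1) := fun q hq =>
    Nat.lt_pow_succ_log_self (hQp q hq).one_lt m
  have hsub : unsmooth r m ⊆ Q.biUnion fun q =>
      (Finset.Ioc 0 r).filter fun z => q ^ (Nat.log q m + 1) ∣ z := by
    intro z hz
    obtain ⟨hz₁, hz₂⟩ := Finset.mem_filter.1 hz
    obtain ⟨q, hq, hqd⟩ := exists_prime_pow_dvd_of_not_dvd hz₂
    have hqr := hqd.trans (Nat.gcd_dvd_left r z)
    refine Finset.mem_biUnion.2 ⟨q, Finset.mem_filter.2 ⟨Nat.mem_primeFactors.2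
      ⟨hq, (dvd_pow_self q (by simp)).trans hqr, hr.ne'⟩, hqr⟩, Finset.mem_filter.2 ⟨hz₁, ?_⟩⟩
    exact hqd.trans (Nat.gcd_dvd_right r z)
  have hcard : (unsmooth r m).card ≤ Q.card * (r / m) := by
    refine (Finset.card_le_card hsub).trans (Finset.card_biUnion_le_card_mul _ _ _ fun q hq => ?_)
    rw [Nat.Ioc_filter_dvd_card_eq_div]
    exact Nat.div_le_div_left (hlt q hq).le hm
  have hprod : ∏ q ∈ Q, q ^ (Nat.log q m + 1) ∣ r := by
    refine Finset.prod_dvd_of_isRelPrime (fun p hp q hq hpq => ?_)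
      fun q hq => (Finset.mem_filter.1 hq).2
    exact (Nat.coprime_iff_isRelPrime.1
      (((Nat.coprime_primes (hQp p hp) (hQp q hq)).2 hpq).pow _ _))
  have hpow : m ^ Q.card ≤ r := by
    rw [← Finset.prod_const]
    exact (Finset.prod_le_prod' fun q hq => (hlt q hq).le).trans (Nat.le_of_dvd hr hprod)
  have hQm : Nat.log 2 m * Q.card ≤ m := by
    refine (Nat.pow_lt_pow_iff_right (a := 2) (by norm_num)).1 ?_ |>.le
    rw [pow_mul]
    exact ((Nat.pow_le_pow_left (Nat.pow_log_le_self 2 (by omega)) _).trans hpow).trans_lt hrm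
  calc _ ≤ Q.card * (r / m) * Nat.log 2 m := Nat.mul_le_mul_right _ hcard
    _ = Nat.log 2 m * Q.card * (r / m) := by ring
    _ ≤ m * (r / m) := Nat.mul_le_mul_right _ hQm
    _ ≤ r := Nat.mul_div_le _ _

/-! ### Peaks -/

/-- The index `z` of the multiple `z * M / r` closest to the frequency `j`. -/
def peakIndex (M r j : ℕ) : ℕ := (2 * r * j + M) / (2 * M)

/-- The frequency closest to `z * M / r`. -/
def peak (M r z : ℕ) : ℕ := (2 * z * M + r) / (2 * r)

/-- The quotient `(2 * a + b) / (2 * b)` is `a / b` rounded to the nearest integer. -/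
theorem two_mul_abs_round_le {a b : ℕ} (hb : 0 < b) :
    2 * |(((2 * a + b) / (2 * b) : ℕ) : ℤ) * b - a| ≤ b := by
  have h₁ := Nat.div_add_mod (2 * a + b) (2 * b)
  have h₂ := Nat.mod_lt (2 * a + b) (show 2 * b > 0 by omega)
  zify at h₁ h₂
  have h₃ := Int.emod_nonneg (2 * a + b : ℤ) (show (2 * b : ℤ) ≠ 0 by omega)
  set t := (((2 * a + b) / (2 * b) : ℕ) : ℤ) with ht
  have ht' : ((2 * a + b : ℤ) / (2 * b)) = t := by rw [ht]; push_cast; rfl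
  rw [ht'] at h₁
  suffices |t * b - a| * 2 ≤ b by linarith
  rw [← abs_two, ← abs_mul, abs_le]
  constructor <;> nlinarith

theorem peakIndex_spec {M : ℕ} (hM : 0 < M) (r j : ℕ) :
    2 * |(r : ℤ) * j - peakIndex M r j * M| ≤ M := by
  have := two_mul_abs_round_le (a := r * j) hM
  rw [peakIndex, mul_assoc, abs_sub_comm]
  exact_mod_cast this

theorem peak_spec {r : ℕ} (hr : 0 < r) (M z : ℕ) :
    2 * |(peak M r z : ℤ) * r - z * M| ≤ r := by
  have := two_mul_abs_round_le (a := z * M) hr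
  rw [peak, mul_assoc]
  exact_mod_cast this

/-- A bound, up to the factor `1 / r`, for the probability of a frequency at distance `s` from the
closest peak. -/
noncomputable def peakWeight (s : ℕ) : ℝ := if s = 0 then 4 else ((s : ℝ) ^ 2)⁻¹

theorem peakWeight_nonneg (s : ℕ) : 0 ≤ peakWeight s := by
  rw [peakWeight]; split_ifs <;> positivity

theorem sum_peakWeight_le {k T : ℕ} (hk : k ≠ 0) (hT : k ≤ T) :
    ∑ s ∈ Finset.Ioc k T, peakWeight s ≤ 1 / k := by
  have : ∑ s ∈ Finset.Ioc k T, peakWeight s = ∑ s ∈ Finset.Ioc k T, ((s : ℝ) ^ 2)⁻¹ :=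
    Finset.sum_congr rfl fun s hs => by
      rw [peakWeight, if_neg]
      have := (Finset.mem_Ioc.1 hs).1
      omega
  rw [this]
  refine (sum_Ioc_inv_sq_le_sub hk hT).trans ?_
  rw [one_div]
  have : (0 : ℝ) ≤ (T : ℝ)⁻¹ := by positivity
  linarith

theorem sum_range_peakWeight_le (T : ℕ) : ∑ s ∈ Finset.range (T + 1), peakWeight s ≤ 6 := by
  have hsub : Finset.range (T + 1) ⊆ {0, 1} ∪ Finset.Ioc 1 (T + 1) := by
    intro s hs
    simp only [Finset.mem_range, Finset.mem_union, Finset.mem_insert, Finset.mem_singleton,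
      Finset.mem_Ioc] at hs ⊢
    omega
  refine (Finset.sum_le_sum_of_subset_of_nonneg hsub fun s _ _ => peakWeight_nonneg s).trans ?_
  have hdisj : Disjoint ({0, 1} : Finset ℕ) (Finset.Ioc 1 (T + 1)) := by
    rw [Finset.disjoint_left]
    intro s hs
    simp only [Finset.mem_insert, Finset.mem_singleton, Finset.mem_Ioc] at hs ⊢
    omega
  rw [Finset.sum_union hdisj]
  have h₁ := sum_peakWeight_le (k := 1) (T := T + 1) (by norm_num) (by omega)
  have h₂ : ∑ s ∈ ({0, 1} : Finset ℕ), peakWeight s = 5 := by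
    simp [peakWeight]; norm_num
  rw [h₂]
  norm_num at h₁
  linarith

section Success

variable {G : Type u} [Group G] [DecidableEq G] [Fintype G]

/-- The signed distance of the frequency `j` from the closest peak. -/
def peakDist (M r j : ℕ) : ℤ := (j : ℤ) - peak M r (peakIndex M r j)

/-- As the peak is rounded, a frequency at distance `s` from it is at distance at least `s / 2` from
the multiple of `M / r` itself. -/
theorem freqProb_le_peakWeight {n : ℕ} {g : G} (hM : orderOf g ≤ 2 ^ n) (j : ℕ) :
    freqProb n g j ≤ peakWeight (peakDist (2 ^ n) (orderOf g) j).natAbs / orderOf g := by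
  set t := peakDist (2 ^ n) (orderOf g) j with ht
  have hr := orderOf_pos g
  have hr' : (0 : ℝ) < orderOf g := by exact_mod_cast hr
  by_cases h0 : t = 0
  · simpa [h0, peakWeight] using freqProb_le_four_div hM j
  · set z := peakIndex (2 ^ n) (orderOf g) j with hz
    have h₁ := peakIndex_spec (M := 2 ^ n) (by positivity) (orderOf g) j
    have h₂ := peak_spec hr (2 ^ n) z
    rw [← hz] at h₁
    have h₃ : (1 : ℤ) ≤ |t| := Int.one_le_abs h0
    set D : ℤ := (orderOf g : ℤ) * j - z * (2 ^ n : ℕ) with hD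
    have h₄ : (orderOf g : ℤ) * |t| ≤ 2 * |D| := by
      have e : (orderOf g : ℤ) * t = D -
          ((peak (2 ^ n) (orderOf g) z : ℤ) * orderOf g - z * (2 ^ n : ℕ)) := by
        rw [ht, peakDist, ← hz, hD]; ring
      have := abs_sub D ((peak (2 ^ n) (orderOf g) z : ℤ) * orderOf g - z * (2 ^ n : ℕ))
      rw [← e, abs_mul, Nat.abs_cast] at this
      have : (orderOf g : ℤ) ≤ orderOf g * |t| := by nlinarith
      linarith
    have hDp : 0 < |D| := by
      have : (0 : ℤ) < orderOf g := by exact_mod_cast hr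
      nlinarith
    have hDr : (orderOf g : ℝ) * j - z * 2 ^ n = (D : ℝ) := by rw [hD]; push_cast; ring
    have h₅ := freqProb_le_of_dist hM j z
      (by rw [hDr]; exact_mod_cast abs_pos.1 hDp) (by rw [hDr]; exact_mod_cast h₁)
    refine h₅.trans ?_
    rw [hDr, peakWeight, if_neg (by simpa using h0)]
    have h₆ : ((orderOf g : ℝ) * |(t : ℝ)|) ^ 2 ≤ (2 * |(D : ℝ)|) ^ 2 := by
      exact pow_le_pow_left₀ (by positivity) (by exact_mod_cast h₄) 2
    have h₇ : ((t.natAbs : ℕ) : ℝ) = |(t : ℝ)| := by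
      rw [Nat.cast_natAbs]; push_cast; rfl
    have h₈ : (0 : ℝ) < |(t : ℝ)| := abs_pos.2 (by exact_mod_cast h0)
    have h₉ : (0 : ℝ) < |(D : ℝ)| := by exact_mod_cast hDp
    rw [h₇, ← sq_abs (D : ℝ), ← one_div, div_div, div_le_div_iff₀ (by positivity) (by positivity)]
    nlinarith

/-- Frequencies are summed by the closest peak and the signed distance from it; the factor `2`
stands for the two signs. -/
theorem sum_freqProb_le {n : ℕ} {g : G} (hM : orderOf g ≤ 2 ^ n) (A Z S : Finset ℕ)
    (hZ : ∀ j ∈ A, peakIndex (2 ^ n) (orderOf g) j ∈ Z)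
    (hS : ∀ j ∈ A, (peakDist (2 ^ n) (orderOf g) j).natAbs ∈ S) :
    ∑ j ∈ A, freqProb n g j ≤ Z.card * (2 * ∑ s ∈ S, peakWeight s) / orderOf g := by
  set f : ℕ → (ℕ × Bool) × ℕ := fun j => ((peakIndex (2 ^ n) (orderOf g) j,
    decide (0 ≤ peakDist (2 ^ n) (orderOf g) j)), (peakDist (2 ^ n) (orderOf g) j).natAbs) with hf
  have hinj : Set.InjOn f A := by
    intro j _ j' _ h
    simp only [hf, Prod.mk.injEq, decide_eq_decide] at h
    obtain ⟨⟨h₁, h₂⟩, h₃⟩ := h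
    have : peakDist (2 ^ n) (orderOf g) j = peakDist (2 ^ n) (orderOf g) j' := by omega
    simp only [peakDist, h₁] at this
    omega
  have h₁ : ∑ j ∈ A, freqProb n g j ≤ ∑ j ∈ A, peakWeight (f j).2 / orderOf g :=
    Finset.sum_le_sum fun j _ => freqProb_le_peakWeight hM j
  have h₂ : ∑ j ∈ A, peakWeight (f j).2 / (orderOf g : ℝ) =
      ∑ p ∈ A.image f, peakWeight p.2 / (orderOf g : ℝ) :=
    (Finset.sum_image (f := fun p => peakWeight p.2 / (orderOf g : ℝ)) hinj).symm
  have h₃ : ∑ p ∈ A.image f, peakWeight p.2 / (orderOf g : ℝ) ≤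
      ∑ p ∈ (Z ×ˢ (Finset.univ : Finset Bool)) ×ˢ S, peakWeight p.2 / (orderOf g : ℝ) := by
    refine Finset.sum_le_sum_of_subset_of_nonneg ?_ fun p _ _ =>
      div_nonneg (peakWeight_nonneg _) (by positivity)
    intro p hp
    obtain ⟨j, hj, rfl⟩ := Finset.mem_image.1 hp
    exact Finset.mem_product.2 ⟨Finset.mem_product.2 ⟨hZ j hj, Finset.mem_univ _⟩, hS j hj⟩
  refine h₁.trans (h₂.le.trans (h₃.trans_eq ?_))
  rw [Finset.sum_product]
  simp only [← Finset.sum_div, Finset.sum_const, Finset.card_product]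
  simp
  ring_nf

theorem peakIndex_le {M r j : ℕ} (hj : j < M) : peakIndex M r j ≤ r := by
  rw [peakIndex, ← Nat.lt_succ_iff, Nat.div_lt_iff_lt_mul (by omega)]
  have : r * j ≤ r * M := Nat.mul_le_mul_left _ hj.le
  rw [Nat.succ_mul]
  nlinarith

theorem peak_lt {M r z : ℕ} (hz : z < r) (hM : r < M) : peak M r z < M := by
  rw [peak, Nat.div_lt_iff_lt_mul (by omega)]
  have : (z + 1) * M ≤ r * M := Nat.mul_le_mul_right _ hz
  nlinarith

/-! ### The success probability -/

/-- A frequency close to the peak of a smooth index makes the post-processing succeed. -/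
theorem postProcess_of_close (V : Variant) {g : G} {B m ℓ j : ℕ} (hm : 2 ≤ m)
    (hrm : orderOf g < 2 ^ m) (hrM : orderOf g ^ 2 < 2 ^ (m + ℓ))
    (hz₀ : peakIndex (2 ^ (m + ℓ)) (orderOf g) j ≠ 0)
    (hz₁ : peakIndex (2 ^ (m + ℓ)) (orderOf g) j < orderOf g)
    (hz₂ : peakIndex (2 ^ (m + ℓ)) (orderOf g) j ∉ unsmooth (orderOf g) m)
    (hB : (peakDist (2 ^ (m + ℓ)) (orderOf g) j).natAbs ≤ B) :
    (postProcess V g 1 B m ℓ j).val = some (orderOf g) := by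
  have hr := orderOf_pos g
  have hpk := peak_spec hr (2 ^ (m + ℓ)) (peakIndex (2 ^ (m + ℓ)) (orderOf g) j)
  rw [peakDist] at hB
  set z := peakIndex (2 ^ (m + ℓ)) (orderOf g) j
  set r := orderOf g
  have hrM' : r < 2 ^ (m + ℓ) := lt_of_le_of_lt (by nlinarith) hrM
  have hj' := peak_lt hz₁ hrM'
  set j' := peak (2 ^ (m + ℓ)) r z
  have hd : 0 < r.gcd z := Nat.gcd_pos_of_pos_left _ hr
  have hdr := Nat.gcd_dvd_left r z
  have hdz := Nat.gcd_dvd_right r z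
  have hsm : r.gcd z ∣ smoothBound m (primesUpTo m).val := by
    by_contra h
    exact hz₂ (Finset.mem_filter.2 ⟨Finset.mem_Ioc.2 ⟨by omega, hz₁.le⟩, h⟩)
  have hle : r / r.gcd z ≤ r := Nat.div_le_self _ _
  refine postProcess_eq_orderOf V g hm (mem_neighbours hj' (by omega) (by omega))
    (t := r / r.gcd z) (val_solve V.solver (z := z / r.gcd z) ?_ ?_ ?_ ?_) (by omega)
    (Nat.div_dvd_of_dvd hdr) ?_
  · exact Nat.div_pos (Nat.le_of_dvd hr hdr) hd
  · exact (Nat.pow_le_pow_left hle 2).trans_lt hrM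
  · exact (Nat.coprime_div_gcd_div_gcd hd).symm
  · have e₁ : (r : ℤ) = r.gcd z * (r / r.gcd z : ℕ) := by
      exact_mod_cast (Nat.mul_div_cancel' hdr).symm
    have e₂ : (z : ℤ) = r.gcd z * (z / r.gcd z : ℕ) := by
      exact_mod_cast (Nat.mul_div_cancel' hdz).symm
    have e₃ : (j' : ℤ) * r - z * (2 ^ (m + ℓ) : ℕ) = r.gcd z *
        ((j' : ℤ) * (r / r.gcd z : ℕ) - (z / r.gcd z : ℕ) * 2 ^ (m + ℓ)) := by
      push_cast at e₁ e₂ ⊢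
      linear_combination (j' : ℤ) * e₁ - 2 ^ (m + ℓ) * e₂
    rw [e₃, abs_mul, Nat.abs_cast] at hpk
    have hd' : (0 : ℤ) < r.gcd z := by exact_mod_cast hd
    refine le_of_mul_le_mul_left ?_ hd'
    rw [← e₁]
    linarith
  · change r / (r / r.gcd z) ∣ _
    rw [Nat.div_div_self hdr hr.ne']
    exact hsm

/-- Failure occurs only for frequencies closest to the peak of a bad index (`A₁` in the proof) or
far from the closest peak (`A₂`). -/
theorem one_sub_le_successProb (V : Variant) {g : G} {m ℓ : ℕ} (hm : 2 ≤ m)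
    (hrm : orderOf g < 2 ^ m) (hrM : orderOf g ^ 2 < 2 ^ (m + ℓ)) :
    1 - (((unsmooth (orderOf g) m).card + 2) * 12 / orderOf g +
      (orderOf g + 1) * (2 / m) / orderOf g) ≤ successProb V g 1 m m ℓ := by
  have hr := orderOf_pos g
  have hr' : (0 : ℝ) < orderOf g := by exact_mod_cast hr
  have hrM' : orderOf g < 2 ^ (m + ℓ) := lt_of_le_of_lt (by nlinarith) hrM
  have hrM'' := hrM'.le
  set r := orderOf g with hrdef
  set M := 2 ^ (m + ℓ) with hMdef
  have hMm : m < M := by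
    rw [hMdef]
    exact Nat.lt_two_pow_self.trans_le (Nat.pow_le_pow_right (by norm_num) (by omega))
  have htot := sum_freqProb (m + ℓ) g
  rw [← hMdef] at htot
  rw [successProb, ← hMdef]
  set good : ℕ → Prop := fun j => (postProcess V g 1 m m ℓ j).val = some (orderOf g)
  have hsplit := Finset.sum_filter_add_sum_filter_not (Finset.range M) good
    (fun j => freqProb (m + ℓ) g j)
  -- the distance of a frequency from the closest peak is at most `M`
  have hdist : ∀ j < M, (peakDist M r j).natAbs ≤ M := by
    intro j hj
    have h := peakIndex_le (r := r) hj
    have : peak M r (peakIndex M r j) ≤ M := by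
      rw [peak, ← Nat.lt_succ_iff, Nat.div_lt_iff_lt_mul (by omega), Nat.succ_mul]
      nlinarith [Nat.mul_le_mul_right M h]
    rw [peakDist]
    omega
  set A₁ := (Finset.range M).filter fun j => peakIndex M r j ∈ unsmooth r m ∪ {0, r}
  set A₂ := (Finset.range M).filter fun j => m < (peakDist M r j).natAbs
  have hbad : (Finset.range M).filter (fun j => ¬ good j) ⊆ A₁ ∪ A₂ := by
    intro j hj
    obtain ⟨hj, hg⟩ := Finset.mem_filter.1 hj
    by_contra hnot
    apply hg
    simp only [A₁, A₂, Finset.mem_union, Finset.mem_filter, hj, true_and, Finset.mem_insert,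
      Finset.mem_singleton, not_or, not_lt] at hnot
    obtain ⟨⟨h₁, h₂, h₃⟩, h₄⟩ := hnot
    have := peakIndex_le (r := r) (Finset.mem_range.1 hj)
    exact postProcess_of_close V hm hrm hrM h₂ (lt_of_le_of_ne this h₃) h₁ h₄
  have hA₁ : ∑ j ∈ A₁, freqProb (m + ℓ) g j ≤ ((unsmooth r m).card + 2) * 12 / r := by
    refine (sum_freqProb_le hrM'' A₁ (unsmooth r m ∪ {0, r}) (Finset.range (M + 1))
      (fun j hj => (Finset.mem_filter.1 hj).2) fun j hj => ?_).trans ?_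
    · have := hdist j (Finset.mem_range.1 (Finset.mem_filter.1 hj).1)
      exact Finset.mem_range.2 (Nat.lt_succ_of_le this)
    · have h₁ := sum_range_peakWeight_le M
      have h₂ : ((unsmooth r m ∪ {0, r}).card : ℝ) ≤ (unsmooth r m).card + 2 := by
        exact_mod_cast (Finset.card_union_le _ _).trans
          (Nat.add_le_add_left Finset.card_le_two _)
      have h₃ : (0 : ℝ) ≤ ∑ s ∈ Finset.range (M + 1), peakWeight s :=
        Finset.sum_nonneg fun s _ => peakWeight_nonneg s
      gcongr
      linarith
  have hA₂ : ∑ j ∈ A₂, freqProb (m + ℓ) g j ≤ (r + 1) * (2 / m) / r := by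
    refine (sum_freqProb_le hrM'' A₂ (Finset.range (r + 1)) (Finset.Ioc m M)
      (fun j hj => ?_) fun j hj => ?_).trans ?_
    · have := peakIndex_le (r := r) (Finset.mem_range.1 (Finset.mem_filter.1 hj).1)
      exact Finset.mem_range.2 (Nat.lt_succ_of_le this)
    · obtain ⟨h₁, h₂⟩ := Finset.mem_filter.1 hj
      exact Finset.mem_Ioc.2 ⟨h₂, hdist j (Finset.mem_range.1 h₁)⟩
    · have h₁ := sum_peakWeight_le (k := m) (T := M) (by omega) hMm.le
      rw [Finset.card_range]
      push_cast
      gcongr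
      rw [show (2 : ℝ) / m = 2 * (1 / m) by ring]
      linarith
  have hbad' : ∑ j ∈ (Finset.range M).filter (fun j => ¬ good j), freqProb (m + ℓ) g j ≤
      ∑ j ∈ A₁, freqProb (m + ℓ) g j + ∑ j ∈ A₂, freqProb (m + ℓ) g j := by
    refine (Finset.sum_le_sum_of_subset_of_nonneg hbad
      fun j _ _ => freqProb_nonneg _ _ _).trans ?_
    have := Finset.sum_union_inter (s₁ := A₁) (s₂ := A₂) (f := fun j => freqProb (m + ℓ) g j)
    have h₀ : 0 ≤ ∑ j ∈ A₁ ∩ A₂, freqProb (m + ℓ) g j :=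
      Finset.sum_nonneg fun j _ => freqProb_nonneg _ _ _
    linarith
  change _ ≤ ∑ j ∈ (Finset.range M).filter good, freqProb (m + ℓ) g j
  linarith

end Success

/-- For `r ≥ 2 ^ 2 ^ L` the number `log₂ m` is at least `L`, and the probability of failure is at
most `40 / L`. -/
theorem exists_forall_one_sub_le_successProb (V : Variant) {ε : ℝ} (hε : 0 < ε) :
    ∃ R : ℕ, ∀ (G : Type u) [Group G] [Fintype G] [DecidableEq G] (g : G) (m ℓ : ℕ),
      R ≤ orderOf g → orderOf g < 2 ^ m → orderOf g ^ 2 < 2 ^ (m + ℓ) →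
      1 - ε ≤ successProb V g 1 m m ℓ := by
  obtain ⟨L, hL⟩ := exists_nat_ge (40 / ε)
  have hL0 : (0 : ℝ) < L := (by positivity : (0 : ℝ) < 40 / ε).trans_le hL
  have hL1 : 1 ≤ L := by exact_mod_cast hL0
  refine ⟨2 ^ 2 ^ L, fun G _ _ _ g m ℓ hR hrm hrM => ?_⟩
  have hm : 2 ^ L < m := (Nat.pow_lt_pow_iff_right (a := 2) (by norm_num)).1 (hR.trans_lt hrm)
  have hLL : L < 2 ^ L := Nat.lt_two_pow_self
  have hLr : L ≤ orderOf g := (hLL.le.trans Nat.lt_two_pow_self.le).trans hR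
  have hlog : L ≤ Nat.log 2 m := Nat.le_log_of_pow_le (by norm_num) hm.le
  have hc := card_unsmooth_mul_log_le (orderOf_pos g) (by omega) hrm
  have hc' : (unsmooth (orderOf g) m).card * L ≤ orderOf g :=
    (Nat.mul_le_mul_left _ hlog).trans hc
  refine le_trans ?_ (one_sub_le_successProb V (by omega) hrm hrM)
  have hr : (0 : ℝ) < orderOf g := by exact_mod_cast orderOf_pos g
  have hr1 : (1 : ℝ) ≤ orderOf g := by exact_mod_cast orderOf_pos g
  have hm0 : (0 : ℝ) < m := by exact_mod_cast (by omega : 0 < m)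
  have hmL : (L : ℝ) ≤ m := by exact_mod_cast (by omega : L ≤ m)
  have hrL : (L : ℝ) ≤ orderOf g := by exact_mod_cast hLr
  have h₁ : ((unsmooth (orderOf g) m).card : ℝ) ≤ orderOf g / L := by
    rw [le_div_iff₀ hL0]; exact_mod_cast hc'
  have h₂ : (((unsmooth (orderOf g) m).card : ℝ) + 2) * 12 / orderOf g ≤ 36 / L := by
    rw [div_le_div_iff₀ hr hL0]
    rw [le_div_iff₀ hL0] at h₁
    nlinarith
  have h₃ : ((orderOf g : ℝ) + 1) * (2 / m) / orderOf g ≤ 4 / L := by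
    have : (2 : ℝ) / m ≤ 2 / L := by gcongr
    rw [div_le_iff₀ hr]
    calc ((orderOf g : ℝ) + 1) * (2 / m) ≤ (2 * orderOf g) * (2 / L) := by gcongr; linarith
      _ = _ := by ring
  have h₄ : (40 : ℝ) / L ≤ ε := by
    rw [div_le_iff₀ hL0]
    rw [div_le_iff₀ hε] at hL
    linarith
  have h₅ : (36 : ℝ) / L + 4 / L = 40 / L := by ring
  linarith

/-! ### The circuit -/

section Circuit

variable {G : Type u} [Group G] {n : ℕ}

theorem runGates_append (C D : List (Gate n G)) (ψ : QState n G) :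
    runGates (C ++ D) ψ = runGates D (runGates C ψ) := List.foldl_append

theorem runGates_cons (γ : Gate n G) (C : List (Gate n G)) (ψ : QState n G) :
    runGates (γ :: C) ψ = runGates C (γ.apply ψ) := rfl

/-- The uniform superposition in the qubits of `S`, and `0` in the others. -/
noncomputable def uniformOn [DecidableEq G] (S : Finset (Fin n)) : QState n G := fun b x =>
  (1 / (Real.sqrt 2 : ℂ)) ^ S.card * if (∀ k ∉ S, b k = 0) ∧ x = 1 then 1 else 0

theorem runGates_hadamard [DecidableEq G] {l : List (Fin n)} {S : Finset (Fin n)}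
    (hl : l.Nodup) (hS : ∀ i ∈ l, i ∉ S) :
    runGates (l.map Gate.hadamard) (uniformOn (G := G) S) = uniformOn (S ∪ l.toFinset) := by
  induction l generalizing S with
  | nil => simp [runGates]
  | cons i l ih =>
    have hi : i ∉ S := hS i (by simp)
    have hstep : (Gate.hadamard i).apply (uniformOn (G := G) S) = uniformOn (insert i S) := by
      funext b x
      have hc : ∀ s : Fin 2, (∀ k ∉ S, Function.update b i s k = 0) ↔
          s = 0 ∧ ∀ k ∉ insert i S, b k = 0 := by
        intro s
        constructor
        · intro h
          refine ⟨by simpa using h i hi, fun k hk => ?_⟩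
          rw [Finset.mem_insert, not_or] at hk
          simpa [hk.1] using h k hk.2
        · rintro ⟨rfl, h⟩ k hk
          rcases eq_or_ne k i with rfl | hki
          · simp
          · simpa [hki] using h k (by simp [hki, hk])
      simp only [Gate.apply, uniformOn, hc, Fin.sum_univ_two, Finset.card_insert_of_notMem hi]
      simp
      ring_nf
    rw [List.map_cons, runGates_cons, hstep, ih (List.nodup_cons.1 hl).2]
    · congr 1
      ext k
      simp
    · intro k hk
      have : k ≠ i := by rintro rfl; exact (List.nodup_cons.1 hl).1 hk
      simp [this, hS k (by simp [hk])]

/-- The number with the bits `b i`, for `i` in the list `l`, least significant bit first. -/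
def bitValue (b : Fin n → Fin 2) (l : List (Fin n)) : ℕ :=
  l.foldr (fun i w => (b i).val + 2 * w) 0

/-- In `cmulGates l h` the qubits of `l` control `h`, `h ^ 2`, `h ^ 4`, …, so they multiply by `h`
to the power of the number they hold. -/
theorem runGates_cmulGates (l : List (Fin n)) (h : G) (ψ : QState n G) :
    runGates (cmulGates l h).val ψ = fun b x => ψ b (x * (h ^ bitValue b l)⁻¹) := by
  induction l generalizing h ψ with
  | nil => funext b x; simp [cmulGates, runGates, bitValue]
  | cons i l ih =>
    funext b x
    simp only [cmulGates, Timed.val_bind, Timed.val_ret, val_gmul, runGates_cons, ih, Gate.apply]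
    congr 1
    rw [mul_assoc, ← mul_inv_rev,
      show bitValue b (i :: l) = (b i).val + 2 * bitValue b l from rfl, pow_add, pow_mul, sq]

theorem bitValue_finRange (b : Fin n → Fin 2) :
    bitValue b (List.finRange n) = ∑ i, (b i).val * 2 ^ i.val := by
  induction n with
  | zero => simp [bitValue]
  | succ n ih =>
    have h : bitValue b ((List.finRange n).map Fin.succ) =
        bitValue (fun i => b i.succ) (List.finRange n) := by
      simp [bitValue, List.foldr_map]
    rw [List.finRange_succ, bitValue, List.foldr_cons, ← bitValue, h, ih, Fin.sum_univ_succ,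
      Finset.mul_sum]
    simp [pow_succ]
    exact Finset.sum_congr rfl fun i _ => by ring

/-- The phase that the gates with target `i` contribute, if the bit `s` is read off qubit `i` and
the bits of the exponent are `a`. -/
noncomputable def qftPhase (a : Fin n → Fin 2) (i : Fin n) (s : Fin 2) : ℂ :=
  (-1) ^ (s.val * (a i).val) * ∏ k ∈ Finset.univ.filter (· < i),
    Complex.exp (2 * Real.pi * Complex.I * (s.val * (a k).val) / 2 ^ (i.val - k.val + 1))

/-- The state after the part of the Fourier transform with targets in `S`: the qubits in `S` hold
bits of the frequency, the others still hold bits of the exponent. -/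
noncomputable def partialFourier (ψ : QState n G) (S : Finset (Fin n)) : QState n G := fun b x =>
  (1 / (Real.sqrt 2 : ℂ)) ^ S.card * ∑ a : Fin n → Fin 2,
    if ∀ k ∉ S, a k = b k then (∏ i ∈ S, qftPhase a i (b i)) * ψ a x else 0

theorem runGates_cphase (i : Fin n) (l : List (Fin n)) (d : Fin n → ℕ) (ψ : QState n G) :
    runGates (l.map fun k => Gate.cphase k i (d k)) ψ = fun b x =>
      (l.map fun k =>
        Complex.exp (2 * Real.pi * Complex.I * ((b k).val * (b i).val) / 2 ^ d k)).prod *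
        ψ b x := by
  induction l generalizing ψ with
  | nil => simp [runGates]
  | cons k l ih =>
    rw [List.map_cons, runGates_cons, ih]
    funext b x
    simp only [Gate.apply, List.map_cons, List.prod_cons]
    ring

/-- The Hadamard gate and the phase rotations with target `i`, if the targets in `S`, all greater
than `i`, have been processed: the controls `k < i` still hold bits of the exponent. -/
theorem runGates_qft_step (ψ : QState n G) {S : Finset (Fin n)} {i : Fin n}
    (hS : ∀ s ∈ S, i < s) :
    runGates (Gate.hadamard i :: ((List.finRange n).filter fun k => k < i).map fun k =>
      Gate.cphase k i (i.val - k.val + 1)) (partialFourier ψ S) =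
      partialFourier ψ (insert i S) := by
  have hi : i ∉ S := fun h => lt_irrefl _ (hS i h)
  funext b x
  rw [runGates_cons, runGates_cphase]
  simp only [Gate.apply, partialFourier, Finset.card_insert_of_notMem hi]
  set P := (((List.finRange n).filter fun k => k < i).map fun k => Complex.exp
    (2 * Real.pi * Complex.I * ((b k).val * (b i).val) / 2 ^ (i.val - k.val + 1))).prod with hP
  have hP' : P = ∏ k ∈ Finset.univ.filter (· < i), Complex.exp
      (2 * Real.pi * Complex.I * ((b k).val * (b i).val) / 2 ^ (i.val - k.val + 1)) := by
    rw [hP, ← List.prod_toFinset _ ((List.nodup_finRange n).filter _)]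
    congr 1
    ext k
    simp
  have key : ∀ a : Fin n → Fin 2, (P * ∑ s : Fin 2, (-1) ^ ((b i).val * s.val) *
      if ∀ k ∉ S, a k = Function.update b i s k then
        (∏ j ∈ S, qftPhase a j (Function.update b i s j)) * ψ a x else 0) =
      if ∀ k ∉ insert i S, a k = b k then (∏ j ∈ insert i S, qftPhase a j (b j)) * ψ a x
      else 0 := by
    intro a
    have hc : ∀ s : Fin 2, (∀ k ∉ S, a k = Function.update b i s k) ↔
        s = a i ∧ ∀ k ∉ insert i S, a k = b k := by
      intro s
      constructor
      · intro h
        refine ⟨by simpa using (h i hi).symm, fun k hk => ?_⟩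
        rw [Finset.mem_insert, not_or] at hk
        simpa [hk.1] using h k hk.2
      · rintro ⟨rfl, h⟩ k hk
        rcases eq_or_ne k i with rfl | hki
        · simp
        · simpa [hki] using h k (by simp [hki, hk])
    simp only [hc]
    by_cases h : ∀ k ∉ insert i S, a k = b k
    · rw [if_pos h, Finset.sum_eq_single (a i)]
      · rw [if_pos ⟨rfl, h⟩, Finset.prod_insert hi, qftPhase, hP']
        have e₁ : ∏ j ∈ S, qftPhase a j (Function.update b i (a i) j) =
            ∏ j ∈ S, qftPhase a j (b j) := by
          refine Finset.prod_congr rfl fun j hj => ?_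
          rw [Function.update_of_ne]
          rintro rfl; exact hi hj
        have e₂ : ∏ k ∈ Finset.univ.filter (· < i), Complex.exp
            (2 * Real.pi * Complex.I * ((b k).val * (b i).val) / 2 ^ (i.val - k.val + 1)) =
            ∏ k ∈ Finset.univ.filter (· < i), Complex.exp
            (2 * Real.pi * Complex.I * ((b i).val * (a k).val) / 2 ^ (i.val - k.val + 1)) := by
          refine Finset.prod_congr rfl fun k hk => ?_
          have hki : k < i := (Finset.mem_filter.1 hk).2
          rw [h k, mul_comm ((b k).val : ℂ)]
          rw [Finset.mem_insert, not_or]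
          exact ⟨hki.ne, fun hkS => (hS k hkS).not_gt hki⟩
        rw [e₁, e₂]
        ring
      · intro s _ hs
        rw [if_neg (fun h' => hs h'.1), mul_zero]
      · simp
    · rw [if_neg h, Finset.sum_eq_zero, mul_zero]
      intro s _
      rw [if_neg (fun h' => h h'.2), mul_zero]
  rw [← Finset.sum_congr rfl fun a _ => key a]
  simp only [Finset.mul_sum]
  rw [Finset.sum_comm]
  refine Finset.sum_congr rfl fun a _ => Finset.sum_congr rfl fun s _ => ?_
  ring

theorem runGates_qft_aux (ψ : QState n G) (l : List (Fin n)) (hl : l.Pairwise (· > ·))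
    (S : Finset (Fin n)) (hS : ∀ i ∈ l, ∀ s ∈ S, i < s) :
    runGates (l.flatMap fun i =>
      Gate.hadamard i :: ((List.finRange n).filter fun k => k < i).map fun k =>
      Gate.cphase k i (i.val - k.val + 1)) (partialFourier ψ S) =
      partialFourier ψ (S ∪ l.toFinset) := by
  induction l generalizing S with
  | nil => simp [runGates]
  | cons i l ih =>
    rw [List.flatMap_cons, runGates_append, runGates_qft_step ψ (hS i (by simp)), ih]
    · congr 1; ext k; simp
    · exact (List.pairwise_cons.1 hl).2
    · intro k hk s hs
      rcases Finset.mem_insert.1 hs with rfl | hs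
      · exact (List.pairwise_cons.1 hl).1 k hk
      · exact hS k (by simp [hk]) s hs

theorem partialFourier_empty {G : Type u} (ψ : QState n G) : partialFourier ψ ∅ = ψ := by
  funext b x
  simp [partialFourier, ← funext_iff]

theorem runGates_qft (ψ : QState n G) :
    runGates (qft n G) ψ = partialFourier ψ Finset.univ := by
  have := runGates_qft_aux ψ (List.finRange n).reverse
    (by rw [List.pairwise_reverse]; exact List.pairwise_lt_finRange n) ∅ (by simp)
  rw [partialFourier_empty] at this
  rw [qft]
  refine Eq.trans ?_ (this.trans ?_)
  · rfl
  · congr 1; ext; simp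

/-- The phases of the Fourier transform, in terms of the two numbers that the bits stand for. -/
theorem prod_qftPhase (a b : Fin n → Fin 2) :
    ∏ i, qftPhase a i (b i) = Complex.exp (2 * Real.pi * Complex.I / 2 ^ n *
      ((∑ k, (a k).val * 2 ^ k.val : ℕ) * (readout b : ℕ))) := by
  have hsplit : 2 * Real.pi * Complex.I / 2 ^ n *
      ((∑ k, (a k).val * 2 ^ k.val : ℕ) * (readout b : ℕ)) =
      ∑ i, ∑ k,
        2 * Real.pi * Complex.I * ((b i).val * (a k).val) * 2 ^ k.val / 2 ^ (i.val + 1) := by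
    rw [readout]
    push_cast
    rw [Finset.sum_mul_sum, Finset.sum_comm, Finset.mul_sum]
    refine Finset.sum_congr rfl fun i _ => ?_
    rw [Finset.mul_sum]
    refine Finset.sum_congr rfl fun k _ => ?_
    have : (2 : ℂ) ^ n = 2 ^ (n - 1 - i.val) * 2 ^ (i.val + 1) := by
      rw [← pow_add]; congr 1; omega
    rw [this]
    field_simp
  rw [hsplit, Complex.exp_sum]
  refine Finset.prod_congr rfl fun i _ => ?_
  rw [Complex.exp_sum, qftPhase]
  have hF : ∀ k : Fin n, Complex.exp
      (2 * Real.pi * Complex.I * ((b i).val * (a k).val) * 2 ^ k.val / 2 ^ (i.val + 1)) =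
      (if k = i then (-1) ^ ((b i).val * (a k).val) else 1) *
      if k < i then Complex.exp
        (2 * Real.pi * Complex.I * ((b i).val * (a k).val) / 2 ^ (i.val - k.val + 1)) else 1 := by
    intro k
    rcases lt_trichotomy k i with h | rfl | h
    -- `k < i`: a phase rotation
    · rw [if_neg h.ne, if_pos h, one_mul]
      congr 1
      have : (2 : ℂ) ^ (i.val + 1) = 2 ^ (i.val - k.val + 1) * 2 ^ k.val := by
        rw [← pow_add]; congr 1
        have : k.val < i.val := h
        omega
      rw [this]
      field_simp
    -- `k = i`: half a turn, contributed by the Hadamard gate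
    · rw [if_pos rfl, if_neg (lt_irrefl _), mul_one, ← Complex.exp_pi_mul_I, ← Complex.exp_nat_mul]
      congr 1
      push_cast
      rw [pow_succ]
      field_simp
    -- `k > i`: whole turns
    · rw [if_neg h.ne', if_neg h.not_gt, one_mul]
      have : (2 : ℂ) ^ k.val = 2 ^ (k.val - i.val - 1) * 2 ^ (i.val + 1) := by
        rw [← pow_add]; congr 1
        have : i.val < k.val := h
        omega
      rw [this,
        ← Complex.exp_nat_mul_two_pi_mul_I ((b i).val * (a k).val * 2 ^ (k.val - i.val - 1))]
      congr 1
      push_cast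
      field_simp
  rw [Finset.prod_congr rfl fun k _ => hF k, Finset.prod_mul_distrib, Finset.prod_ite_eq',
    if_pos (Finset.mem_univ _), Finset.prod_filter]

/-- The circuit prepares the state of the order-finding algorithm. -/
theorem runGates_circuit [DecidableEq G] (g : G) (b : Fin n → Fin 2) (x : G) :
    runGates (circuit n g).val (initial n) b x = amplitude n g (readout b) x := by
  have h₀ : initial (G := G) n = uniformOn ∅ := by
    funext b x
    simp [initial, uniformOn, funext_iff]
  have h₁ : (circuit n g).val = (List.finRange n).map Gate.hadamard ++
    (cmulGates (List.finRange n) g).val ++ qft n G := rfl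
  rw [h₁, runGates_append, runGates_append, h₀,
    runGates_hadamard (List.nodup_finRange n) (by simp), runGates_cmulGates, runGates_qft]
  have hu : (∅ : Finset (Fin n)) ∪ (List.finRange n).toFinset = Finset.univ := by ext; simp
  rw [hu]
  simp only [partialFourier, uniformOn, bitValue_finRange, prod_qftPhase, Finset.card_univ,
    Fintype.card_fin, Finset.mem_univ, not_true_eq_false, false_imp_iff, implies_true, if_true,
    true_and, mul_inv_eq_one]
  have hs : (1 / (Real.sqrt 2 : ℂ)) ^ n * (1 / (Real.sqrt 2 : ℂ)) ^ n = 1 / 2 ^ n := by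
    rw [← mul_pow, one_div_mul_one_div, ← Complex.ofReal_mul, Real.mul_self_sqrt (by norm_num)]
    simp
  rw [amplitude, ← hs, Finset.mul_sum, Finset.mul_sum]
  -- the exponents are summed by their bits
  rw [← Fin.sum_univ_eq_sum_range (fun a => (1 / (Real.sqrt 2 : ℂ)) ^ n *
    (1 / (Real.sqrt 2 : ℂ)) ^ n * if g ^ a = x then
    Complex.exp (2 * Real.pi * Complex.I / 2 ^ n * (a * (readout b : ℕ))) else 0) (2 ^ n)]
  refine Fintype.sum_equiv finFunctionFinEquiv _ _ fun a => ?_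
  rw [finFunctionFinEquiv_apply]
  by_cases hx : g ^ (∑ k, (a k).val * 2 ^ k.val) = x
  · rw [if_pos hx.symm, if_pos hx, mul_one]
    ring
  · rw [if_neg (Ne.symm hx), if_neg hx]
    simp

end Circuit

/-! ### Bounds for the time: arithmetic and primes -/

/-- A common bound for the number of bit operations and the number of group operations. -/
structure Timed.CostLe {α : Type u} (x : Timed α) (A : ℕ) : Prop where
  bitOps_le : x.bitOps ≤ A
  groupOps_le : x.groupOps ≤ A

/-- The binary length of `a` is less than `U`. -/
def Small (U a : ℕ) : Prop := a.size < U

theorem Small.mono {U a b : ℕ} (hb : Small U b) (h : a ≤ b) : Small U a :=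
  (Nat.size_le_size h).trans_lt hb

theorem small_of_le_two_pow {U a k : ℕ} (h : a ≤ 2 ^ k) (hk : k + 1 < U) : Small U a :=
  (Nat.size_le.2 (h.trans_lt (Nat.pow_lt_pow_right (by norm_num) (Nat.lt_succ_self k)))).trans_lt hk

namespace Timed

theorem CostLe.mono {α : Type u} {x : Timed α} {A B : ℕ} (h : x.CostLe A) (hAB : A ≤ B) :
    x.CostLe B := ⟨h.1.trans hAB, h.2.trans hAB⟩

theorem CostLe.bind {α : Type u} {β : Type v} {x : Timed α} {f : α → Timed β} {A B C : ℕ}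
    (hx : x.CostLe A) (hf : (f x.val).CostLe B) (h : A + B ≤ C) : (x.bind f).CostLe C :=
  ⟨(Nat.add_le_add hx.1 hf.1).trans h, (Nat.add_le_add hx.2 hf.2).trans h⟩

theorem CostLe.time_le {α : Type u} {x : Timed α} {A : ℕ} (h : x.CostLe A) (τ : ℕ) :
    x.time τ ≤ A * (1 + τ) := by
  have h₁ := h.1
  have h₂ : τ * x.groupOps ≤ τ * A := Nat.mul_le_mul_left _ h.2
  rw [Timed.time]
  linarith

theorem costLe_ret {α : Type u} (a : α) : (ret a).CostLe 1 := ⟨le_rfl, Nat.zero_le _⟩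

end Timed

section Basic

variable {U : ℕ}

theorem costLe_op {α : Type u} {a b : ℕ} (ha : Small U a) (hb : Small U b) (x : α) :
    (op a b x).CostLe (U ^ 2) :=
  ⟨by rw [sq]; exact Nat.mul_le_mul ha hb, Nat.zero_le _⟩

theorem costLe_iop {α : Type u} {a b : ℤ} (ha : Small U a.natAbs) (hb : Small U b.natAbs)
    (x : α) : (iop a b x).CostLe (U ^ 2) := costLe_op ha hb x

theorem costLe_rangeT {s k : ℕ} (h : Small U (s + k)) : (rangeT s k).CostLe (k * U + 1) :=
  ⟨Nat.add_le_add_right (Nat.mul_le_mul_left _ h) _, Nat.zero_le _⟩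

theorem costLe_mapT {α : Type u} {β : Type v} {f : α → Timed β} {l : List α} {A : ℕ}
    (h : ∀ a ∈ l, (f a).CostLe A) : (mapT f l).CostLe (l.length * (A + 1) + 1) := by
  induction l with
  | nil => exact (costLe_ret _).mono (by simp)
  | cons a l ih =>
    refine (h a (by simp)).bind ((ih fun a ha => h a (by simp [ha])).bind (costLe_ret _) le_rfl) ?_
    rw [List.length_cons, Nat.succ_mul]; omega

theorem costLe_filterT {α : Type u} {p : α → Timed Bool} {l : List α} {A : ℕ}
    (h : ∀ a ∈ l, (p a).CostLe A) : (filterT p l).CostLe (l.length * (A + 1) + 1) := by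
  induction l with
  | nil => exact (costLe_ret _).mono (by simp)
  | cons a l ih =>
    refine (h a (by simp)).bind ((ih fun a ha => h a (by simp [ha])).bind (costLe_ret _) le_rfl) ?_
    rw [List.length_cons, Nat.succ_mul]; omega

theorem costLe_gpow {G : Type u} [Group G] (x : G) {k : ℕ} (hk : Small U k) :
    (gpow x k).CostLe (2 * U) := by
  have h : ∀ l : List Bool, (powBits x l).CostLe (2 * l.length + 1) := by
    intro l
    induction l with
    | nil => exact costLe_ret _
    | cons b l ih =>
      have : ∀ y z : G, (gmul y z).groupOps = 1 ∧ (gmul y z).bitOps = 0 := fun _ _ => ⟨rfl, rfl⟩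
      constructor
      · have := ih.1
        cases b <;> simp [powBits, *] <;> omega
      · have := ih.2
        cases b <;> simp [powBits, *] <;> omega
  refine (h _).mono ?_
  have : k.bits.length < U := by rwa [Nat.size_eq_bits_len]
  omega

theorem costLe_isOne {G : Type u} [Group G] [DecidableEq G] (x : G) : (isOne x).CostLe 1 :=
  ⟨Nat.zero_le _, le_rfl⟩

/-- For a large base, any sum of few terms of one degree is bounded by the next power. -/
theorem hundred_mul_pow_le (hU : 100 ≤ U) : 100 * U ≤ U ^ 2 ∧ 100 * U ^ 2 ≤ U ^ 3 ∧
    100 * U ^ 3 ≤ U ^ 4 ∧ 100 * U ^ 4 ≤ U ^ 5 ∧ 100 * U ^ 5 ≤ U ^ 6 ∧ 100 * U ^ 6 ≤ U ^ 7 ∧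
    100 * U ^ 7 ≤ U ^ 8 ∧ 100 * U ^ 8 ≤ U ^ 9 ∧ 100 * U ^ 9 ≤ U ^ 10 ∧
    100 * U ^ 10 ≤ U ^ 11 := by
  have h : ∀ i, 100 * U ^ i ≤ U ^ (i + 1) := fun i => by
    rw [pow_succ, mul_comm]; exact Nat.mul_le_mul_left _ hU
  have h1 := h 1
  rw [pow_one] at h1
  exact ⟨h1, h 2, h 3, h 4, h 5, h 6, h 7, h 8, h 9, h 10⟩

theorem costLe_noDivisor {q : ℕ} {l : List ℕ} (hq : Small U q) (hl : ∀ d ∈ l, Small U d) :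
    (noDivisor q l).CostLe (l.length * (U ^ 2 + 1) + 1) := by
  induction l with
  | nil => exact (costLe_ret _).mono (by simp)
  | cons d l ih =>
    have ih' := ih fun d hd => hl d (by simp [hd])
    rw [noDivisor]
    refine (costLe_op hq (hl d (by simp)) _).bind (B := l.length * (U ^ 2 + 1) + 1) ?_ ?_
    · split_ifs
      · exact (costLe_ret _).mono (by simp)
      · exact ih'
    · rw [List.length_cons, Nat.succ_mul]; omega

theorem costLe_primesUpTo (hU : 100 ≤ U) {N : ℕ} (hN : Small U (N + 1)) (hNU : N ≤ U) :
    (primesUpTo N).CostLe (U ^ 6) := by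
  obtain ⟨h1, h2, h3, h4, h5, -⟩ := hundred_mul_pow_le hU
  rcases Nat.eq_zero_or_pos N with rfl | hN0
  · have h' : Small U 2 := small_of_le_two_pow (k := 1) (by norm_num) (by omega)
    refine (costLe_rangeT (k := 0 - 1) h').bind (B := 1)
      (by exact (costLe_ret _)) ?_
    simp; linarith
  refine (costLe_rangeT (hN.mono (by omega))).bind
    (costLe_filterT (A := (N + 1) * U + N * (U ^ 2 + 1) + 2) fun q hq => ?_) ?_
  · have hq' := List.mem_range'_1.1 hq
    refine (costLe_rangeT (hN.mono (by omega))).bind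
      (costLe_noDivisor (hN.mono (by omega)) fun d hd => ?_) ?_
    · have hd' := List.mem_range'_1.1 hd
      exact hN.mono (by omega)
    · simp only [val_rangeT, List.length_range']
      have e₁ : (q - 2) * U ≤ N * U := Nat.mul_le_mul_right _ (by omega)
      have e₂ : (q - 2) * (U ^ 2 + 1) ≤ N * (U ^ 2 + 1) := Nat.mul_le_mul_right _ (by omega)
      linarith
  · simp only [val_rangeT, List.length_range']
    have e₁ : (N - 1) * U ≤ U * U := Nat.mul_le_mul_right _ (by omega)
    have e₂ : (N - 1) * ((N + 1) * U + N * (U ^ 2 + 1) + 2 + 1) ≤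
        U * ((U + 1) * U + U * (U ^ 2 + 1) + 2 + 1) := by
      gcongr
      omega
    linarith

theorem costLe_maxPowLoop {N q : ℕ} (hNU : Small U N) (hNq : Small U (N * q)) (hq : Small U q)
    (i e : ℕ) {p : ℕ} (hp : p ≤ N) : (maxPowLoop N q i e p).CostLe (i * (2 * U ^ 2) + 1) := by
  induction i generalizing e p with
  | zero => exact (costLe_ret _).mono (by simp)
  | succ i ih =>
    rw [maxPowLoop]
    have hpN : p * q ≤ N * q := Nat.mul_le_mul_right _ hp
    refine (costLe_op (hNU.mono hp) hq _).bind
      (B := U ^ 2 + (i * (2 * U ^ 2) + 1)) ?_ (by linarith)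
    refine (costLe_op (hNq.mono hpN) hNU _).bind (B := i * (2 * U ^ 2) + 1) ?_ le_rfl
    rw [val_op, val_op]
    split_ifs with h
    · exact ih _ (of_decide_eq_true h)
    · exact (costLe_ret _).mono (by simp)

/-- The conditions on the common bound `U` for the lengths of all numbers that occur. The lengths of
products of at most `m` factors not greater than `m` are covered by the term `m * m`, and the
lengths of the numbers in the solvers by `10 * n`. -/
structure Large (U n m : ℕ) : Prop where
  hundred_le : 100 ≤ U
  two_le : 2 ≤ m
  le : m ≤ n
  lt : m * m + 10 * n + 50 < U

variable {n m : ℕ} {F : List ℕ}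

theorem Large.small_add_one (h : Large U n m) : Small U (m + 1) := by
  refine small_of_le_two_pow (k := m + 1) Nat.lt_two_pow_self.le ?_
  nlinarith [h.lt, h.le]

theorem Large.small_mul (h : Large U n m) : Small U (m * m) := by
  refine small_of_le_two_pow (k := m * m) Nat.lt_two_pow_self.le ?_
  have := h.lt; have := h.le
  omega

theorem costLe_maxPow (h : Large U n m) {q : ℕ} (hq : q ≤ m) : (maxPow m q).CostLe (U ^ 4) := by
  obtain ⟨h1, h2, h3, -⟩ := hundred_mul_pow_le h.hundred_le
  refine (costLe_maxPowLoop (h.small_add_one.mono (by omega))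
    (h.small_mul.mono (Nat.mul_le_mul_left _ hq)) (h.small_add_one.mono (by omega)) _ _
    (by have := h.two_le; omega)).mono ?_
  have : m.size ≤ U := (h.small_add_one.mono (by omega) : Small U m).le
  have e : m.size * (2 * U ^ 2) ≤ U * (2 * U ^ 2) := Nat.mul_le_mul_right _ this
  have := h.hundred_le
  linarith

theorem smoothBound_le (hm : 1 ≤ m) (F : List ℕ) : smoothBound m F ≤ m ^ F.length := by
  induction F with
  | nil => simp
  | cons q F ih =>
    rw [smoothBound_cons, List.length_cons, pow_succ']
    exact Nat.mul_le_mul (Nat.pow_log_le_self q (by omega)) ih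

theorem Large.small_pow (h : Large U n m) {k : ℕ} (hk : k ≤ m) : Small U (m ^ k) := by
  refine small_of_le_two_pow (k := m * m) ?_ ?_
  · rw [pow_mul]
    exact (Nat.pow_le_pow_left Nat.lt_two_pow_self.le _).trans
      (Nat.pow_le_pow_right (by positivity) hk)
  · have := h.lt; have := h.le
    omega

theorem costLe_prodMaxPow (h : Large U n m) (hF : ∀ q ∈ F, 2 ≤ q ∧ q ≤ m) (hlen : F.length ≤ m) :
    (prodMaxPow m F).CostLe (U ^ 6) := by
  have hm : 1 ≤ m := by have := h.two_le; omega
  obtain ⟨h1, h2, h3, h4, h5, -⟩ := hundred_mul_pow_le h.hundred_le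
  have key : (prodMaxPow m F).CostLe (F.length * (U ^ 4 + U ^ 2) + 1) := by
    clear h1 h2 h3 h4 h5
    induction F with
    | nil => exact (costLe_ret _).mono (by simp)
    | cons q F ih =>
      rw [List.length_cons] at hlen ⊢
      have hF' : ∀ q ∈ F, 2 ≤ q ∧ q ≤ m := fun p hp => hF p (by simp [hp])
      have hq := hF q (by simp)
      refine (costLe_maxPow h hq.2).bind ((ih hF' (by omega)).bind
        (costLe_op (U := U) ?_ ?_ _) le_rfl) ?_
      · rw [val_maxPow hm hq.1]
        exact h.small_add_one.mono ((Nat.pow_log_le_self q (by omega)).trans (by omega))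
      · rw [val_prodMaxPow hm fun q hq => (hF' q hq).1]
        exact (h.small_pow (by omega : F.length ≤ m)).mono (smoothBound_le hm F)
      · linarith
  refine key.mono ?_
  have : F.length ≤ U := by have := h.lt; have := h.le; omega
  have e : F.length * (U ^ 4 + U ^ 2) ≤ U * (U ^ 4 + U ^ 2) := Nat.mul_le_mul_right _ this
  have := h.hundred_le
  linarith

end Basic

/-! ### Bounds for the time: recovery -/

section Tree

variable {G : Type u} [Group G] {U n m : ℕ} {F : List ℕ}

/-- A tree with `k ≥ 1` leaves has `2 * k - 1` nodes. -/
theorem costLe_tree (h : Large U n m) (hF : ∀ q ∈ F, 2 ≤ q ∧ q ≤ m) (hlen : F.length ≤ m) (x : G) :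
    (tree m F x).CostLe ((2 * F.length - 1) * U ^ 7 + 1) := by
  obtain ⟨h1, h2, h3, h4, h5, h6, -⟩ := hundred_mul_pow_le h.hundred_le
  have hU := h.hundred_le
  have hlU : m ≤ U := by have := h.lt; have := h.le; omega
  have hm : 1 ≤ m := by have := h.two_le; omega
  induction F, x using tree.induct with
  | case1 => rw [tree]; exact (costLe_ret _).mono (by simp)
  | case2 x q => rw [tree]; exact (costLe_ret _).mono (by simp)
  | case3 x q₁ q₂ qs F' ih₁ ih₂ =>
    have hF' : ∀ q ∈ F', 2 ≤ q ∧ q ≤ m := hF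
    have hlen' : F'.length ≤ m := hlen
    have ht : ∀ q ∈ F'.take (F'.length / 2), 2 ≤ q ∧ q ≤ m :=
      fun q h => hF' q (List.mem_of_mem_take h)
    have hd : ∀ q ∈ F'.drop (F'.length / 2), 2 ≤ q ∧ q ≤ m :=
      fun q h => hF' q (List.mem_of_mem_drop h)
    have l2 : 2 ≤ F'.length := by simp [F']
    have lt : (F'.take (F'.length / 2)).length = F'.length / 2 := by
      rw [List.length_take]; omega
    have ld : (F'.drop (F'.length / 2)).length = F'.length - F'.length / 2 := by
      rw [List.length_drop]
    have ct := costLe_prodMaxPow h ht (by omega)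
    have cd := costLe_prodMaxPow h hd (by omega)
    have st : Small U (prodMaxPow m (F'.take (F'.length / 2))).val := by
      rw [val_prodMaxPow hm fun q hq => (ht q hq).1]
      exact (h.small_pow (by omega)).mono (smoothBound_le hm _)
    have sd : Small U (prodMaxPow m (F'.drop (F'.length / 2))).val := by
      rw [val_prodMaxPow hm fun q hq => (hd q hq).1]
      exact (h.small_pow (by omega)).mono (smoothBound_le hm _)
    have i₁ := fun x => ih₁ x ht (by omega)
    have i₂ := fun x => ih₂ x hd (by omega)
    simp only [lt] at i₁
    simp only [ld] at i₂
    change (tree m F' x).CostLe ((2 * F'.length - 1) * U ^ 7 + 1)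
    rw [show tree m F' x = _ from tree.eq_3 m x q₁ q₂ qs]
    refine cd.bind (ct.bind ((costLe_gpow _ sd).bind ((costLe_gpow _ st).bind ((i₁ _).bind
      ((i₂ _).bind (B := m) ⟨hlen', Nat.zero_le _⟩ le_rfl) le_rfl) le_rfl) le_rfl) le_rfl) ?_
    have e : 2 * F'.length - 1 = (2 * (F'.length / 2) - 1) +
      (2 * (F'.length - F'.length / 2) - 1) + 1 := by omega
    rw [e]
    linarith

end Tree

section Recover

variable {G : Type u} [Group G] [DecidableEq G] {U n m : ℕ} {F : List ℕ}

theorem costLe_inRange {t : ℕ} (h : Large U n m) (ht : Small U t) :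
    (inRange m t).CostLe (U ^ 2) :=
  costLe_op ht (small_of_le_two_pow le_rfl (by have := h.lt; have := h.le; omega)) _

/-- What the bounds need to know of the entries `(x, q, e)` that `climb` pushes onto the stack. -/
def GoodEntry (m : ℕ) (s : G × ℕ × ℕ) : Prop :=
  1 ≤ s.2.1 ∧ s.2.1 ≤ m ∧ s.2.2 ≤ m ∧ s.2.1 ^ s.2.2 ≤ m

theorem climb_spec (h : Large U n m) (hF : ∀ q ∈ F, 2 ≤ q ∧ q ≤ m) (x : G)
    {S : List (G × ℕ × ℕ)} (hS : ∀ s ∈ S, GoodEntry m s) :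
    (climb m F x S).CostLe (F.length * (U ^ 4 + 2 * U + 2) + 1) ∧
      (climb m F x S).val.2.length ≤ F.length + S.length ∧
      ∀ s ∈ (climb m F x S).val.2, GoodEntry m s := by
  have hm : 1 ≤ m := by have := h.two_le; omega
  induction F generalizing x S with
  | nil => exact ⟨(costLe_ret _).mono (by simp), by simp [climb], by simpa [climb] using hS⟩
  | cons q F ih =>
    have hq := hF q (by simp)
    have hlog : q ^ Nat.log q m ≤ m := Nat.pow_log_le_self q (by omega)
    have hS' : ∀ s ∈ (x, q, Nat.log q m) :: S, GoodEntry m s := by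
      intro s hs
      rcases List.mem_cons.1 hs with rfl | hs
      · exact ⟨(by omega : 1 ≤ q), hq.2, Nat.log_le_self q m, hlog⟩
      · exact hS s hs
    have ih' := ih (fun p hp => hF p (by simp [hp])) (x ^ q ^ Nat.log q m) hS'
    have hc : Small U (maxPow m q).val.2 := by
      rw [val_maxPow hm hq.1]; exact h.small_add_one.mono (hlog.trans (by omega))
    rw [climb, List.length_cons]
    refine ⟨(costLe_maxPow h hq.2).bind ((costLe_gpow _ hc).bind ((costLe_isOne _).bind
      (B := F.length * (U ^ 4 + 2 * U + 2) + 1) ?_ le_rfl) le_rfl) ?_, ?_, ?_⟩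
    · rw [val_gpow, val_isOne, val_maxPow hm hq.1]
      split_ifs
      · exact (costLe_ret _).mono (by simp)
      · exact ih'.1
    · linarith
    · by_cases hx : x ^ q ^ Nat.log q m = 1
      · simp [val_maxPow hm hq.1, hx]
      · simp only [val_bind, val_gpow, val_isOne, val_maxPow hm hq.1, hx, decide_false]
        refine ih'.2.1.trans ?_
        simp; omega
    · by_cases hx : x ^ q ^ Nat.log q m = 1
      · simpa only [val_bind, val_gpow, val_isOne, val_maxPow hm hq.1, hx, decide_true, if_true,
          val_ret] using hS'
      · simp only [val_bind, val_gpow, val_isOne, val_maxPow hm hq.1, hx, decide_false]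
        exact ih'.2.2

/-- The bound `D` for the multiples of `d` that occur keeps the operands small. -/
theorem peel_spec {D q : ℕ} (hD : Small U D) (hq : 1 ≤ q) (hqU : Small U q) (i : ℕ) (x : G) {d : ℕ}
    (hd : d * q ^ i ≤ D) :
    (peel q i x d).CostLe (i * (2 * U + U ^ 2 + 1) + 1) ∧ (peel q i x d).val ≤ d * q ^ i := by
  induction i generalizing x d with
  | zero => exact ⟨(costLe_ret _).mono (by simp), by simp [peel]⟩
  | succ i ih =>
    have hle : d ≤ d * q ^ (i + 1) := Nat.le_mul_of_pos_right _ (by positivity)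
    have e : d * q * q ^ i = d * q ^ (i + 1) := by ring
    have ih' := ih (x ^ q) (d := d * q) (by rw [e]; exact hd)
    rw [peel]
    constructor
    · refine (costLe_isOne _).bind (B := 2 * U + (U ^ 2 + (i * (2 * U + U ^ 2 + 1) + 1))) ?_
        (by linarith)
      split_ifs
      · exact (costLe_ret _).mono (by omega)
      · refine (costLe_gpow _ hqU).bind ((costLe_op (hD.mono (hle.trans hd)) hqU _).bind ?_ le_rfl)
          le_rfl
        simpa using ih'.1
    · simp only [val_bind]
      split_ifs
      · exact hle
      · simp only [val_bind, val_gpow, val_op]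
        exact ih'.2.trans e.le

theorem backtrack_spec (h : Large U n m) {D : ℕ} (hD : Small U D) {S : List (G × ℕ × ℕ)}
    (hS : ∀ s ∈ S, GoodEntry m s) {d : ℕ} (hd : d * m ^ S.length ≤ D) :
    (backtrack S d).CostLe (S.length * (U ^ 4 + 2 * U) + 1) ∧ (backtrack S d).val ≤ D := by
  have hm : 1 ≤ m := by have := h.two_le; omega
  have hU := h.hundred_le
  obtain ⟨h1, h2, h3, -⟩ := hundred_mul_pow_le hU
  have hmU : m ≤ U := by have := h.lt; have := h.le; omega
  induction S generalizing d with
  | nil => exact ⟨(costLe_ret _).mono (by simp), by simpa [backtrack] using hd⟩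
  | cons s S ih =>
    obtain ⟨x, q, e⟩ := s
    obtain ⟨hq, hqm, hem, hqe⟩ := hS (x, q, e) (by simp)
    dsimp only at hq hqm hem hqe
    rw [List.length_cons] at hd ⊢
    have hmul : d * q ^ e * m ^ S.length ≤ D := by
      refine le_trans ?_ hd
      rw [pow_succ', ← mul_assoc]
      exact Nat.mul_le_mul_right _ (Nat.mul_le_mul_left _ hqe)
    have hdq : d * q ^ e ≤ D := (Nat.le_mul_of_pos_right _ (by positivity)).trans hmul
    have hdD : d ≤ D := (Nat.le_mul_of_pos_right _ (by positivity)).trans hdq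
    have hp := peel_spec hD hq (h.small_add_one.mono (by omega)) e (x ^ d) hdq
    have ih' := ih (fun s hs => hS s (by simp [hs])) (d := (peel q e (x ^ d) d).val)
      ((Nat.mul_le_mul_right _ hp.2).trans hmul)
    have hp' : (peel q e (x ^ d) d).CostLe (U ^ 4) := by
      refine hp.1.mono ?_
      have : e * (2 * U + U ^ 2 + 1) ≤ U * (2 * U + U ^ 2 + 1) := Nat.mul_le_mul_right _ (by omega)
      linarith
    rw [backtrack]
    constructor
    · refine (costLe_gpow _ (hD.mono hdD)).bind (B := U ^ 4 + (S.length * (U ^ 4 + 2 * U) + 1)) ?_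
        (by linarith)
      rw [val_gpow]
      exact hp'.bind ih'.1 le_rfl
    · simpa using ih'.2

theorem costLe_recoverStack (h : Large U n m) (hF : ∀ q ∈ F, 2 ≤ q ∧ q ≤ m) (hlen : F.length ≤ m)
    (g : G) {t : ℕ} (ht : Small U t) : (recoverStack m m F g t).CostLe (U ^ 7) := by
  obtain ⟨h1, h2, h3, h4, h5, h6, -⟩ := hundred_mul_pow_le h.hundred_le
  have hU := h.hundred_le
  have hlU : F.length ≤ U := by have := h.lt; have := h.le; omega
  have hD := h.small_pow hlen
  obtain ⟨c₁, c₂, c₃⟩ := climb_spec h hF (g ^ t) (S := []) (by simp)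
  have hm : 1 ≤ m := by have := h.two_le; omega
  obtain ⟨b₁, b₂⟩ := backtrack_spec h hD c₃ (d := 1) (by
    rw [one_mul]; exact Nat.pow_le_pow_right hm (by simpa using c₂))
  have c₁' : (climb m F (g ^ t) []).CostLe (U ^ 6) := by
    refine c₁.mono ?_
    have : F.length * (U ^ 4 + 2 * U + 2) ≤ U * (U ^ 4 + 2 * U + 2) := Nat.mul_le_mul_right _ hlU
    linarith
  have b₁' : (backtrack (climb m F (g ^ t) []).val.2 1).CostLe (U ^ 6) := by
    refine b₁.mono ?_
    have : (climb m F (g ^ t) []).val.2.length * (U ^ 4 + 2 * U) ≤ U * (U ^ 4 + 2 * U) :=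
      Nat.mul_le_mul_right _ (c₂.trans (by simpa using hlU))
    linarith
  rw [recoverStack]
  refine (costLe_inRange h ht).bind
    (B := 2 * U + (1 + (U ^ 6 + (1 + (U ^ 6 + U ^ 2))))) ?_ (by linarith)
  split_ifs
  · refine (costLe_gpow _ ht).bind ((costLe_isOne _).bind
      (B := U ^ 6 + (1 + (U ^ 6 + U ^ 2))) ?_ le_rfl) le_rfl
    rw [val_gpow]
    split_ifs
    · exact (costLe_ret _).mono (by omega)
    · refine c₁'.bind ((costLe_isOne _).bind (B := U ^ 6 + U ^ 2) ?_ le_rfl) le_rfl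
      split_ifs
      · exact b₁'.bind (costLe_op (hD.mono b₂) ht _) le_rfl
      · exact (costLe_ret _).mono (by linarith)
  · exact (costLe_ret _).mono (by omega)

theorem treePeel_spec {D q : ℕ} (hD : Small U D) (hq : 1 ≤ q) (hqU : Small U q) (i : ℕ) (x : G)
    {d : ℕ} (hd : d * q ^ i ≤ D) :
    (treePeel q i x d).CostLe (i * (2 * U + U ^ 2 + 1) + 2) ∧
      ∀ d', (treePeel q i x d).val = some d' → d' ≤ d * q ^ i := by
  induction i generalizing x d with
  | zero =>
    refine ⟨(costLe_isOne x).bind (costLe_ret _) (by simp), fun d' hd' => ?_⟩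
    by_cases hx : x = 1 <;> simp [treePeel, hx] at hd' ⊢
    exact hd'.ge
  | succ i ih =>
    have hle : d ≤ d * q ^ (i + 1) := Nat.le_mul_of_pos_right _ (by positivity)
    have e : d * q * q ^ i = d * q ^ (i + 1) := by ring
    have ih' := ih (x ^ q) (d := d * q) (by rw [e]; exact hd)
    rw [treePeel]
    constructor
    · refine (costLe_isOne _).bind (B := 2 * U + (U ^ 2 + (i * (2 * U + U ^ 2 + 1) + 2))) ?_
        (by linarith)
      split_ifs
      · exact (costLe_ret _).mono (by omega)
      · refine (costLe_gpow _ hqU).bind ((costLe_op (hD.mono (hle.trans hd)) hqU _).bind ?_ le_rfl)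
          le_rfl
        simpa using ih'.1
    · rw [val_bind]
      split_ifs
      · intro d' hd'
        simp only [val_ret, Option.some.injEq] at hd'
        exact hd' ▸ hle
      · simp only [val_bind, val_gpow, val_op]
        exact fun d' hd' => (ih'.2 d' hd').trans e.le

theorem treeCollect_spec (h : Large U n m) {D : ℕ} (hD : Small U D) {T : List (ℕ × G)}
    (hT : ∀ p ∈ T, 2 ≤ p.1 ∧ p.1 ≤ m) {d : ℕ} (hd : d * m ^ T.length ≤ D) :
    (treeCollect m T d).CostLe (T.length * (2 * U ^ 4) + 1) ∧
      ∀ d', (treeCollect m T d).val = some d' → d' ≤ D := by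
  have hm : 1 ≤ m := by have := h.two_le; omega
  have hU := h.hundred_le
  obtain ⟨h1, h2, h3, -⟩ := hundred_mul_pow_le hU
  have hmU : m ≤ U := by have := h.lt; have := h.le; omega
  induction T generalizing d with
  | nil => exact ⟨(costLe_ret _).mono (by simp), by simpa [treeCollect] using hd⟩
  | cons p T ih =>
    obtain ⟨q, x⟩ := p
    obtain ⟨hq, hqm⟩ := hT (q, x) (by simp)
    dsimp only at hq hqm
    rw [List.length_cons] at hd ⊢
    have hmul : d * q ^ Nat.log q m * m ^ T.length ≤ D := by
      refine le_trans ?_ hd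
      rw [pow_succ', ← mul_assoc]
      exact Nat.mul_le_mul_right _ (Nat.mul_le_mul_left _ (Nat.pow_log_le_self q (by omega)))
    have hdq : d * q ^ Nat.log q m ≤ D := (Nat.le_mul_of_pos_right _ (by positivity)).trans hmul
    have hp := treePeel_spec hD (by omega) (h.small_add_one.mono (by omega)) (Nat.log q m) x hdq
    have hp' : (treePeel q (Nat.log q m) x d).CostLe (U ^ 4) := by
      refine hp.1.mono ?_
      have : Nat.log q m * (2 * U + U ^ 2 + 1) ≤ U * (2 * U + U ^ 2 + 1) :=
        Nat.mul_le_mul_right _ ((Nat.log_le_self q m).trans hmU)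
      linarith
    rw [treeCollect]
    have hv := val_maxPow hm hq
    constructor
    · refine (costLe_maxPow h hqm).bind (B := U ^ 4 + (T.length * (2 * U ^ 4) + 1)) ?_
        (by linarith)
      rw [hv]
      refine hp'.bind ?_ le_rfl
      rcases ho : (treePeel q (Nat.log q m) x d).val with - | d'
      · exact (costLe_ret _).mono (by simp)
      · exact (ih (fun p hp => hT p (by simp [hp])) (d := d')
          ((Nat.mul_le_mul_right _ (hp.2 d' ho)).trans hmul)).1
    · simp only [val_bind, hv]
      rcases ho : (treePeel q (Nat.log q m) x d).val with - | d'
      · simp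
      · exact (ih (fun p hp => hT p (by simp [hp])) (d := d')
          ((Nat.mul_le_mul_right _ (hp.2 d' ho)).trans hmul)).2

theorem costLe_recoverTree (h : Large U n m) (hF : ∀ q ∈ F, q.Prime ∧ q ≤ m)
    (hlen : F.length ≤ m) (g : G) {t : ℕ} (ht : Small U t) :
    (recoverTree m m F g t).CostLe (U ^ 9) := by
  obtain ⟨h1, h2, h3, h4, h5, h6, h7, h8, -⟩ := hundred_mul_pow_le h.hundred_le
  have hU := h.hundred_le
  have hmU : m ≤ U := by have := h.lt; have := h.le; omega
  have hm : 1 ≤ m := by have := h.two_le; omega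
  have hF' : ∀ q ∈ F, 2 ≤ q ∧ q ≤ m := fun q hq => ⟨(hF q hq).1.two_le, (hF q hq).2⟩
  have hv := val_tree hm (fun q hq => (hF q hq).1) (g ^ t)
  have ct : (tree m F (g ^ t)).CostLe (3 * U ^ 8) := by
    refine (costLe_tree h hF' hlen (g ^ t)).mono ?_
    have : (2 * F.length - 1) * U ^ 7 ≤ (2 * U) * U ^ 7 := Nat.mul_le_mul_right _ (by omega)
    linarith
  obtain ⟨c₁, c₂⟩ := treeCollect_spec h (h.small_pow hlen) (T := (tree m F (g ^ t)).val) (d := 1)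
    (by rw [hv]; simpa using hF') (by rw [hv]; simp)
  have c₁' : (treeCollect m (tree m F (g ^ t)).val 1).CostLe (U ^ 6) := by
    refine c₁.mono ?_
    have : (tree m F (g ^ t)).val.length * (2 * U ^ 4) ≤ U * (2 * U ^ 4) := by
      rw [hv, List.length_map]
      exact Nat.mul_le_mul_right _ (by omega)
    linarith
  rw [recoverTree]
  refine (costLe_inRange h ht).bind (B := 2 * U + (3 * U ^ 8 + (U ^ 6 + U ^ 2))) ?_ (by linarith)
  split_ifs
  · refine (costLe_gpow _ ht).bind (B := 3 * U ^ 8 + (U ^ 6 + U ^ 2)) ?_ le_rfl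
    rw [val_gpow]
    refine ct.bind (c₁'.bind ?_ le_rfl) le_rfl
    rcases ho : (treeCollect m (tree m F (g ^ t)).val 1).val with - | d
    · exact (costLe_ret _).mono (by nlinarith)
    · exact costLe_op ((h.small_pow hlen).mono (c₂ d ho)) ht _
  · exact (costLe_ret _).mono (by omega)

theorem costLe_recover (R : Recovery) (h : Large U n m) (g : G) {t : ℕ} (ht : Small U t) :
    (recover R m m (primesUpTo m).val g t).CostLe (U ^ 9) := by
  have hF : ∀ q ∈ (primesUpTo m).val, q.Prime ∧ q ≤ m := fun q => mem_primesUpTo.1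
  cases R with
  | stack =>
    exact (costLe_recoverStack h (fun q hq => ⟨(hF q hq).1.two_le, (hF q hq).2⟩)
      (length_primesUpTo_le m) g ht).mono (Nat.pow_le_pow_right (by have := h.hundred_le; omega)
        (by norm_num))
  | tree => exact costLe_recoverTree h hF (length_primesUpTo_le m) g ht

theorem costLe_filterCandidates (h : Large U n m) (g : G) {S : List ℕ}
    (hS : ∀ t ∈ S, Small U t) (hlen : S.length ≤ U) :
    (filterCandidates m m (primesUpTo m).val g S).CostLe (U ^ 7) := by
  obtain ⟨h1, h2, h3, h4, h5, h6, -⟩ := hundred_mul_pow_le h.hundred_le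
  have hU := h.hundred_le
  have hm : 1 ≤ m := by have := h.two_le; omega
  have hF : ∀ q ∈ (primesUpTo m).val, 2 ≤ q ∧ q ≤ m := fun q hq =>
    ⟨(mem_primesUpTo.1 hq).1.two_le, (mem_primesUpTo.1 hq).2⟩
  have hs : Small U (prodMaxPow m (primesUpTo m).val).val := by
    rw [val_prodMaxPow hm fun q hq => (hF q hq).1]
    exact (h.small_pow (length_primesUpTo_le m)).mono (smoothBound_le hm _)
  refine (costLe_prodMaxPow h hF (length_primesUpTo_le m)).bind ((costLe_gpow _ hs).bind
    (costLe_filterT (A := U ^ 2 + (2 * U + 1)) fun t ht => ?_) le_rfl) ?_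
  · refine (costLe_inRange h (hS t ht)).bind (B := 2 * U + 1) ?_ le_rfl
    split_ifs
    · exact (costLe_gpow _ (hS t ht)).bind (costLe_isOne _) le_rfl
    · exact (costLe_ret _).mono (by omega)
  · have : S.length * (U ^ 2 + (2 * U + 1) + 1) ≤ U * (U ^ 2 + (2 * U + 1) + 1) :=
      Nat.mul_le_mul_right _ hlen
    linarith

theorem minimumT_spec {l : List (Option ℕ)} {D : ℕ} (hD : Small U D)
    (hl : ∀ a, some a ∈ l → a ≤ D) :
    (minimumT l).CostLe (l.length * (U ^ 2 + 1) + 1) ∧ ∀ a, (minimumT l).val = some a → a ≤ D := by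
  induction l with
  | nil => exact ⟨(costLe_ret _).mono (by simp), by simp [minimumT]⟩
  | cons o l ih =>
    obtain ⟨ih₁, ih₂⟩ := ih fun a h => hl a (List.mem_cons_of_mem _ h)
    rw [List.length_cons]
    cases o with
    | none => exact ⟨ih₁.bind (costLe_ret _) (by linarith [Nat.zero_le (U ^ 2)]), ih₂⟩
    | some a =>
      have ha := hl a (by simp)
      rcases ho : (minimumT l).val with - | b
      · refine ⟨ih₁.bind (B := 1) ?_ (by linarith [Nat.zero_le (U ^ 2)]), ?_⟩
        · rw [ho]; exact costLe_ret _
        · simpa [minimumT, ho] using ha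
      · have hb := ih₂ b ho
        refine ⟨ih₁.bind (B := U ^ 2) ?_ (by linarith), ?_⟩
        · rw [ho]; exact costLe_op (hD.mono ha) (hD.mono hb) _
        · simp only [minimumT, val_bind, ho, val_op, Option.some.injEq]
          rintro _ rfl
          omega

end Recover

/-! ### Bounds for the time: the solvers -/

section Solvers

variable {U n m : ℕ}

theorem Large.small_two_pow (h : Large U n m) {a k : ℕ} (ha : a ≤ 2 ^ k) (hk : k ≤ 4 * n + 48) :
    Small U a := by
  refine small_of_le_two_pow ha ?_
  have := h.lt
  have : 0 ≤ m * m := Nat.zero_le _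
  have := h.two_le; have := h.le
  nlinarith

/-- One step of the continued fraction expansion. -/
theorem cfLoop_step (h : Large U n m) {a b q₂ q₁ A : ℕ} (ha : a ≤ 2 ^ n) (hb : b ≤ 2 ^ n)
    (hq₂ : q₂ ≤ 2 ^ n) (hq₁ : q₁ ≤ 2 ^ n) (hA : 1 ≤ A)
    (hrec : b ≠ 0 → ∀ q ≤ 2 ^ n, (cfLoop (2 ^ n) b (a % b) q₁ q).CostLe A ∧
      (cfLoop (2 ^ n) b (a % b) q₁ q).val ≤ 2 ^ n) :
    (cfLoop (2 ^ n) a b q₂ q₁).CostLe (5 * U ^ 2 + A) ∧ (cfLoop (2 ^ n) a b q₂ q₁).val ≤ 2 ^ n := by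
  have hM : 1 ≤ 2 ^ n := Nat.one_le_two_pow
  have p2 : 2 ^ n * 2 ^ n = 2 ^ (2 * n) := by rw [← pow_add]; congr 1; ring
  have ht : a / b ≤ 2 ^ n := (Nat.div_le_self _ _).trans ha
  have hs : a / b * q₁ ≤ 2 ^ (2 * n) := p2 ▸ Nat.mul_le_mul ht hq₁
  have hq : a / b * q₁ + q₂ ≤ 2 ^ (2 * n + 1) := by
    have : 2 ^ n ≤ 2 ^ (2 * n) := Nat.pow_le_pow_right (by norm_num) (by omega)
    rw [pow_succ]; omega
  have hqq : (a / b * q₁ + q₂) * (a / b * q₁ + q₂) ≤ 2 ^ (4 * n + 2) := by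
    refine (Nat.mul_le_mul hq hq).trans_eq ?_
    rw [← pow_add]; congr 1; ring
  have sM : ∀ a ≤ 2 ^ n, Small U a := fun a ha => h.small_two_pow ha (by omega)
  rw [cfLoop]
  split_ifs with h0
  · exact ⟨(costLe_ret _).mono (by omega), hq₁⟩
  · have hb' := hrec h0
    constructor
    · refine (costLe_op (sM a ha) (sM b hb) _).bind ((costLe_op (sM _ ht) (sM _ hq₁) _).bind
        ((costLe_op (h.small_two_pow hs (by omega)) (sM _ hq₂) _).bind
        ((costLe_op (h.small_two_pow hq (by omega)) (h.small_two_pow hq (by omega)) _).bind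
        ((costLe_op (h.small_two_pow hqq (by omega)) (sM _ le_rfl) _).bind (B := A) ?_ le_rfl)
        le_rfl) le_rfl) le_rfl) (by omega)
      by_cases hc : (a / b * q₁ + q₂) * (a / b * q₁ + q₂) < 2 ^ n
      · simp only [val_op, hc, decide_true, if_true]
        exact (hb' _ ((Nat.le_mul_self _).trans hc.le)).1
      · simp only [val_op, hc, decide_false]
        exact (costLe_ret _).mono hA
    · by_cases hc : (a / b * q₁ + q₂) * (a / b * q₁ + q₂) < 2 ^ n
      · simp only [val_bind, val_op, hc, decide_true, if_true]
        exact (hb' _ ((Nat.le_mul_self _).trans hc.le)).2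
      · simp only [val_bind, val_op, hc, decide_false]
        exact hq₁

/-- Each division step halves the product of the two remainders. -/
theorem cfLoop_spec (h : Large U n m) (k : ℕ) {a b q₂ q₁ : ℕ} (hba : b ≤ a) (hab : a * b < 2 ^ k)
    (ha : a ≤ 2 ^ n) (hq₂ : q₂ ≤ 2 ^ n) (hq₁ : q₁ ≤ 2 ^ n) :
    (cfLoop (2 ^ n) a b q₂ q₁).CostLe ((k + 1) * (5 * U ^ 2) + 1) ∧
      (cfLoop (2 ^ n) a b q₂ q₁).val ≤ 2 ^ n := by
  induction k generalizing a b q₂ q₁ with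
  | zero =>
    have hb0 : b = 0 := by nlinarith
    obtain ⟨h₁, h₂⟩ := cfLoop_step h (A := 1) ha (hba.trans ha) hq₂ hq₁ le_rfl
      (fun hb => absurd hb0 hb)
    exact ⟨h₁.mono (by omega), h₂⟩
  | succ k ih =>
    have := cfLoop_step h (A := (k + 1) * (5 * U ^ 2) + 1) ha (hba.trans ha) hq₂ hq₁ (by omega)
      fun hb q hq => by
        have hmod := Nat.mod_lt a (Nat.pos_of_ne_zero hb)
        refine ih hmod.le ?_ (hba.trans ha) hq₁ hq
        have h₁ := Nat.div_add_mod a b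
        have h₂ : 1 ≤ a / b := Nat.div_pos hba (Nat.pos_of_ne_zero hb)
        have h₃ : b ≤ b * (a / b) := Nat.le_mul_of_pos_right _ h₂
        have h₄ : 2 * (a % b) ≤ a := by omega
        have h₅ : b * (2 * (a % b)) ≤ b * a := Nat.mul_le_mul_left _ h₄
        rw [pow_succ] at hab
        linarith
    exact ⟨this.1.mono (by linarith), this.2⟩

/-- As `j` may be less than `2 ^ n`, the first division is counted apart: after it, the remainders
decrease. -/
theorem cfSolve_spec (h : Large U n m) {j : ℕ} (hj : j ≤ 2 ^ n) :
    (cfSolve n j).CostLe (U ^ 4) ∧ (cfSolve n j).val ≤ 2 ^ (n + 2) := by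
  have hle : 2 ^ n ≤ 2 ^ (n + 2) := Nat.pow_le_pow_right (by norm_num) (by omega)
  have := cfLoop_step h (A := (2 * n + 1 + 1) * (5 * U ^ 2) + 1) hj le_rfl (q₂ := 1) (q₁ := 0)
    Nat.one_le_two_pow (Nat.zero_le _) (by omega) fun hb q hq => by
      have hmod := Nat.mod_lt j (Nat.pos_of_ne_zero hb)
      refine cfLoop_spec h (2 * n + 1) hmod.le ?_ le_rfl (Nat.zero_le _) hq
      have : 2 ^ n * (j % 2 ^ n) ≤ 2 ^ n * 2 ^ n := Nat.mul_le_mul_left _ hmod.le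
      have e : 2 ^ (2 * n + 1) = 2 * (2 ^ n * 2 ^ n) := by rw [← pow_add]; ring
      have : 1 ≤ 2 ^ n * 2 ^ n := Nat.mul_pos (by positivity) (by positivity)
      omega
  refine ⟨this.1.mono ?_, this.2.trans hle⟩
  obtain ⟨h1, h2, h3, -⟩ := hundred_mul_pow_le h.hundred_le
  have hU := h.hundred_le
  have hn : 2 * n + 1 + 1 ≤ U := by have := h.lt; omega
  have : (2 * n + 1 + 1) * (5 * U ^ 2) ≤ U * (5 * U ^ 2) := Nat.mul_le_mul_right _ hn
  linarith

theorem natAbs_le_of_sqNorm {A : ℕ} {x : ℤ × ℤ} (h : sqNorm x ≤ A ^ 2) :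
    x.1.natAbs ≤ A ∧ x.2.natAbs ≤ A := by
  rw [sqNorm] at h
  constructor
  · refine (Nat.pow_le_pow_iff_left two_ne_zero).1 ?_
    nlinarith [Nat.zero_le (x.1.natAbs ^ 2), Nat.zero_le (x.2.natAbs ^ 2)]
  · refine (Nat.pow_le_pow_iff_left two_ne_zero).1 ?_
    nlinarith [Nat.zero_le (x.1.natAbs ^ 2), Nat.zero_le (x.2.natAbs ^ 2)]

/-- A bound for `16 * A ^ 3` is a bound for all numbers that occur in the reduction of vectors with
components at most `A`. -/
theorem costLe_sqNormT {A : ℕ} (hA : 1 ≤ A) (hU : Small U (16 * A ^ 3)) {x : ℤ × ℤ}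
    (hx : x.1.natAbs ≤ A ∧ x.2.natAbs ≤ A) : (sqNormT x).CostLe (4 * U ^ 2) := by
  have h₁ : x.1.natAbs ^ 2 ≤ A ^ 2 := Nat.pow_le_pow_left hx.1 2
  have h₂ : x.2.natAbs ^ 2 ≤ A ^ 2 := Nat.pow_le_pow_left hx.2 2
  have a₂ : A ≤ A ^ 2 := Nat.le_self_pow (by norm_num) _
  have a₃ : A ^ 2 ≤ A ^ 3 := Nat.pow_le_pow_right hA (by norm_num)
  refine (costLe_iop (hU.mono (by omega)) (hU.mono (by omega)) _).bind
    ((costLe_iop (hU.mono (by omega)) (hU.mono (by omega)) _).bind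
    ((costLe_op (hU.mono (by omega)) (hU.mono ?_) _).bind
    (costLe_op (hU.mono ?_) (hU.mono ?_) _) le_rfl) le_rfl) (by omega) <;>
    simp only [val_iop, val_op] <;> omega

theorem natAbs_inner4_le {A : ℕ} {x y : ℤ × ℤ} (hx : x.1.natAbs ≤ A ∧ x.2.natAbs ≤ A)
    (hy : y.1.natAbs ≤ A ∧ y.2.natAbs ≤ A) : (inner4 x y).natAbs ≤ 5 * A ^ 2 := by
  have h₁ : (x.1 * y.1).natAbs ≤ A ^ 2 := by
    rw [Int.natAbs_mul, sq]; exact Nat.mul_le_mul hx.1 hy.1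
  have h₂ : (x.2 * y.2).natAbs ≤ A ^ 2 := by
    rw [Int.natAbs_mul, sq]; exact Nat.mul_le_mul hx.2 hy.2
  rw [inner4]; omega

theorem costLe_innerT {A : ℕ} (hA : 1 ≤ A) (hU : Small U (16 * A ^ 3)) {x y : ℤ × ℤ}
    (hx : x.1.natAbs ≤ A ∧ x.2.natAbs ≤ A) (hy : y.1.natAbs ≤ A ∧ y.2.natAbs ≤ A) :
    (innerT x y).CostLe (4 * U ^ 2) := by
  have h₁ : (x.1 * y.1).natAbs ≤ A ^ 2 := by
    rw [Int.natAbs_mul, sq]; exact Nat.mul_le_mul hx.1 hy.1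
  have h₂ : (x.2 * y.2).natAbs ≤ A ^ 2 := by
    rw [Int.natAbs_mul, sq]; exact Nat.mul_le_mul hx.2 hy.2
  have a₂ : A ≤ A ^ 2 := Nat.le_self_pow (by norm_num) _
  have a₃ : A ^ 2 ≤ A ^ 3 := Nat.pow_le_pow_right hA (by norm_num)
  refine (costLe_iop (hU.mono (by omega)) (hU.mono (by omega)) _).bind
    ((costLe_iop (hU.mono (by omega)) (hU.mono (by omega)) _).bind
    ((costLe_iop (hU.mono (by omega)) (hU.mono ?_) _).bind
    (costLe_iop (hU.mono ?_) (hU.mono ?_) _) le_rfl) le_rfl) (by omega) <;>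
    simp only [val_iop] <;> omega

theorem costLe_reduceT {A : ℕ} (hA : 1 ≤ A) (hU : Small U (16 * A ^ 3)) (hU1 : 1 ≤ U)
    {x y : ℤ × ℤ}
    (hx : x.1.natAbs ≤ A ∧ x.2.natAbs ≤ A) (hy : y.1.natAbs ≤ A ∧ y.2.natAbs ≤ A) :
    (reduceT x y).CostLe (17 * U ^ 2) := by
  have a₂ : A ≤ A ^ 2 := Nat.le_self_pow (by norm_num) _
  have a₃ : A ^ 2 ≤ A ^ 3 := Nat.pow_le_pow_right hA (by norm_num)
  have hp := natAbs_inner4_le hx hy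
  have hs : sqNorm x ≤ 5 * A ^ 2 := by
    have h₁ : x.1.natAbs ^ 2 ≤ A ^ 2 := Nat.pow_le_pow_left hx.1 2
    have h₂ : x.2.natAbs ^ 2 ≤ A ^ 2 := Nat.pow_le_pow_left hx.2 2
    rw [sqNorm]; omega
  have ha : (2 * inner4 x y + sqNorm x).natAbs ≤ 15 * A ^ 2 := by omega
  have ht : (roundCoeff x y).natAbs ≤ 15 * A ^ 2 :=
    (Int.natAbs_ediv_le_natAbs _ _).trans ha
  have hc₁ : (roundCoeff x y * x.1).natAbs ≤ 15 * A ^ 3 := by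
    rw [Int.natAbs_mul, pow_succ A 2, ← mul_assoc]; exact Nat.mul_le_mul ht hx.1
  have hc₂ : (roundCoeff x y * x.2).natAbs ≤ 15 * A ^ 3 := by
    rw [Int.natAbs_mul, pow_succ A 2, ← mul_assoc]; exact Nat.mul_le_mul ht hx.2
  have hU2 : 1 ≤ U ^ 2 := Nat.one_le_pow _ _ hU1
  rw [reduceT]
  refine (costLe_innerT hA hU hx hy).bind (B := 13 * U ^ 2) ?_ (by omega)
  refine (costLe_sqNormT hA hU hx).bind (B := 9 * U ^ 2) ?_ (by omega)
  rw [val_innerT, val_sqNormT]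
  refine (costLe_iop (hU.mono (by omega)) (hU.mono (by omega)) _).bind
    (B := 8 * U ^ 2) ?_ (by omega)
  refine (costLe_iop (hU.mono ?_) (hU.mono ?_) _).bind (B := 7 * U ^ 2) ?_ (by omega)
  · simp only [val_iop]; omega
  · omega
  refine (costLe_iop (hU.mono (by omega)) (hU.mono ?_) _).bind (B := 6 * U ^ 2) ?_ (by omega)
  · omega
  simp only [val_iop]
  refine (costLe_iop (hU.mono (by omega)) (hU.mono (by omega)) _).bind
    (B := 5 * U ^ 2) ?_ (by omega)
  rw [val_iop, ← roundCoeff]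
  refine (costLe_iop (hU.mono (by omega)) (hU.mono (by omega)) _).bind
    (B := 4 * U ^ 2) ?_ (by omega)
  refine (costLe_iop (hU.mono (by omega)) (hU.mono (by omega)) _).bind
    (B := 3 * U ^ 2) ?_ (by omega)
  rw [val_iop, val_iop]
  refine (costLe_iop (hU.mono (by omega)) (hU.mono (by omega)) _).bind
    (B := 2 * U ^ 2) ?_ (by omega)
  refine (costLe_iop (hU.mono (by omega)) (hU.mono (by omega)) _).bind
    (B := 1 * U ^ 2) ?_ (by omega)
  exact (costLe_ret _).mono (by omega)

/-- A reduction step that does not shrink the square of the norm by a factor `3` is followed by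
the end of the algorithm. -/
theorem sqNorm_le_sqNorm_reduceT {x z : ℤ × ℤ} (hz : 0 < sqNorm z)
    (hxz : 2 * |inner4 x z| ≤ sqNorm x) (hlt : sqNorm z < sqNorm x)
    (h3 : sqNorm x < 3 * sqNorm z) : sqNorm z ≤ sqNorm (reduceT z x).val := by
  have hz' : (0 : ℤ) < sqNorm z := by exact_mod_cast hz
  have hc : inner4 z x = inner4 x z := by simp [inner4]; ring
  have ht₁ : -1 ≤ roundCoeff z x := by
    rw [roundCoeff, Int.le_ediv_iff_mul_le (by omega), hc]
    have := neg_abs_le (inner4 x z)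
    omega
  have ht₂ : roundCoeff z x < 2 := by
    rw [roundCoeff, Int.ediv_lt_iff_lt_mul (by omega), hc]
    have := le_abs_self (inner4 x z)
    omega
  have e : (sqNorm (reduceT z x).val : ℤ) =
      sqNorm x - 2 * roundCoeff z x * inner4 x z + roundCoeff z x ^ 2 * sqNorm z := by
    rw [val_reduceT, cast_sqNorm, cast_sqNorm, cast_sqNorm]
    simp [inner4]; ring
  have h₁ := neg_abs_le (inner4 x z)
  have h₂ := le_abs_self (inner4 x z)
  zify
  rw [e]
  generalize roundCoeff z x = t at ht₁ ht₂
  obtain rfl | rfl | rfl : t = -1 ∨ t = 0 ∨ t = 1 := by omega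
  · linarith
  · zify at hlt; linarith
  · linarith

theorem sqNorm_reduceT_le {x : ℤ × ℤ} (hx : 0 < sqNorm x) (y : ℤ × ℤ) :
    sqNorm (reduceT x y).val ≤ sqNorm y := by
  have hz := two_mul_abs_inner4_reduceT_le hx y
  have hx' : (0 : ℤ) < sqNorm x := by exact_mod_cast hx
  rw [val_reduceT] at hz ⊢
  generalize roundCoeff x y = t at hz ⊢
  have e : (sqNorm y : ℤ) = sqNorm (y - t • x) + 2 * t * inner4 x (y - t • x) +
      t ^ 2 * sqNorm x := by
    rw [cast_sqNorm, cast_sqNorm, cast_sqNorm]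
    simp [inner4]; ring
  have h₁ : -(|t| * sqNorm x) ≤ 2 * t * inner4 x (y - t • x) := by
    have h₂ := neg_abs_le (2 * t * inner4 x (y - t • x))
    rw [abs_mul, abs_mul, abs_two] at h₂
    have : |t| * (2 * |inner4 x (y - t • x)|) ≤ |t| * sqNorm x := by gcongr
    linarith
  have h₃ : |t| ≤ t ^ 2 := by
    rw [← sq_abs]
    rcases eq_or_ne t 0 with rfl | h
    · simp
    · have := Int.one_le_abs h
      nlinarith
  zify
  nlinarith

/-- One step of Lagrange's algorithm costs at most `26 * U ^ 2`. -/
theorem lagrange_step {A : ℕ} (hA : 1 ≤ A) (hU : Small U (16 * A ^ 3)) (hU1 : 1 ≤ U)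
    {x y : ℤ × ℤ} (hx0 : 0 < sqNorm x) (hx : sqNorm x ≤ A ^ 2) (hy : sqNorm y ≤ A ^ 2) {B : ℕ}
    (hB : sqNorm (reduceT x y).val < sqNorm x → (lagrange (reduceT x y).val x).CostLe B)
    (hB1 : 1 ≤ B) : (lagrange x y).CostLe (26 * U ^ 2 + B) := by
  have a₂ : A ≤ A ^ 2 := Nat.le_self_pow (by norm_num) _
  have a₃ : A ^ 2 ≤ A ^ 3 := Nat.pow_le_pow_right hA (by norm_num)
  have hz := (sqNorm_reduceT_le hx0 y).trans hy
  rw [lagrange]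
  refine (costLe_reduceT hA hU hU1 (natAbs_le_of_sqNorm hx) (natAbs_le_of_sqNorm hy)).bind
    ((costLe_sqNormT hA hU (natAbs_le_of_sqNorm hz)).bind
    ((costLe_sqNormT hA hU (natAbs_le_of_sqNorm hx)).bind
    ((costLe_op (U := U) ?_ ?_ _).bind (B := B) ?_ le_rfl) le_rfl) le_rfl) (by omega)
  · rw [val_sqNormT]; exact hU.mono (by omega)
  · rw [val_sqNormT]; exact hU.mono (by omega)
  · split_ifs with h
    · exact hB h
    · exact (costLe_ret _).mono hB1

/-- Either the squared norm shrinks by a factor of at least two in each step, or the next step is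
the last one. -/
theorem costLe_lagrange {A : ℕ} (hA : 1 ≤ A) (hU : Small U (16 * A ^ 3)) (hU1 : 1 ≤ U) (k : ℕ)
    {x y : ℤ × ℤ} (hxy : det2 x y ≠ 0) (hx : sqNorm x ≤ A ^ 2) (hy : sqNorm y ≤ A ^ 2)
    (hk : sqNorm x < 2 ^ k) : (lagrange x y).CostLe ((k + 1) * (26 * U ^ 2) + 1) := by
  have hx0 := sqNorm_pos_of_det2 hxy
  induction k generalizing x y with
  | zero => omega
  | succ k ih =>
    set z := (reduceT x y).val with hzdef
    have hd : det2 z x ≠ 0 := by rw [det2_reduceT]; simpa using hxy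
    have hz0 := sqNorm_pos_of_det2 hd
    have hxz := two_mul_abs_inner4_reduceT_le hx0 y
    rw [← hzdef] at hxz
    refine (lagrange_step hA hU hU1 hx0 hx hy (B := (k + 1) * (26 * U ^ 2) + 1) (fun hlt => ?_)
      (by omega)).mono (by linarith)
    rw [← hzdef] at hlt ⊢
    rcases Nat.lt_or_ge (sqNorm x) (3 * sqNorm z) with h3 | h3
    · have hend := sqNorm_le_sqNorm_reduceT hz0 hxz hlt h3
      refine (lagrange_step hA hU hU1 hz0 (hlt.le.trans hx) hx (B := 1)
        (fun h => absurd h (by omega)) le_rfl).mono ?_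
      have : 1 * (26 * U ^ 2) ≤ (k + 1) * (26 * U ^ 2) := Nat.mul_le_mul_right _ (by omega)
      omega
    · exact ih hd (hlt.le.trans hx) hx (by rw [pow_succ] at hk; omega) hz0

theorem latticeSolve_spec (h : Large U n m) {j : ℕ} (hj : j ≤ 2 ^ n) :
    (latticeSolve n j).CostLe (U ^ 4) ∧ (latticeSolve n j).val ≤ 2 ^ (n + 2) := by
  have hn : 1 ≤ n := by have := h.le; have := h.two_le; omega
  have hU := h.hundred_le
  have hM : 1 ≤ 2 ^ n := Nat.one_le_two_pow
  have e₂ : (2 ^ (n + 2)) ^ 2 = 16 * (2 ^ n) ^ 2 := by ring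
  have hM2 : 1 ≤ (2 ^ n) ^ 2 := Nat.one_le_pow _ _ hM
  have hjj : j ^ 2 ≤ (2 ^ n) ^ 2 := Nat.pow_le_pow_left hj 2
  have hx : sqNorm ((j : ℤ), 1) ≤ 5 * (2 ^ n) ^ 2 := by simp [sqNorm]; omega
  have hy : sqNorm ((2 : ℤ) ^ n, 0) ≤ 5 * (2 ^ n) ^ 2 := by
    simp [sqNorm, Int.natAbs_pow]; omega
  have hdet : det2 ((j : ℤ), 1) ((2 : ℤ) ^ n, 0) ≠ 0 := by simp [det2]
  have hs : Small U (16 * (2 ^ (n + 2)) ^ 3) := by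
    refine small_of_le_two_pow (k := 3 * n + 10) (le_of_eq (by ring)) ?_
    have := h.lt; omega
  have hc := costLe_lagrange (A := 2 ^ (n + 2)) Nat.one_le_two_pow hs (by omega) (2 * n + 3) hdet
    (by omega) (by omega) (by
      have : 2 ^ (2 * n + 3) = 8 * (2 ^ n) ^ 2 := by ring
      omega)
  obtain ⟨-, -, hmin⟩ := lagrange_shortest _ _ hdet
  have hmin' := hmin 1 0 (by simp [Prod.ext_iff])
  rw [one_smul, zero_smul, add_zero] at hmin'
  refine ⟨hc.bind (costLe_ret _) ?_, ?_⟩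
  · obtain ⟨h1, h2, h3, -⟩ := hundred_mul_pow_le hU
    have hn : 26 * (2 * n + 3 + 1) ≤ U * 26 := by have := h.lt; omega
    have : 26 * (2 * n + 3 + 1) * U ^ 2 ≤ U * 26 * U ^ 2 := Nat.mul_le_mul_right _ hn
    linarith
  · exact (natAbs_le_of_sqNorm (hmin'.trans (hx.trans (by omega)))).2

theorem solve_spec (A : Solver) (h : Large U n m) {j : ℕ} (hj : j ≤ 2 ^ n) :
    (solve A n j).CostLe (U ^ 4) ∧ (solve A n j).val ≤ 2 ^ (n + 2) := by
  cases A with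
  | continuedFractions => exact cfSolve_spec h hj
  | lattice => exact latticeSolve_spec h hj

theorem neighbours_spec (h : Large U n m) {j : ℕ} (hj : j < 2 ^ n) :
    (neighbours n m j).CostLe (U ^ 5) ∧ (neighbours n m j).val.length = 2 * m + 1 ∧
      ∀ a ∈ (neighbours n m j).val, a ≤ 2 ^ n := by
  have hn : m ≤ 2 ^ n := h.le.trans Nat.lt_two_pow_self.le
  have hU := h.hundred_le
  have hm2 := h.two_le
  obtain ⟨h1, h2, h3, h4, -⟩ := hundred_mul_pow_le hU
  have hlt := h.lt
  have hle := h.le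
  have s₂ : Small U (2 ^ (n + 4)) := h.small_two_pow le_rfl (by omega)
  have e₂ : 2 ^ (n + 4) = 16 * 2 ^ n := by ring
  rw [neighbours_eq]
  refine ⟨(costLe_rangeT (s₂.mono (by omega))).bind (costLe_mapT (A := 3 * U ^ 2) ?_) ?_, ?_, ?_⟩
  · intro s hs
    obtain ⟨i, hi, rfl⟩ := List.mem_map.1 hs
    have hi' := List.mem_range'_1.1 hi
    have e : ((2 : ℤ) ^ n).natAbs = 2 ^ n := by simp [Int.natAbs_pow]
    refine (costLe_iop (s₂.mono (by omega)) (s₂.mono (by omega)) _).bind (B := 2 * U ^ 2) ?_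
      (by omega)
    refine (costLe_iop (s₂.mono ?_) (s₂.mono (by omega)) _).bind (B := 1 * U ^ 2) ?_ (by omega)
    · simp only [val_iop]; omega
    refine (costLe_iop (s₂.mono ?_) (s₂.mono (by omega)) _).mono (by omega)
    simp only [val_iop]; omega
  · simp only [val_rangeT, List.length_map, List.length_range']
    have e₁ : (2 * m + 1) * U ≤ U * U := Nat.mul_le_mul_right _ (by omega)
    have e₃ : (2 * m + 1) * (3 * U ^ 2 + 1) ≤ U * (3 * U ^ 2 + 1) :=
      Nat.mul_le_mul_right _ (by omega)
    linarith
  · simp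
  · intro a ha
    simp only [val_bind, val_mapT, val_iop, List.mem_map] at ha
    obtain ⟨s, -, rfl⟩ := ha
    have hp : (0 : ℤ) < 2 ^ n := by positivity
    have := Int.emod_lt_of_pos ((j : ℤ) - m + s) hp
    have h0 := Int.emod_nonneg ((j : ℤ) - m + s) hp.ne'
    zify
    rw [Int.toNat_of_nonneg h0]
    exact this.le

end Solvers

/-! ### Bounds for the time: the circuit -/

section CircuitSize

variable {G : Type u} [Group G]

theorem cmulGates_spec {n : ℕ} (l : List (Fin n)) (h : G) :
    (cmulGates l h).CostLe (l.length + 1) ∧ (cmulGates l h).val.length = l.length := by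
  induction l generalizing h with
  | nil => exact ⟨costLe_ret _, rfl⟩
  | cons i l ih =>
    obtain ⟨h₁, h₂⟩ := ih (h * h)
    refine ⟨⟨?_, ?_⟩, ?_⟩
    · have := h₁.1
      simp [cmulGates, gmul] at this ⊢
      omega
    · have := h₁.2
      simp [cmulGates, gmul] at this ⊢
      omega
    · simp [cmulGates, gmul] at h₂ ⊢
      exact h₂

theorem length_qft_le {G : Type u} (n : ℕ) : (qft n G).length ≤ n * (n + 1) := by
  rw [qft, List.length_flatMap]
  refine (List.sum_le_card_nsmul _ (n + 1) fun a ha => ?_).trans (by simp)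
  obtain ⟨i, -, rfl⟩ := List.mem_map.1 ha
  simp only [List.length_cons, List.length_map]
  exact Nat.succ_le_succ ((List.length_filter_le _ _).trans (by simp))

theorem Gate.time_le {G : Type u} {n : ℕ} (τ : ℕ) (γ : Gate n G) : γ.time τ ≤ 1 + τ := by
  cases γ <;> simp [Gate.time]

theorem circuit_spec (n : ℕ) (g : G) :
    (circuit n g).CostLe (n * (n + 1) + 3 * n + 1) ∧
      (circuit n g).val.length ≤ n * (n + 1) + 2 * n := by
  obtain ⟨h₁, h₂⟩ := cmulGates_spec (List.finRange n) g
  have h₃ := length_qft_le (G := G) n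
  rw [List.length_finRange] at h₁ h₂
  refine ⟨h₁.bind (B := n * (n + 1) + 2 * n) ⟨?_, Nat.zero_le _⟩ (by omega), ?_⟩
  · dsimp only; omega
  · simp [circuit, h₂]; omega

end CircuitSize

/-! ### Bounds for the time: a run -/

section Total

variable {G : Type u} [Group G] [DecidableEq G] {U m ℓ : ℕ}

/-- The candidates have at most `n + 2` bits and there are `2 * m + 1` of them; recovering `r` from
them dominates the cost. -/
theorem costLe_postProcess [Finite G] (V : Variant) (g : G) (h : Large U (m + ℓ) m) {j : ℕ}
    (hj : j < 2 ^ (m + ℓ)) : (postProcess V g 1 m m ℓ j).CostLe (U ^ 11) := by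
  obtain ⟨h1, h2, h3, h4, h5, h6, h7, h8, h9, h10⟩ := hundred_mul_pow_le h.hundred_le
  have hU := h.hundred_le
  have hlt := h.lt
  have hm := h.two_le
  obtain ⟨n₁, n₂, n₃⟩ := neighbours_spec h hj
  have hmU : m ≤ U := by omega
  rw [postProcess]
  refine (costLe_op (h.small_add_one.mono (by omega)) (h.small_add_one.mono (by omega)) _).bind
    (B := U ^ 6 + (U ^ 5 + (U ^ 6 + (U ^ 7 + (2 * U ^ 10 + U ^ 4))))) ?_ (by linarith)
  rw [val_op, one_mul]
  refine (costLe_primesUpTo hU h.small_add_one hmU).bind (n₁.bind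
    (B := U ^ 6 + (U ^ 7 + (2 * U ^ 10 + U ^ 4))) ?_ le_rfl) le_rfl
  have hlen : (neighbours (m + ℓ) m j).val.length ≤ U := by omega
  have hsolve := costLe_mapT (f := solve V.solver (m + ℓ)) (A := U ^ 4)
    (l := (neighbours (m + ℓ) m j).val) fun a ha => (solve_spec V.solver h (n₃ a ha)).1
  refine (hsolve.mono (B := U ^ 6) ?_).bind
    (B := U ^ 7 + (2 * U ^ 10 + U ^ 4)) ?_ le_rfl
  · have : (neighbours (m + ℓ) m j).val.length * (U ^ 4 + 1) ≤ U * (U ^ 4 + 1) :=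
      Nat.mul_le_mul_right _ hlen
    linarith
  rw [val_mapT]
  set S := (neighbours (m + ℓ) m j).val.map fun a => (solve V.solver (m + ℓ) a).val with hS
  have hSU : ∀ t ∈ S, Small U t := by
    intro t ht
    obtain ⟨a, ha, rfl⟩ := List.mem_map.1 ht
    exact h.small_two_pow (solve_spec V.solver h (n₃ a ha)).2 (by omega)
  have hSlen : S.length ≤ U := by rw [hS, List.length_map]; exact hlen
  have hfilt : (if V.filter = true then filterCandidates m m (primesUpTo m).val g S
      else ret S).CostLe (U ^ 7) := by
    split_ifs
    · exact costLe_filterCandidates h g hSU hSlen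
    · exact (costLe_ret _).mono (by linarith)
  have hfsub : List.Sublist (if V.filter = true then filterCandidates m m (primesUpTo m).val g S
      else ret S).val S := by
    split_ifs
    · rw [val_filterCandidates m (by omega)]
      exact List.filter_sublist
    · exact List.Sublist.refl _
  refine hfilt.bind ?_ le_rfl
  generalize (if V.filter = true then filterCandidates m m (primesUpTo m).val g S
      else ret S).val = S' at hfsub
  have hS'len : S'.length ≤ U := hfsub.length_le.trans hSlen
  have hrec := costLe_mapT (f := recover V.recovery m m (primesUpTo m).val g) (A := U ^ 9) (l := S')
    fun t ht => costLe_recover V.recovery h g (hSU t (hfsub.subset ht))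
  refine (hrec.mono (B := 2 * U ^ 10) ?_).bind (B := U ^ 4) ?_ le_rfl
  · have : S'.length * (U ^ 9 + 1) ≤ U * (U ^ 9 + 1) := Nat.mul_le_mul_right _ hS'len
    linarith
  have hD : Small U (m ^ (primesUpTo m).val.length * 2 ^ m) := by
    refine small_of_le_two_pow (k := m * m + m) ?_ (by omega)
    rw [pow_add]
    refine Nat.mul_le_mul_right _ ?_
    rw [pow_mul]
    exact (Nat.pow_le_pow_left Nat.lt_two_pow_self.le _).trans
      (Nat.pow_le_pow_right (by positivity) (length_primesUpTo_le m))
  refine (minimumT_spec hD fun a ha => ?_).1.mono ?_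
  · rw [val_mapT] at ha
    obtain ⟨t, -, ht⟩ := List.mem_map.1 ha
    rw [val_recover _ _ hm] at ht
    split_ifs at ht with hgood
    rw [Option.some.injEq] at ht
    subst ht
    refine Nat.mul_le_mul ?_ hgood.1.2.le
    refine le_trans (Nat.le_of_dvd ?_ (orderOf_dvd_of_pow_eq_one hgood.2))
      (smoothBound_le (by omega) _)
    refine Nat.pos_of_ne_zero (List.prod_ne_zero fun h0 => ?_)
    obtain ⟨q, hq, h0⟩ := List.mem_map.1 h0
    exact (Nat.pow_pos (n := Nat.log q m) (mem_primesUpTo.1 hq).1.pos).ne' h0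
  · rw [val_mapT, List.length_map]
    have : S'.length * (U ^ 2 + 1) ≤ U * (U ^ 2 + 1) := Nat.mul_le_mul_right _ hS'len
    linarith

/-- The sum of the bounds for constructing the circuit, executing it, measuring `n` qubits and
post-processing. -/
theorem totalTime_le {n a b p s U : ℕ} (hU : U = (n + 10) ^ 2) (hs : 1 ≤ s)
    (ha : a ≤ (n * (n + 1) + 3 * n + 1) * s) (hb : b ≤ (n * (n + 1) + 2 * n) * s)
    (hp : p ≤ U ^ 11 * s) : a + b + n + p ≤ U ^ 12 * s := by
  have hU' : 100 ≤ U := by nlinarith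
  have hsmall : n * (n + 1) + 3 * n + 1 + (n * (n + 1) + 2 * n) + n ≤ 2 * U := by nlinarith
  clear hU
  have h₁ : U ^ 1 ≤ U ^ 11 := Nat.pow_le_pow_right (by omega) (by norm_num)
  have h₂ : 100 * U ^ 11 ≤ U ^ 12 := by
    rw [pow_succ U 11, mul_comm]; exact Nat.mul_le_mul_left _ hU'
  rw [pow_one] at h₁
  have hn : n ≤ n * s := Nat.le_mul_of_pos_right _ hs
  have hfin : n * (n + 1) + 3 * n + 1 + (n * (n + 1) + 2 * n) + n + U ^ 11 ≤ U ^ 12 := by omega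
  calc a + b + n + p ≤ (n * (n + 1) + 3 * n + 1) * s + (n * (n + 1) + 2 * n) * s + n * s
        + U ^ 11 * s := by gcongr
    _ = (n * (n + 1) + 3 * n + 1 + (n * (n + 1) + 2 * n) + n + U ^ 11) * s := by
        simp only [add_mul]
    _ ≤ U ^ 12 * s := Nat.mul_le_mul_right _ hfin

theorem runTime_le [Finite G] (V : Variant) (g : G) (hm : 2 ≤ m) (τ : ℕ) {j : ℕ}
    (hj : j < 2 ^ (m + ℓ)) :
    runTime V τ g 1 m m ℓ j ≤ (m + ℓ + 10) ^ 24 * (1 + τ) := by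
  have hL : Large ((m + ℓ + 10) ^ 2) (m + ℓ) m :=
    ⟨Nat.pow_le_pow_left (show 10 ≤ m + ℓ + 10 by omega) 2, hm, by omega, by nlinarith⟩
  obtain ⟨h₁, h₂⟩ := circuit_spec (m + ℓ) g
  have hgates : ((circuit (m + ℓ) g).val.map (Gate.time τ)).sum ≤
      ((m + ℓ) * (m + ℓ + 1) + 2 * (m + ℓ)) * (1 + τ) := by
    refine (List.sum_le_card_nsmul _ (1 + τ) fun a ha => ?_).trans ?_
    · obtain ⟨γ, -, rfl⟩ := List.mem_map.1 ha
      exact Gate.time_le τ γ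
    · rw [List.length_map, smul_eq_mul]
      exact Nat.mul_le_mul_right _ h₂
  have e : (m + ℓ + 10) ^ 24 = ((m + ℓ + 10) ^ 2) ^ 12 := by rw [← pow_mul]
  rw [runTime, e]
  exact totalTime_le rfl (Nat.le_add_right _ _) (h₁.time_le τ) hgates
    ((costLe_postProcess V g hL hj).time_le τ)

/-- If the number of qubits and the time of one group operation are polynomial in `log r`, then so
is the time of a run. -/
theorem exists_runTime_le (V : Variant) (K k : ℕ) : ∃ K' k' : ℕ, ∀ (G : Type u) [Group G]
    [Fintype G] [DecidableEq G] (g : G) (m ℓ τ j : ℕ), 2 ≤ orderOf g → orderOf g < 2 ^ m →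
    ((m + ℓ : ℕ) : ℝ) ≤ K * Real.logb 2 (orderOf g) ^ k →
    (τ : ℝ) ≤ K * Real.logb 2 (orderOf g) ^ k → j < 2 ^ (m + ℓ) →
    (runTime V τ g 1 m m ℓ j : ℝ) ≤ K' * Real.logb 2 (orderOf g) ^ k' := by
  refine ⟨(K + 10) ^ 24 * (1 + K), k * 24 + k, fun G _ _ _ g m ℓ τ j hr hrm hn hτ hj => ?_⟩
  have hm : 2 ≤ m := by
    by_contra! h
    have : 2 ^ m ≤ 2 ^ 1 := Nat.pow_le_pow_right (by norm_num) (by omega)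
    omega
  have hL : 1 ≤ Real.logb 2 (orderOf g) := by
    rw [Real.le_logb_iff_rpow_le (by norm_num) (by positivity), Real.rpow_one]
    exact_mod_cast hr
  set L := Real.logb 2 (orderOf g)
  have hLk : 1 ≤ L ^ k := one_le_pow₀ hL
  have h₁ : (runTime V τ g 1 m m ℓ j : ℝ) ≤ ((m + ℓ : ℕ) + 10) ^ 24 * (1 + τ) := by
    exact_mod_cast runTime_le V g hm τ hj
  refine h₁.trans ?_
  calc (((m + ℓ : ℕ) : ℝ) + 10) ^ 24 * (1 + τ)
      ≤ ((K + 10) * L ^ k) ^ 24 * ((1 + K) * L ^ k) := by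
        gcongr
        · linarith
        · linarith
    _ = _ := by push_cast; rw [mul_pow, ← pow_mul, pow_add]; ring

end Total

end OrderFinding

theorem mainTheorem5 (V : OrderFinding.Variant) :
    -- the circuit prepares the state of the quantum algorithm, in every finite group
    (∀ (G : Type u) [Group G] [Fintype G] [DecidableEq G] (g : G) (n : ℕ)
        (b : Fin n → Fin 2) (x : G),
      OrderFinding.runGates (OrderFinding.circuit n g).val (OrderFinding.initial n) b x
        = OrderFinding.amplitude n g (OrderFinding.readout b) x) ∧
    -- with `c = 1` and `B = m`, the success probability of a single run tends to one as `r → ∞`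
    (∀ ε : ℝ, 0 < ε → ∃ R : ℕ, ∀ (G : Type u) [Group G] [Fintype G] [DecidableEq G] (g : G)
        (m ℓ : ℕ), 0 < ℓ → R ≤ orderOf g → orderOf g < 2 ^ m → orderOf g ^ 2 < 2 ^ (m + ℓ) →
      1 - ε ≤ OrderFinding.successProb V g 1 m m ℓ) ∧
    -- with the same parameters, a run takes time polynomial in `log r`, if `m`, `ℓ` and the time
    -- `τ` of one group operation are polynomial in `log r`
    (∀ K k : ℕ, ∃ K' k' : ℕ, ∀ (G : Type u) [Group G] [Fintype G] [DecidableEq G] (g : G)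
        (m ℓ τ j : ℕ), 0 < ℓ → 2 ≤ orderOf g → orderOf g < 2 ^ m →
      orderOf g ^ 2 < 2 ^ (m + ℓ) → ((m + ℓ : ℕ) : ℝ) ≤ K * Real.logb 2 (orderOf g) ^ k →
      (τ : ℝ) ≤ K * Real.logb 2 (orderOf g) ^ k → j < 2 ^ (m + ℓ) →
      (OrderFinding.runTime V τ g 1 m m ℓ j : ℝ) ≤ K' * Real.logb 2 (orderOf g) ^ k') := by
  refine ⟨fun G _ _ _ g n b x => OrderFinding.runGates_circuit g b x, fun ε hε => ?_, fun K k => ?_⟩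
  · obtain ⟨R, hR⟩ := OrderFinding.exists_forall_one_sub_le_successProb.{u} V hε
    exact ⟨R, fun G _ _ _ g m ℓ _ h₁ h₂ h₃ => hR G g m ℓ h₁ h₂ h₃⟩
  · obtain ⟨K', k', h⟩ := OrderFinding.exists_runTime_le.{u} V K k
    exact ⟨K', k', fun G _ _ _ g m ℓ τ j _ hr hrm _ hn hτ hj => h G g m ℓ τ j hr hrm hn hτ hj⟩
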